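/- **Setting.** Plant $\dot x=Y(x)\theta+f_0(x)+g(x)u$, $y=Cx$, with $x\in\mathbb R^n$, $u\in\mathbb R^m$, $y\in\mathbb R^q$ and unknown $\theta\in\Theta=\{\|\theta\|\le\bar\theta\}\subset\mathbb R^p$. Let $\mathcal C\subset\mathbb R^n$ be compact and convex and $\mathcal U\subset\mathbb R^m$ bounded. On $\mathcal C$ the functions $Y,f_0,g$ are differentiable and, for all $x\in\mathcal C$, $\theta\in\Theta$, $u\in\mathcal U$ and all $i,j,k,l$, $(K_{y_1})_{jk}\le \partial_kY_{ji}(x)\,\theta_i\le(K_{y_2})_{jk}$, $(K_{f_1})_{jk}\le\partial_k (f_0)_j(x)\le (K_{f_2})_{jk}$, $(K_{g_1})_{jk}\le\partial_kg_{jl}(x)\,u_l\le(K_{g_2})_{jk}$. *State estimator.* With $A=K_{y_1}+K_{f_1}+K_{g_1}$, $F_\theta(x,\theta)=-K_{y_1}x+Y(x)\theta$, $F_1(x)=-K_{f_1}x+f_0(x)$, $G_u(x,u)=-K_{g_1}x+g(x)u$, $$\dot{\hat x}=A\hat x+F_\theta(\hat x+l_1(y-C\hat x),\hat\theta)+F_1(\hat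 x+l_2(y-C\hat x))+G_u(\hat x+l_3(y-C\hat x),u)+L(y-C\hat x),$$ where $\alpha>0$, $P=P^{\mathsf T}>0$, $L,l_1,l_2,l_3$ satisfy $$\begin{bmatrix}(A-LC)^{\mathsf T}P+P(A-LC)+2\alpha P& P-J_{21}^{\mathsf T}\\ P-J_{21}&-3I\end{bmatrix}<0,\qquad J_{21}=-\tfrac12\sum_{(\bullet,i)\in\{(y,1),(f,2),(g,3)\}}(K_{\bullet_2}-K_{\bullet_1})(I-l_iC).$$ *Parameter estimator.* For a delay $T\ge0$ let $\hat{\mathcal Y}(t)=\int_{t-T}^tY(\hat x)$, $\hat{\mathcal G}(t)=\int_{t-T}^t(f_0(\hat x)+g(\hat x)u)$, $\tilde x=x-\hat x$, $\tilde\theta=\theta-\hat\theta$, and $\mathcal E(t)=\hat x(t)-\hat x(t-T)-\hat{\mathcal Y}(t)\theta-\hat{\mathcal G}(t)$. A history stack has $N$ slots, each empty (zero data) or holding the data recorded at a time $t_i\ge T$. For the active main stack put $\sigma_i=(1+\kappa\|\hat{\mathcal Y}(t_i)\|^2)^{-1}$, $\Psi=\sum_i\sigma_i\hat{\mathcal Y}(t_i)^{\mathsf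 T}\hat{\mathcal Y}(t_i)$, $Q=\sum_i\sigma_i\hat{\mathcal Y}(t_i)^{\mathsf T}\mathcal E(t_i)$, $\phi=\sum_i\sigma_i\hat{\mathcal Y}(t_i)^{\mathsf T}\big(\hat x(t_i)-\hat x(t_i-T)-\hat{\mathcal G}(t_i)-\hat{\mathcal Y}(t_i)\hat\theta\big)$. If $\|\hat\theta\|<\bar\theta$, or $\|\hat\theta\|=\bar\theta$ and $(k_\theta\Gamma\phi)^{\mathsf T}\hat\theta\le0$, then $\dot{\hat\theta}=k_\theta\Gamma\phi$ and $\dot\Gamma=\beta_1\Gamma-k_\theta\Gamma\Psi\Gamma$; otherwise $\dot{\hat\theta}=\big(I-\frac{\Gamma\hat\theta\hat\theta^{\mathsf T}}{\hat\theta^{\mathsf T}\Gamma\hat\theta}\big)k_\theta\Gamma\phi$ and $\dot\Gamma=0$. Here $\kappa,k_\theta,\beta_1>0$, $\Gamma(0)=\Gamma_0>0$ is fixed, $\|\hat\theta(0)\|\le\bar\theta$, and solutions are in the sense of Carathéodory. *Recording algorithm.* A main stack $\mathcal H$ and a transient stack $\mathcal G$ start empty, with $\lambda=0$, $\tau_2=0$.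 At each time $t=kt^*\ge T$, $k=1,2,\dots$ ($t^*>0$): let $\lambda'$ be the largest value, over the slots $j$, of the least eigenvalue of the Gram matrix $\sum_i\hat{\mathcal Y}_i^{\mathsf T}\hat{\mathcal Y}_i$ of $\mathcal H$ with slot $j$ replaced by the data of time $t$. If $\lambda'-\lambda\ge\lambda^*$ ($\lambda^*\ge0$), set $\lambda\gets\lambda'$, make a maximizing replacement in $\mathcal H$, and put the data into an empty slot of $\mathcal G$, or, if $\mathcal G$ is full, into a slot where this raises the least eigenvalue of $\sum_i\sigma_i\hat{\mathcal Y}_i^{\mathsf T}\hat{\mathcal Y}_i$ by more than the factor $1+\delta$ (if there is one). If then the least eigenvalue of the Gram matrix of $\mathcal G$ is at least $\xi\lambda$ ($0<\xi\le1$) and $t-\tau_2\ge\mathcal T(t)$ (dwell time), purge: $\mathcal H\gets\mathcal G$, $\mathcal G\gets\emptyset$, $\tau_2\gets t$, and $\lambda$ is raised to the least eigenvalue of the Gram matrix of the new $\mathcal H$ if that is larger. **Theorem.** Fix the plant, the bounds $K_\bullet$, $\mathcal C$, $\mathcal U$, the constants and the dwell-time function of the parameter estimator, and $c_0>0$, $\tau_0$.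 Consider all closed-loop trajectories as above (any $\theta\in\Theta$, any $\alpha,P,L,l_i$ satisfying the matrix inequality, any initial values) with $u(t)\in\mathcal U$, $x(t),\hat x(t)\in\mathcal C$ for all $t\ge0$, such that $(\hat x,u)$ is finitely informative (there are times $T\le t_1<\dots<t_M$, $M\geq 1$, whose stack has $\Psi>0$) and the excitation lasts through two purges: not later than at time $\tau_0$, the stack $\mathcal H_3$ active after the second and before the third purge has $\lambda_{\min}(\Psi)\ge c_0$. There are constants $L_e,\underline\Gamma,\overline\Gamma,\underline c>0$, $\underline a=k_\theta\underline c+\beta_1/\overline\Gamma$, and functions $\beta\in\mathcal{KL}$, $\gamma\in\mathcal K$, the same for all these trajectories, such that the following holds. 1. For each of these trajectories: $\|\hat\theta(t)\|\le\bar\theta$ and $\underline\Gamma I\le\Gamma(t)\le\overline\Gamma I$ for $t\ge0$; $\lambda_{\min}(\Psi(t))\ge\underline c$ for $t\ge \max(0,\tau_0)$; $\|\mathcal E(t)\|\le L_e\sup_{[t-T,t]}\|\tilde x\|$ for $t\ge T$. The parameter error is input-to-state stable with input $\mu=\sqrt{\bar Q}$, where $\bar Q\ge\|Q\|$ on $[t_0,t]$: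 $\|\tilde\theta(t)\|\le\beta(\|\tilde\theta(t_0)\|,t-t_0)+\gamma(\mu)$ for $0\le t_0\le t$. It is ultimately bounded: if $\|Q(t)\|\le\bar Q$ for all large $t$, then $$\limsup_{t\to\infty}\|\tilde\theta(t)\|\le\sqrt{\overline\Gamma/\underline\Gamma}\;\frac{4k_\theta\bar Q}{\underline a},$$ and if for all large $t$ the data in the active stack were recorded with $\|\tilde x\|\le e$ on the recording windows $[t_i-T,t_i]$, then $$\limsup_{t\to\infty}\|\tilde\theta(t)\|\le\sqrt{\frac{\overline\Gamma}{\kappa\underline\Gamma}}\,\frac{2k_\theta NL_e}{\underline a}\,e .$$ 2. For every $\varepsilon>0$ there is $\alpha_0>0$ such that for each of these trajectories for which the points $\hat x+l_i(y-C\hat x)$ stay in $\mathcal C$ and the gain $\alpha$ is large enough, namely $\alpha\ge\alpha_0\sqrt{\lambda_{\max}(P)/\lambda_{\min}(P)}$, one has $\|\tilde x(t)\|\le\varepsilon$ for all $t\ge t^*$ and $$\limsup_{t\to\infty}\|\tilde\theta(t)\|\le\sqrt{\frac{\overline\Gamma}{\kappa\underline\Gamma}}\,\frac{2k_\theta NL_e}{\underline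 a}\,\varepsilon .$$ -/

import Mathlib

open MeasureTheory Filter Topology Set
open scoped Matrix Matrix.Norms.L2Operator

noncomputable section

/-- Euclidean space of column vectors. -/
abbrev Vec (k : ℕ) : Type := EuclideanSpace ℝ (Fin k)

/-- Real `k × l` matrices; `‖·‖` on them is the norm induced by the Euclidean norms. -/
abbrev Mat (k l : ℕ) : Type := Matrix (Fin k) (Fin l) ℝ

/-- Matrix times column vector. -/
def app {k l : ℕ} (M : Mat k l) (v : Vec l) : Vec k := WithLp.toLp 2 (M *ᵥ v.ofLp)

/-- Smallest (real) eigenvalue. -/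
def minEig {k : ℕ} (M : Mat k k) : ℝ := sInf (spectrum ℝ M)

/-- Largest (real) eigenvalue. -/
def maxEig {k : ℕ} (M : Mat k k) : ℝ := sSup (spectrum ℝ M)

/-- `f` solves `f' = r` on `[0, ∞)` in the sense of Carathéodory: it is the integral of its locally
integrable right-hand side `r`. -/
def SolvesODE {E : Type*} [NormedAddCommGroup E] [NormedSpace ℝ E] (f r : ℝ → E) : Prop :=
  ∀ t : ℝ, 0 ≤ t → IntervalIntegrable r volume 0 t ∧ f t = f 0 + ∫ s in (0 : ℝ)..t, r s

/-- Comparison functions of class `𝒦`. -/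
def IsClassK (γ : ℝ → ℝ) : Prop :=
  ContinuousOn γ (Ici 0) ∧ StrictMonoOn γ (Ici 0) ∧ γ 0 = 0

/-- Comparison functions of class `𝒦ℒ`. -/
def IsClassKL (β : ℝ → ℝ → ℝ) : Prop :=
  ContinuousOn (fun z : ℝ × ℝ => β z.1 z.2) (Ici 0 ×ˢ Ici 0) ∧
  (∀ s : ℝ, 0 ≤ s → IsClassK (fun r => β r s)) ∧
  (∀ r : ℝ, 0 ≤ r → AntitoneOn (β r) (Ici 0) ∧ Tendsto (β r) atTop (𝓝 0))

/-- `limsup_{t → ∞} f t ≤ b`. -/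
def LimsupLE (f : ℝ → ℝ) (b : ℝ) : Prop :=
  ∀ δ : ℝ, 0 < δ → ∀ᶠ t in atTop, f t ≤ b + δ

/-! ### The plant `x' = Y(x) θ + f₀(x) + g(x) u`, `y = C x` -/

structure Plant (n m p q : ℕ) where
  Y : Vec n → Mat n p
  f0 : Vec n → Vec n
  g : Vec n → Mat n m
  C : Mat q n

/-- The bounding matrices of the Jacobians. -/
structure JacBounds (n : ℕ) where
  Ky1 : Mat n n
  Ky2 : Mat n n
  Kf1 : Mat n n
  Kf2 : Mat n n
  Kg1 : Mat n n
  Kg2 : Mat n n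

/-- The partial derivative of `h` at `x` with respect to the `k`-th coordinate. -/
def partialD {n : ℕ} (h : Vec n → ℝ) (x : Vec n) (k : Fin n) : ℝ :=
  fderiv ℝ h x (EuclideanSpace.single k 1)

/-- `Y`, `f₀`, `g` are differentiable on `𝒞`, and the element-wise Jacobian bounds hold for all
states in `𝒞`, inputs in `𝒰` and parameters in `Θ`. -/
def JacobianBounded {n m p q : ℕ} (S : Plant n m p q) (K : JacBounds n)
    (𝒞 : Set (Vec n)) (𝒰 : Set (Vec m)) (Θ : Set (Vec p)) : Prop :=
  ∀ x ∈ 𝒞, ∀ j : Fin n,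
    ((∀ i : Fin p, DifferentiableAt ℝ (fun z => S.Y z j i) x) ∧
      DifferentiableAt ℝ (fun z => S.f0 z j) x ∧
      (∀ l : Fin m, DifferentiableAt ℝ (fun z => S.g z j l) x)) ∧
    ∀ k : Fin n,
      (∀ θ ∈ Θ, ∀ i : Fin p,
        K.Ky1 j k ≤ partialD (fun z => S.Y z j i) x k * θ i ∧
        partialD (fun z => S.Y z j i) x k * θ i ≤ K.Ky2 j k) ∧
      (K.Kf1 j k ≤ partialD (fun z => S.f0 z j) x k ∧
        partialD (fun z => S.f0 z j) x k ≤ K.Kf2 j k) ∧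
      (∀ u ∈ 𝒰, ∀ l : Fin m,
        K.Kg1 j k ≤ partialD (fun z => S.g z j l) x k * u l ∧
        partialD (fun z => S.g z j l) x k * u l ≤ K.Kg2 j k)

/-! ### The state estimator -/

/-- `A = K_{y1} + K_{f1} + K_{g1}`. -/
def JacBounds.A {n : ℕ} (K : JacBounds n) : Mat n n := K.Ky1 + K.Kf1 + K.Kg1

/-- `F_θ(x, θ) = -K_{y1} x + Y(x) θ`. -/
def Ftheta {n m p q : ℕ} (S : Plant n m p q) (K : JacBounds n) (x : Vec n) (θ : Vec p) : Vec n :=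
  -app K.Ky1 x + app (S.Y x) θ

/-- `F_1(x) = -K_{f1} x + f₀(x)`. -/
def Fone {n m p q : ℕ} (S : Plant n m p q) (K : JacBounds n) (x : Vec n) : Vec n :=
  -app K.Kf1 x + S.f0 x

/-- `G_u(x, u) = -K_{g1} x + ∑ i, g_i(x) u_i`. -/
def Gu {n m p q : ℕ} (S : Plant n m p q) (K : JacBounds n) (x : Vec n) (u : Vec m) : Vec n :=
  -app K.Kg1 x + app (S.g x) u

/-- The design variables of the state estimator. -/
structure Gains (n q : ℕ) where
  α : ℝ
  P : Mat n n
  L : Mat n q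
  l1 : Mat n q
  l2 : Mat n q
  l3 : Mat n q

/-- The multiplier matrix of the sector with slopes between `K1` and `K2`. -/
def multiplier {n : ℕ} (K1 K2 : Mat n n) : Matrix (Fin n ⊕ Fin n) (Fin n ⊕ Fin n) ℝ :=
  Matrix.fromBlocks 0 (-((1 / 2 : ℝ) • (K2ᵀ - K1ᵀ))) (-((1 / 2 : ℝ) • (K2 - K1))) 1

def J21 {n q : ℕ} (K : JacBounds n) (C : Mat q n) (O : Gains n q) : Mat n n :=
  (multiplier K.Ky1 K.Ky2).toBlocks₂₁ * (1 - O.l1 * C) +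
  (multiplier K.Kf1 K.Kf2).toBlocks₂₁ * (1 - O.l2 * C) +
  (multiplier K.Kg1 K.Kg2).toBlocks₂₁ * (1 - O.l3 * C)

def J22 {n : ℕ} (K : JacBounds n) : Mat n n :=
  (multiplier K.Ky1 K.Ky2).toBlocks₂₂ + (multiplier K.Kf1 K.Kf2).toBlocks₂₂ +
  (multiplier K.Kg1 K.Kg2).toBlocks₂₂

/-- `α > 0`, `P` is symmetric positive definite and the observer matrix inequality holds. -/
def SatisfiesLMI {n q : ℕ} (K : JacBounds n) (C : Mat q n) (O : Gains n q) : Prop :=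
  0 < O.α ∧ O.P.PosDef ∧
  (-(Matrix.fromBlocks
      ((K.A - O.L * C)ᵀ * O.P + O.P * (K.A - O.L * C) + (2 * O.α) • O.P)
      (O.P - (J21 K C O)ᵀ)
      (O.P - J21 K C O)
      (-J22 K))).PosDef

/-! ### The parameter estimator and its history stacks -/

/-- The user-selected constants of the parameter estimator. -/
structure Tuning (p : ℕ) where
  /-- known bound on the norm of the parameters -/
  thetaBar : ℝ
  /-- normalization gain -/
  κ : ℝ
  /-- concurrent-learning gain -/
  kθ : ℝ
  /-- adaptation gain of the least-squares update -/
  β1 : ℝ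
  /-- initial least-squares gain matrix -/
  Γ0 : Mat p p
  /-- number of data points in a history stack -/
  N : ℕ
  /-- time delay -/
  T : ℝ
  /-- sampling period -/
  tstar : ℝ
  /-- eigenvalue threshold -/
  lamStar : ℝ
  /-- purging threshold -/
  ξ : ℝ
  /-- replacement margin of the transient stack -/
  δ : ℝ
  /-- dwell time -/
  dwell : ℝ → ℝ

def Tuning.Valid {p : ℕ} (D : Tuning p) : Prop :=
  0 < D.κ ∧ 0 < D.kθ ∧ 0 < D.β1 ∧ D.Γ0.PosDef ∧ 0 ≤ D.T ∧ 0 < D.tstar ∧ 0 ≤ D.lamStar ∧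
  0 < D.ξ ∧ D.ξ ≤ 1 ∧ -1 < D.δ

/-- A history stack: each slot is empty (data equal to `0`) or holds the data point recorded at
the stored time. -/
abbrev Stack (N : ℕ) : Type := Fin N → Option ℝ

/-- The value of a recorded signal in a slot. -/
def slotValue {E : Type*} [Zero E] (f : ℝ → E) (a : Option ℝ) : E := a.elim 0 f

/-- `∑ i, Y_iᵀ Y_i` over the slots of a stack. -/
def gram {n p N : ℕ} (Yh : ℝ → Mat n p) (H : Stack N) : Mat p p :=
  ∑ i, (slotValue Yh (H i))ᵀ * slotValue Yh (H i)

/-- The normalization `1 / (1 + κ ‖M‖²)`. -/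
def normalizer {n p : ℕ} (κ : ℝ) (M : Mat n p) : ℝ := 1 / (1 + κ * ‖M‖ ^ 2)

/-- `∑ i, Y_iᵀ Y_i / (1 + κ ‖Y_i‖²)` over the slots of a stack. -/
def normGram {n p N : ℕ} (κ : ℝ) (Yh : ℝ → Mat n p) (H : Stack N) : Mat p p :=
  ∑ i, normalizer κ (slotValue Yh (H i)) • ((slotValue Yh (H i))ᵀ * slotValue Yh (H i))

/-- A stack is full rank if its normalized Gram matrix has positive least eigenvalue. -/
def FullRank {n p N : ℕ} (κ : ℝ) (Yh : ℝ → Mat n p) (H : Stack N) : Prop :=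
  0 < minEig (normGram κ Yh H)

/-- The memory of the recording algorithm. -/
structure AlgState (N : ℕ) where
  /-- main stack `ℋ`, used by the update law -/
  main : Stack N
  /-- transient stack `𝒢` -/
  trans : Stack N
  /-- highest minimum eigenvalue so far -/
  lam : ℝ
  /-- time of the last purge -/
  tau : ℝ
  /-- number of purges `ℋ ← 𝒢` so far -/
  purges : ℕ

def AlgState.init {n p : ℕ} (N : ℕ) (Yh : ℝ → Mat n p) : AlgState N where
  main := fun _ => none
  trans := fun _ => none
  lam := minEig (gram Yh (fun _ : Fin N => none))
  tau := 0
  purges := 0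

/-- The stack `H` with the data point recorded at time `t` put into slot `i`. -/
def Stack.put {N : ℕ} (H : Stack N) (i : Fin N) (t : ℝ) : Stack N :=
  Function.update H i (some t)

/-- `G'` results from offering the data point recorded at time `t` to the transient stack `G`:
if `G` is not full, the point goes to an empty slot; otherwise it replaces a point for which the
eigenvalue condition holds, if there is one. -/
def TransInsert {n p N : ℕ} (κ δ : ℝ) (Yh : ℝ → Mat n p) (t : ℝ) (G G' : Stack N) : Prop :=
  ((∃ i, G i = none) ∧ ∃ i, G i = none ∧ G' = G.put i t) ∨
  ((∀ i, G i ≠ none) ∧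
    ((∃ j, minEig (normGram κ Yh G) < minEig (normGram κ Yh (G.put j t)) / (1 + δ) ∧
        G' = G.put j t) ∨
     ((∀ j, ¬ minEig (normGram κ Yh G) < minEig (normGram κ Yh (G.put j t)) / (1 + δ)) ∧
        G' = G)))

/-- One pass of the recording algorithm at the sampling time `t`. Ties in the choice of a slot may
be broken arbitrarily. -/
def AlgStep {n p : ℕ} (D : Tuning p) (Yh : ℝ → Mat n p) (t : ℝ) (s s' : AlgState D.N) : Prop :=
  (t < D.T ∧ s' = s) ∨
  (D.T ≤ t ∧
    (((∀ i, minEig (gram Yh (s.main.put i t)) - s.lam < D.lamStar) ∧ s' = s) ∨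
     ∃ (j : Fin D.N) (lam1 : ℝ) (G1 : Stack D.N),
        lam1 = minEig (gram Yh (s.main.put j t)) ∧
        (∀ i, minEig (gram Yh (s.main.put i t)) ≤ lam1) ∧
        D.lamStar ≤ lam1 - s.lam ∧
        TransInsert D.κ D.δ Yh t s.trans G1 ∧
        (((D.ξ * lam1 ≤ minEig (gram Yh G1) ∧ D.dwell t ≤ t - s.tau) ∧
            s' = { main := G1
                   trans := fun _ => none
                   lam := max lam1 (minEig (gram Yh G1))
                   tau := t
                   purges := s.purges + 1 }) ∨
          (¬ (D.ξ * lam1 ≤ minEig (gram Yh G1) ∧ D.dwell t ≤ t - s.tau) ∧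
            s' = { main := s.main.put j t
                   trans := G1
                   lam := lam1
                   tau := s.tau
                   purges := s.purges }))))

/-! ### The closed loop -/

/-- The signals of a plant with its state and parameter estimators. `alg k` is the memory of the
recording algorithm after the sampling time `k * tstar`. -/
structure Loop (n m p q N : ℕ) where
  gains : Gains n q
  θ : Vec p
  u : ℝ → Vec m
  x : ℝ → Vec n
  xh : ℝ → Vec n
  θh : ℝ → Vec p
  Γ : ℝ → Mat p p
  alg : ℕ → AlgState N

section LoopSignals

variable {n m p q : ℕ} (S : Plant n m p q) (K : JacBounds n) (D : Tuning p)
  (R : Loop n m p q D.N)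

/-- State estimation error. -/
def xErr (t : ℝ) : Vec n := R.x t - R.xh t

/-- Parameter estimation error. -/
def thetaErr (t : ℝ) : Vec p := R.θ - R.θh t

/-- The output error `y - C x̂`. -/
def yErr (t : ℝ) : Vec q := app S.C (R.x t) - app S.C (R.xh t)

/-- The points at which the observer evaluates the nonlinearities. -/
def inj (l : Mat n q) (t : ℝ) : Vec n := R.xh t + app l (yErr S D R t)

/-- `Ŷ(t) = ∫_{t-T}^t Y(x̂)`. -/
def Yhat (t : ℝ) : Mat n p :=
  Matrix.of fun j i => ∫ s in (t - D.T)..t, S.Y (R.xh s) j i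

/-- `Ĝ_{fu}(t) = ∫_{t-T}^t (f₀(x̂) + g(x̂) u)`. -/
def Ghat (t : ℝ) : Vec n :=
  ∫ s in (t - D.T)..t, (S.f0 (R.xh s) + app (S.g (R.xh s)) (R.u s))

/-- `x̂(t) - x̂(t-T)`. -/
def Xhat (t : ℝ) : Vec n := R.xh t - R.xh (t - D.T)

/-- The residual `ℰ(t)` in `x̂(t) - x̂(t-T) = Ŷ(t) θ + Ĝ_{fu}(t) + ℰ(t)`. -/
def residualErr (t : ℝ) : Vec n := Xhat D R t - app (Yhat S D R t) R.θ - Ghat S D R t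

/-- The main stack that is active at time `t`. -/
def activeStack (t : ℝ) : Stack D.N := (R.alg ⌊t / D.tstar⌋₊).main

/-- `Ψ(t) = ∑ i, Ŷ_iᵀ Ŷ_i / (1 + κ ‖Ŷ_i‖²)` for the active stack. -/
def PsiMat (t : ℝ) : Mat p p := normGram D.κ (Yhat S D R) (activeStack D R t)

/-- `Q(t) = ∑ i, Ŷ_iᵀ ℰ_i / (1 + κ ‖Ŷ_i‖²)` for the active stack. -/
def Qvec (t : ℝ) : Vec p :=
  ∑ i, normalizer D.κ (slotValue (Yhat S D R) (activeStack D R t i)) •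
    app (slotValue (Yhat S D R) (activeStack D R t i))ᵀ
      (slotValue (residualErr S D R) (activeStack D R t i))

/-- `φ(t) = ∑ i, Ŷ_iᵀ (x̂(t_i) - x̂(t_i - T) - Ĝ_{fu}(t_i) - Ŷ_i θ̂(t)) / (1 + κ ‖Ŷ_i‖²)`. -/
def phi (t : ℝ) : Vec p :=
  ∑ i, normalizer D.κ (slotValue (Yhat S D R) (activeStack D R t i)) •
    app (slotValue (Yhat S D R) (activeStack D R t i))ᵀ
      (slotValue (Xhat D R) (activeStack D R t i)
        - slotValue (Ghat S D R) (activeStack D R t i)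
        - app (slotValue (Yhat S D R) (activeStack D R t i)) (R.θh t))

/-- The unprojected update direction `k_θ Γ φ`. -/
def rawUpdate (t : ℝ) : Vec p := D.kθ • app (R.Γ t) (phi S D R t)

/-- The projection is inactive at time `t`. -/
def Unprojected (t : ℝ) : Prop :=
  ‖R.θh t‖ ^ 2 < D.thetaBar ^ 2 ∨
    (‖R.θh t‖ ^ 2 = D.thetaBar ^ 2 ∧ inner ℝ (rawUpdate S D R t) (R.θh t) ≤ 0)

open Classical in
/-- Right-hand side of the projected concurrent-learning update law. -/
def thetaRHS (t : ℝ) : Vec p :=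
  if Unprojected S D R t then rawUpdate S D R t
  else rawUpdate S D R t -
    (inner ℝ (R.θh t) (rawUpdate S D R t) / inner ℝ (R.θh t) (app (R.Γ t) (R.θh t))) •
      app (R.Γ t) (R.θh t)

open Classical in
/-- Right-hand side of the least-squares gain update. -/
def gammaRHS (t : ℝ) : Mat p p :=
  if Unprojected S D R t then D.β1 • R.Γ t - D.kθ • (R.Γ t * PsiMat S D R t * R.Γ t) else 0

/-- Right-hand side of the plant. -/
def plantRHS (t : ℝ) : Vec n :=
  app (S.Y (R.x t)) R.θ + S.f0 (R.x t) + app (S.g (R.x t)) (R.u t)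

/-- Right-hand side of the observer. -/
def observerRHS (t : ℝ) : Vec n :=
  app K.A (R.xh t) + Ftheta S K (inj S D R R.gains.l1 t) (R.θh t)
    + Fone S K (inj S D R R.gains.l2 t) + Gu S K (inj S D R R.gains.l3 t) (R.u t)
    + app R.gains.L (yErr S D R t)

/-- `R` is a trajectory of the closed loop: an observer design satisfying the matrix inequality,
a true parameter and an initial estimate in the ball of radius `thetaBar`, an input with values in
`𝒰`, the plant, the observer, the projected update laws, a history stack populated by the recording
algorithm, and states and state estimates in `𝒞`. -/
structure IsClosedLoop (𝒞 : Set (Vec n)) (𝒰 : Set (Vec m)) : Prop where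
  lmi : SatisfiesLMI K S.C R.gains
  theta_le : ‖R.θ‖ ≤ D.thetaBar
  thetaHat_zero_le : ‖R.θh 0‖ ≤ D.thetaBar
  u_meas : Measurable R.u
  u_mem : ∀ t : ℝ, 0 ≤ t → R.u t ∈ 𝒰
  x_mem : ∀ t : ℝ, 0 ≤ t → R.x t ∈ 𝒞
  xh_mem : ∀ t : ℝ, 0 ≤ t → R.xh t ∈ 𝒞
  plant : SolvesODE R.x (plantRHS S D R)
  observer : SolvesODE R.xh (observerRHS S K D R)
  update : SolvesODE R.θh (thetaRHS S D R)
  gain_zero : R.Γ 0 = D.Γ0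
  gain : SolvesODE R.Γ (gammaRHS S D R)
  alg_zero : R.alg 0 = AlgState.init D.N (Yhat S D R)
  alg_step : ∀ k : ℕ,
    AlgStep D (Yhat S D R) (((k + 1 : ℕ) : ℝ) * D.tstar) (R.alg k) (R.alg (k + 1))

/-- The signal `(x̂, u)` is finitely informative. -/
def FinitelyInformative : Prop :=
  ∃ (M : ℕ) (τ : Fin M → ℝ), 0 < M ∧ StrictMono τ ∧ (∀ i, D.T ≤ τ i) ∧
    FullRank D.κ (Yhat S D R) (fun i => some (τ i))

/-- The excitation lasts through two purging events: the stack `ℋ₃`, active between the second and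
the third purge, is full rank with least eigenvalue at least `c₀`, not later than at time `τ₀`. -/
def ExcitedThroughTwoPurges (c₀ τ₀ : ℝ) : Prop :=
  ∃ k : ℕ, (R.alg k).purges = 2 ∧ (k : ℝ) * D.tstar ≤ τ₀ ∧
    c₀ ≤ minEig (normGram D.κ (Yhat S D R) (R.alg k).main)

/-- All data in the active stack at time `t` were recorded while the state estimation error was at
most `e`. -/
def RecordedWithin (e t : ℝ) : Prop :=
  ∀ i : Fin D.N, ∀ τ : ℝ, activeStack D R t i = some τ →
    ∀ s ∈ Icc (τ - D.T) τ, ‖xErr D R s‖ ≤ e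

/-- The points at which the observer evaluates the nonlinearities stay in `𝒞`, where the Jacobian
bounds hold. -/
def InjectionsIn (𝒞 : Set (Vec n)) : Prop :=
  ∀ t : ℝ, 0 ≤ t → inj S D R R.gains.l1 t ∈ 𝒞 ∧ inj S D R R.gains.l2 t ∈ 𝒞 ∧
    inj S D R R.gains.l3 t ∈ 𝒞

end LoopSignals

end

/-! ### Calculus of Carathéodory solutions: products, compositions, comparison. -/

section SolvesODECalculus

variable {E F : Type*} [NormedAddCommGroup E] [NormedSpace ℝ E] [NormedAddCommGroup F]
  [NormedSpace ℝ F]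

/-! The least-squares gain is studied through its inverse `W`, because the quadratic law of `Γ`
becomes the linear law `W' = χ (-β₁ W + k_θ Ψ)`, where `χ` is the indicator of the times at which
the projection is off. Every quadratic form of `W` is then a scalar comparison problem. The
normalization keeps `Ψ ≤ N/κ` whatever the data, which bounds `W` above; `W` decays no faster than
`exp (-β₁ t)` before `τ₀` and is sustained by the excitation afterwards, which bounds it below
(`IsInverseGain.inner_le`, `IsInverseGain.min_mul_le_inner`). The bounds involve only the fixed
data, so they are uniform over all trajectories.

The excitation is never lost: the recording algorithm maintains `ξ λ ≤ λ_min` for the Gram matrix of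
the main stack, and `λ` never decreases (`AlgInvariant.step`, `IsClosedLoop.le_minEig_PsiMat`).

Take `V = θ̃ᵀ W θ̃` and note `φ = Ψ θ̃ + Q`. Both branches of the update law give `V' ≤ -k_θ θ̃ᵀΨθ̃
- 2 k_θ Qᵀθ̃ - min (β₁ V) (k_θ θ̃ᵀΨθ̃)`; the projection only helps, since `θ` lies in the ball on
whose boundary `θ̂` sits (`IsInverseGain.exists_lyapunov_deriv`). Under excitation this is decay
with rate constant `a = k_θ c + β₁ w₁`, where `w₁` is the lower bound of `W`, and Young and Grönwall
yield the ultimate bound (`GainBounds.limsupLE`). Before the excitation there is no decay, only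
growth of `V` at a rate linear in `‖Q‖`, because `‖θ̃‖ ≤ 2 θ̄`; hence the square root in the input
of the stability estimate (`GainBounds.iss`).

For large observer gain, the matrix inequality makes the linear part of the error dynamics contract
at rate `α`, and all other terms are a bounded perturbation, since every evaluation point lies in
the compact set `𝒞`. If `α` is large against the root of the condition number of `P`, the error is
below `ε` from time `t*` on (`IsClosedLoop.norm_xErr_le`). After two purges the main stack holds
only data whose recording windows start at `t*` or later
(`IsClosedLoop.activeStack_time_of_purged`), so the bound through the residuals applies with `e =
ε`. -/

theorem SolvesODE.intervalIntegrable {f r : ℝ → E} (h : SolvesODE f r) {s t : ℝ} (hs : 0 ≤ s)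
    (ht : 0 ≤ t) : IntervalIntegrable r volume s t :=
  (h s hs).1.symm.trans (h t ht).1

theorem SolvesODE.sub_eq {f r : ℝ → E} (h : SolvesODE f r) {s t : ℝ} (hs : 0 ≤ s) (ht : 0 ≤ t) :
    f t - f s = ∫ τ in s..t, r τ := by
  rw [(h t ht).2, (h s hs).2, add_sub_add_left_eq_sub,
    intervalIntegral.integral_interval_sub_left (h t ht).1 (h s hs).1]

theorem SolvesODE.continuousOn {f r : ℝ → E} (h : SolvesODE f r) : ContinuousOn f (Ici 0) := by
  have key : ∀ b : ℝ, 0 ≤ b → ContinuousOn f (Icc 0 b) := by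
    intro b hb
    have h1 : ContinuousOn (fun t => f 0 + ∫ s in (0 : ℝ)..t, r s) (uIcc 0 b) :=
      continuousOn_const.add (intervalIntegral.continuousOn_primitive_interval
        (by
          rw [uIcc_of_le hb, integrableOn_Icc_iff_integrableOn_Ioc]
          exact (h b hb).1.1))
    rw [uIcc_of_le hb] at h1
    exact h1.congr fun t ht => (h t ht.1).2
  intro t ht
  have h1 := key (t + 1) (by linarith [mem_Ici.1 ht]) t ⟨ht, by linarith⟩
  refine h1.mono_of_mem_nhdsWithin ?_
  rw [← Ici_inter_Iic]
  exact inter_mem_nhdsWithin _ (Iic_mem_nhds (by linarith))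

theorem SolvesODE.congr_rhs {f r r' : ℝ → E} (h : SolvesODE f r) (hr : ∀ t, 0 ≤ t → r t = r' t) :
    SolvesODE f r' := by
  intro t ht
  have : EqOn r r' (uIoc 0 t) := fun s hs => by
    rw [uIoc_of_le ht] at hs
    exact hr s hs.1.le
  refine ⟨(intervalIntegrable_congr this).1 (h t ht).1, ?_⟩
  rw [(h t ht).2]
  congr 1
  refine intervalIntegral.integral_congr fun s hs => ?_
  rw [uIcc_of_le ht] at hs
  exact hr s hs.1

theorem SolvesODE.congr_fun {f f' r : ℝ → E} (h : SolvesODE f r) (hf : ∀ t, 0 ≤ t → f t = f' t) :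
    SolvesODE f' r := by
  intro t ht
  exact ⟨(h t ht).1, by rw [← hf t ht, ← hf 0 le_rfl]; exact (h t ht).2⟩

theorem SolvesODE.congr {f f' r r' : ℝ → E} (h : SolvesODE f r) (hf : ∀ t, 0 ≤ t → f t = f' t)
    (hr : ∀ t, 0 ≤ t → r t = r' t) : SolvesODE f' r' :=
  (h.congr_fun hf).congr_rhs hr

theorem SolvesODE.clm_comp [CompleteSpace E] [CompleteSpace F] {f r : ℝ → E} (h : SolvesODE f r)
    (L : E →L[ℝ] F) : SolvesODE (fun t => L (f t)) (fun t => L (r t)) := by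
  intro t ht
  refine ⟨⟨L.integrable_comp (h t ht).1.1, L.integrable_comp (h t ht).1.2⟩, ?_⟩
  rw [L.intervalIntegral_comp_comm (h t ht).1, ← map_add, ← (h t ht).2]

theorem solvesODE_const (c : E) : SolvesODE (fun _ => c) (fun _ => 0) := by
  intro t ht
  simp

theorem SolvesODE.add {f g r s : ℝ → E} (hf : SolvesODE f r) (hg : SolvesODE g s) :
    SolvesODE (fun t => f t + g t) (fun t => r t + s t) := by
  intro t ht
  refine ⟨(hf t ht).1.add (hg t ht).1, ?_⟩
  simp only
  rw [intervalIntegral.integral_add (hf t ht).1 (hg t ht).1, (hf t ht).2, (hg t ht).2]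
  abel

theorem SolvesODE.neg {f r : ℝ → E} (hf : SolvesODE f r) :
    SolvesODE (fun t => -f t) (fun t => -r t) := by
  intro t ht
  refine ⟨(hf t ht).1.neg, ?_⟩
  simp only
  rw [intervalIntegral.integral_neg, (hf t ht).2]
  abel

theorem SolvesODE.sub {f g r s : ℝ → E} (hf : SolvesODE f r) (hg : SolvesODE g s) :
    SolvesODE (fun t => f t - g t) (fun t => r t - s t) := by
  simpa [sub_eq_add_neg] using hf.add hg.neg

theorem SolvesODE.sum {ι : Type*} (A : Finset ι) {f r : ι → ℝ → E}
    (h : ∀ i ∈ A, SolvesODE (f i) (r i)) :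
    SolvesODE (fun t => ∑ i ∈ A, f i t) (fun t => ∑ i ∈ A, r i t) := by
  classical
  induction A using Finset.induction_on with
  | empty => simpa using solvesODE_const (0 : E)
  | insert a A ha ih =>
    simp only [Finset.sum_insert ha]
    exact (h a (by simp)).add (ih fun i hi => h i (by simp [hi]))

theorem SolvesODE.const_mul {f r : ℝ → ℝ} (hf : SolvesODE f r) (c : ℝ) :
    SolvesODE (fun t => c * f t) (fun t => c * r t) := by
  simpa using hf.clm_comp (ContinuousLinearMap.mul ℝ ℝ c)

theorem solvesODE_of_ac {f r : ℝ → ℝ} (hac : ∀ t, 0 ≤ t → AbsolutelyContinuousOnInterval f 0 t)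
    (hd : ∀ t, 0 ≤ t → ∀ᵐ x, x ∈ uIcc 0 t → HasDerivAt f (r x) x) : SolvesODE f r := by
  intro t ht
  have h1 : ∀ᵐ x, x ∈ uIoc 0 t → deriv f x = r x := by
    filter_upwards [hd t ht] with x hx hx'
    exact (hx (uIoc_subset_uIcc hx')).deriv
  refine ⟨(hac t ht).intervalIntegrable_deriv.congr_ae
    ((ae_restrict_iff' measurableSet_uIoc).2 h1), ?_⟩
  rw [← intervalIntegral.integral_congr_ae h1, (hac t ht).integral_deriv_eq_sub]
  ring

/-- Nothing is known about `f` at negative times. The primitive of `r` agrees with `f` on `[0, ∞)`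
and has two-sided derivatives almost everywhere, so pointwise differentiation rules can be used on
it. -/
theorem SolvesODE.exists_ac {f r : ℝ → ℝ} (h : SolvesODE f r) :
    ∃ F : ℝ → ℝ, (∀ t, 0 ≤ t → F t = f t) ∧
      (∀ t, 0 ≤ t → AbsolutelyContinuousOnInterval F 0 t) ∧
      (∀ t, 0 ≤ t → ∀ᵐ x, x ∈ uIcc 0 t → HasDerivAt F (r x) x) := by
  refine ⟨fun t => f 0 + ∫ s in (0 : ℝ)..t, r s, fun t ht => (h t ht).2.symm, fun t ht => ?_,
    fun t ht => ?_⟩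
  · have h1 := (h t ht).1.absolutelyContinuousOnInterval_intervalIntegral
      (c := 0) (by simp)
    have h2 : AbsolutelyContinuousOnInterval (fun _ : ℝ => f 0) 0 t :=
      (contDiff_const.contDiffOn).absolutelyContinuousOnInterval
    exact h2.fun_add h1
  · filter_upwards [(h t ht).1.ae_hasDerivAt_integral] with x hx hx'
    exact (hx hx' 0 (by simp)).const_add _

theorem SolvesODE.mul {f g r s : ℝ → ℝ} (hf : SolvesODE f r) (hg : SolvesODE g s) :
    SolvesODE (fun t => f t * g t) (fun t => r t * g t + f t * s t) := by
  obtain ⟨F, hF, hFac, hFd⟩ := hf.exists_ac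
  obtain ⟨G, hG, hGac, hGd⟩ := hg.exists_ac
  have : SolvesODE (fun t => F t * G t) (fun t => r t * G t + F t * s t) := by
    refine solvesODE_of_ac (fun t ht => (hFac t ht).fun_mul (hGac t ht)) fun t ht => ?_
    filter_upwards [hFd t ht, hGd t ht] with x h1 h2 hx
    exact (h1 hx).mul (h2 hx)
  exact this.congr (fun t ht => by rw [hF t ht, hG t ht]) fun t ht => by rw [hF t ht, hG t ht]

/-- A `C¹` function is Lipschitz on the bounded range of `f`, and this preserves absolute
continuity. -/
theorem AbsolutelyContinuousOnInterval.contDiff_comp {f φ : ℝ → ℝ} {a b : ℝ}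
    (hf : AbsolutelyContinuousOnInterval f a b) (hφ : ContDiff ℝ 1 φ) :
    AbsolutelyContinuousOnInterval (fun t => φ (f t)) a b := by
  obtain ⟨B, hB⟩ := hf.exists_bound
  obtain ⟨K, hK⟩ := hφ.contDiffOn.exists_lipschitzOnWith (n := 1) (by decide)
    (convex_closedBall (0 : ℝ) B) (isCompact_closedBall 0 B)
  rw [absolutelyContinuousOnInterval_iff] at hf ⊢
  intro ε hε
  obtain ⟨δ, hδ, h⟩ := hf (ε / (K + 1)) (by positivity)
  refine ⟨δ, hδ, fun I hI hI' => ?_⟩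
  have hmem : ∀ x ∈ uIcc a b, f x ∈ Metric.closedBall (0 : ℝ) B := fun x hx => by
    simpa using hB x hx
  calc ∑ i ∈ Finset.range I.1, dist (φ (f (I.2 i).1)) (φ (f (I.2 i).2))
      ≤ ∑ i ∈ Finset.range I.1, K * dist (f (I.2 i).1) (f (I.2 i).2) :=
        Finset.sum_le_sum fun i hi => hK.dist_le_mul _ (hmem _ (hI.1 i hi).1) _
          (hmem _ (hI.1 i hi).2)
    _ = K * ∑ i ∈ Finset.range I.1, dist (f (I.2 i).1) (f (I.2 i).2) := by
        rw [Finset.mul_sum]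
    _ ≤ K * (ε / (K + 1)) := by gcongr; exact (h I hI hI').le
    _ < (K + 1) * (ε / (K + 1)) := by gcongr; linarith
    _ = ε := by field_simp

theorem SolvesODE.contDiff_comp {f r φ : ℝ → ℝ} (hf : SolvesODE f r) (hφ : ContDiff ℝ 1 φ) :
    SolvesODE (fun t => φ (f t)) (fun t => deriv φ (f t) * r t) := by
  obtain ⟨F, hF, hFac, hFd⟩ := hf.exists_ac
  have : SolvesODE (fun t => φ (F t)) (fun t => deriv φ (F t) * r t) := by
    refine solvesODE_of_ac (fun t ht => (hFac t ht).contDiff_comp hφ) fun t ht => ?_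
    filter_upwards [hFd t ht] with x h1 hx
    exact ((hφ.differentiable one_ne_zero).differentiableAt.hasDerivAt).comp x (h1 hx)
  exact this.congr (fun t ht => by rw [hF t ht]) fun t ht => by rw [hF t ht]

theorem SolvesODE.exp_mul {f r : ℝ → ℝ} (hf : SolvesODE f r) (c : ℝ) :
    SolvesODE (fun t => Real.exp (c * f t)) (fun t => c * r t * Real.exp (c * f t)) := by
  refine ((hf.const_mul c).contDiff_comp Real.contDiff_exp).congr_rhs fun t _ => ?_
  rw [Real.deriv_exp, mul_comm]

theorem solvesODE_id : SolvesODE (fun t => t) (fun _ => 1) := by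
  intro t ht
  simp

theorem SolvesODE.le_of_nonpos_Ioo {f r : ℝ → ℝ} (h : SolvesODE f r) {s t : ℝ} (hs : 0 ≤ s)
    (hst : s ≤ t) (hr : ∀ τ ∈ Ioo s t, r τ ≤ 0) : f t ≤ f s := by
  have h1 := h.sub_eq hs (hs.trans hst)
  have h2 : ∫ τ in s..t, r τ ≤ 0 := by
    have := intervalIntegral.integral_mono_on_of_le_Ioo hst
      (h.intervalIntegrable hs (hs.trans hst)) (intervalIntegrable_const (c := (0 : ℝ))) hr
    simpa using this
  linarith

theorem SolvesODE.le_of_nonpos {f r : ℝ → ℝ} (h : SolvesODE f r) {s t : ℝ} (hs : 0 ≤ s)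
    (hst : s ≤ t) (hr : ∀ τ ∈ Icc s t, r τ ≤ 0) : f t ≤ f s :=
  h.le_of_nonpos_Ioo hs hst fun τ hτ => hr τ (Ioo_subset_Icc_self hτ)

/-- Grönwall's inequality for Carathéodory solutions. -/
theorem SolvesODE.gronwall {f r : ℝ → ℝ} (h : SolvesODE f r) {s t η b : ℝ} (hη : η ≠ 0)
    (hs : 0 ≤ s) (hst : s ≤ t) (hr : ∀ τ ∈ Icc s t, r τ ≤ -η * f τ + b) :
    f t ≤ Real.exp (-η * (t - s)) * (f s - b / η) + b / η := by
  -- With the integrating factor, `exp (η τ) (f τ - b/η)` does not increase; the sign of `η` plays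
  -- no role.
  have h1 := (solvesODE_id.exp_mul η).mul (h.sub (solvesODE_const (b / η)))
  have h2 := h1.le_of_nonpos hs hst fun τ hτ => by
    have h3 := hr τ hτ
    have h4 : η * 1 * Real.exp (η * τ) * (f τ - b / η) + Real.exp (η * τ) * (r τ - 0) =
      Real.exp (η * τ) * (r τ - (-η * f τ + b)) := by
      field_simp
      ring
    rw [h4]
    exact mul_nonpos_of_nonneg_of_nonpos (Real.exp_pos _).le (by linarith)
  have h5 : Real.exp (-η * (t - s)) = Real.exp (-(η * t)) * Real.exp (η * s) := by
    rw [← Real.exp_add]; congr 1; ring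
  have h6 : Real.exp (-(η * t)) * Real.exp (η * t) = 1 := by
    rw [← Real.exp_add]; simp
  have h7 : f t - b / η ≤ Real.exp (-η * (t - s)) * (f s - b / η) := by
    calc f t - b / η = Real.exp (-(η * t)) * (Real.exp (η * t) * (f t - b / η)) := by
          rw [← mul_assoc, h6, one_mul]
      _ ≤ Real.exp (-(η * t)) * (Real.exp (η * s) * (f s - b / η)) := by
          gcongr
      _ = _ := by rw [h5, mul_assoc]
  linarith

theorem SolvesODE.le_add_mul {f r : ℝ → ℝ} (h : SolvesODE f r) {s t b : ℝ}
    (hs : 0 ≤ s) (hst : s ≤ t) (hr : ∀ τ ∈ Icc s t, r τ ≤ b) : f t ≤ f s + b * (t - s) := by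
  have h1 := (h.sub (solvesODE_id.const_mul b)).le_of_nonpos hs hst fun τ hτ => by
    have := hr τ hτ
    linarith
  linarith

end SolvesODECalculus

/-! ### Matrices as operators, and extreme eigenvalues as bounds of quadratic forms. -/

section LinearAlgebra

variable {k l r : ℕ}

theorem app_apply (M : Mat k l) (v : Vec l) (i : Fin k) : app M v i = ∑ j, M i j * v j := rfl

theorem inner_eq_sum (v w : Vec k) : inner ℝ v w = ∑ i, v i * w i := by
  simp [PiLp.inner_apply, mul_comm]

@[simp] theorem app_add (M : Mat k l) (v w : Vec l) : app M (v + w) = app M v + app M w := by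
  ext i; simp [app, Matrix.mulVec_add]

@[simp] theorem app_sub (M : Mat k l) (v w : Vec l) : app M (v - w) = app M v - app M w := by
  ext i; simp [app, Matrix.mulVec_sub]

@[simp] theorem app_smul (M : Mat k l) (c : ℝ) (v : Vec l) : app M (c • v) = c • app M v := by
  ext i; simp [app, Matrix.mulVec_smul]

@[simp] theorem app_zero (M : Mat k l) : app M 0 = 0 := by
  ext i; simp [app]

@[simp] theorem add_app (M M' : Mat k l) (v : Vec l) : app (M + M') v = app M v + app M' v := by
  ext i; simp [app, Matrix.add_mulVec]

@[simp] theorem sub_app (M M' : Mat k l) (v : Vec l) : app (M - M') v = app M v - app M' v := by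
  ext i; simp [app, Matrix.sub_mulVec]

@[simp] theorem smul_app (c : ℝ) (M : Mat k l) (v : Vec l) : app (c • M) v = c • app M v := by
  ext i; simp [app, Matrix.smul_mulVec]

@[simp] theorem zero_app (v : Vec l) : app (0 : Mat k l) v = 0 := by
  ext i; simp [app]

@[simp] theorem one_app (v : Vec l) : app (1 : Mat l l) v = v := by
  ext i; simp [app]

theorem mul_app (M : Mat k l) (M' : Mat l r) (v : Vec r) :
    app (M * M') v = app M (app M' v) := by
  ext i; simp [app, Matrix.mulVec_mulVec]

theorem sum_app {ι : Type*} (A : Finset ι) (M : ι → Mat k l) (v : Vec l) :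
    app (∑ i ∈ A, M i) v = ∑ i ∈ A, app (M i) v := by
  ext i; simp [app, Matrix.sum_mulVec]

theorem inner_app (M : Mat k l) (v : Vec l) (w : Vec k) :
    inner ℝ (app M v) w = inner ℝ v (app Mᵀ w) := by
  simp only [inner_eq_sum, app_apply, Finset.sum_mul, Finset.mul_sum, Matrix.transpose_apply]
  rw [Finset.sum_comm]
  exact Finset.sum_congr rfl fun i _ => Finset.sum_congr rfl fun j _ => by ring

theorem inner_app_symm {M : Mat k k} (hM : M.IsHermitian) (v w : Vec k) :
    inner ℝ (app M v) w = inner ℝ v (app M w) := by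
  rw [inner_app, show Mᵀ = M by simpa [Matrix.IsHermitian] using hM]

theorem norm_app_le (M : Mat k l) (v : Vec l) : ‖app M v‖ ≤ ‖M‖ * ‖v‖ :=
  Matrix.l2_opNorm_mulVec M v

theorem inner_app_eq_sum (M : Mat k k) (v : Vec k) :
    inner ℝ v (app M v) = ∑ i, ∑ j, v i * M i j * v j := by
  simp only [inner_eq_sum, app_apply, Finset.mul_sum]
  exact Finset.sum_congr rfl fun i _ => Finset.sum_congr rfl fun j _ => by ring

theorem norm_transpose (M : Mat k l) : ‖Mᵀ‖ = ‖M‖ := by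
  simpa using Matrix.l2_opNorm_conjTranspose M

theorem abs_inner_app_le (M : Mat k k) (v : Vec k) : |inner ℝ v (app M v)| ≤ ‖M‖ * ‖v‖ ^ 2 := by
  have h1 := abs_real_inner_le_norm v (app M v)
  have h2 := norm_app_le M v
  nlinarith [norm_nonneg v]

theorem posSemidef_of_inner {M : Mat k k} (hM : M.IsHermitian)
    (h : ∀ v : Vec k, 0 ≤ inner ℝ v (app M v)) : M.PosSemidef := by
  refine Matrix.PosSemidef.of_dotProduct_mulVec_nonneg hM fun x => ?_
  have := h (WithLp.toLp 2 x)
  rw [inner_eq_sum] at this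
  simpa [dotProduct, app] using this

theorem Matrix.PosSemidef.inner_nonneg {M : Mat k k} (hM : M.PosSemidef) (v : Vec k) :
    0 ≤ inner ℝ v (app M v) := by
  have := hM.dotProduct_mulVec_nonneg v.ofLp
  rw [inner_eq_sum]
  simpa [dotProduct, app] using this

theorem app_eigenvectorBasis {M : Mat k k} (hM : M.IsHermitian) (i : Fin k) :
    app M (hM.eigenvectorBasis i) = hM.eigenvalues i • hM.eigenvectorBasis i := by
  ext j
  have := congrFun (hM.mulVec_eigenvectorBasis i) j
  simpa [app] using this

theorem inner_app_eq_sum_eigenvalues {M : Mat k k} (hM : M.IsHermitian) (v : Vec k) :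
    inner ℝ v (app M v) = ∑ i, hM.eigenvalues i * (inner ℝ (hM.eigenvectorBasis i) v) ^ 2 := by
  rw [← hM.eigenvectorBasis.sum_inner_mul_inner v (app M v)]
  refine Finset.sum_congr rfl fun i _ => ?_
  rw [← inner_app_symm hM, app_eigenvectorBasis hM, inner_smul_left, real_inner_comm v]
  simp
  ring

theorem norm_sq_eq_sum_eigenvectorBasis {M : Mat k k} (hM : M.IsHermitian) (v : Vec k) :
    ‖v‖ ^ 2 = ∑ i, (inner ℝ (hM.eigenvectorBasis i) v) ^ 2 := by
  rw [← real_inner_self_eq_norm_sq, ← hM.eigenvectorBasis.sum_inner_mul_inner v v]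
  refine Finset.sum_congr rfl fun i _ => ?_
  rw [real_inner_comm v]
  ring

theorem minEig_mul_le {M : Mat k k} (hM : M.IsHermitian) (v : Vec k) :
    minEig M * ‖v‖ ^ 2 ≤ inner ℝ v (app M v) := by
  rw [inner_app_eq_sum_eigenvalues hM, norm_sq_eq_sum_eigenvectorBasis hM, Finset.mul_sum]
  refine Finset.sum_le_sum fun i _ => mul_le_mul_of_nonneg_right ?_ (sq_nonneg _)
  rw [minEig, hM.spectrum_real_eq_range_eigenvalues]
  exact csInf_le (Set.finite_range _).bddBelow ⟨i, rfl⟩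

theorem le_maxEig_mul {M : Mat k k} (hM : M.IsHermitian) (v : Vec k) :
    inner ℝ v (app M v) ≤ maxEig M * ‖v‖ ^ 2 := by
  rw [inner_app_eq_sum_eigenvalues hM, norm_sq_eq_sum_eigenvectorBasis hM, Finset.mul_sum]
  refine Finset.sum_le_sum fun i _ => mul_le_mul_of_nonneg_right ?_ (sq_nonneg _)
  rw [maxEig, hM.spectrum_real_eq_range_eigenvalues]
  exact le_csSup (Set.finite_range _).bddAbove ⟨i, rfl⟩

/-- In dimension zero the spectrum is empty and `minEig` is `sInf ∅ = 0`, so a positive `c` would be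
a counterexample; hence `0 < k`. -/
theorem le_minEig {M : Mat k k} (hk : 0 < k) (hM : M.IsHermitian) {c : ℝ}
    (h : ∀ v : Vec k, c * ‖v‖ ^ 2 ≤ inner ℝ v (app M v)) : c ≤ minEig M := by
  have : Nonempty (Fin k) := ⟨⟨0, hk⟩⟩
  rw [minEig, hM.spectrum_real_eq_range_eigenvalues]
  refine le_csInf (Set.range_nonempty _) ?_
  rintro _ ⟨i, rfl⟩
  have h1 := h (hM.eigenvectorBasis i)
  rw [app_eigenvectorBasis hM, inner_smul_right, real_inner_self_eq_norm_sq] at h1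
  simpa using h1

theorem minEig_pos_of_posDef {M : Mat k k} (hk : 0 < k) (hM : M.PosDef) : 0 < minEig M := by
  have : Nonempty (Fin k) := ⟨⟨0, hk⟩⟩
  rw [minEig, hM.1.spectrum_real_eq_range_eigenvalues]
  obtain ⟨i, hi⟩ := (Set.range_nonempty hM.1.eigenvalues).csInf_mem (Set.finite_range _)
  rw [← hi]
  exact hM.eigenvalues_pos i

theorem minEig_of_zero (M : Mat 0 0) : minEig M = 0 := by
  simp [minEig]

theorem minEig_nonneg {M : Mat k k} (hM : M.PosSemidef) : 0 ≤ minEig M := by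
  rcases Nat.eq_zero_or_pos k with rfl | hk
  · exact (minEig_of_zero M).ge
  · exact le_minEig hk hM.1 fun v => by simpa using hM.inner_nonneg v

theorem Matrix.PosDef.exists_pos_mul_le {M : Mat k k} (hM : M.PosDef) :
    ∃ c : ℝ, 0 < c ∧ ∀ v : Vec k, c * ‖v‖ ^ 2 ≤ inner ℝ v (app M v) := by
  rcases Nat.eq_zero_or_pos k with rfl | hk
  · exact ⟨1, one_pos, fun v => by simp [Subsingleton.elim v 0]⟩
  · exact ⟨minEig M, minEig_pos_of_posDef hk hM, minEig_mul_le hM.1⟩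

end LinearAlgebra

/-! ### Gram matrices of history stacks, plain and normalized. -/

section GramMatrices

variable {n p N : ℕ}

theorem normalizer_nonneg {κ : ℝ} (hκ : 0 < κ) (M : Mat n p) : 0 ≤ normalizer κ M := by
  unfold normalizer; positivity

theorem normalizer_le_one {κ : ℝ} (hκ : 0 < κ) (M : Mat n p) : normalizer κ M ≤ 1 := by
  unfold normalizer
  rw [div_le_one (by positivity)]
  nlinarith [sq_nonneg ‖M‖]

theorem gram_isHermitian (Yh : ℝ → Mat n p) (H : Stack N) : (gram Yh H).IsHermitian := by
  simp [Matrix.IsHermitian, gram, Matrix.transpose_sum]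

theorem normGram_isHermitian (κ : ℝ) (Yh : ℝ → Mat n p) (H : Stack N) :
    (normGram κ Yh H).IsHermitian := by
  simp [Matrix.IsHermitian, normGram, Matrix.transpose_sum]

theorem inner_transpose_mul_self (M : Mat n p) (v : Vec p) :
    inner ℝ v (app (Mᵀ * M) v) = ‖app M v‖ ^ 2 := by
  rw [mul_app, ← inner_app, real_inner_self_eq_norm_sq]

theorem inner_gram (Yh : ℝ → Mat n p) (H : Stack N) (v : Vec p) :
    inner ℝ v (app (gram Yh H) v) = ∑ i, ‖app (slotValue Yh (H i)) v‖ ^ 2 := by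
  simp [gram, sum_app, inner_sum, inner_transpose_mul_self]

theorem inner_normGram (κ : ℝ) (Yh : ℝ → Mat n p) (H : Stack N) (v : Vec p) :
    inner ℝ v (app (normGram κ Yh H) v) =
      ∑ i, normalizer κ (slotValue Yh (H i)) * ‖app (slotValue Yh (H i)) v‖ ^ 2 := by
  simp [normGram, sum_app, inner_sum, inner_smul_right, inner_transpose_mul_self]

theorem gram_posSemidef (Yh : ℝ → Mat n p) (H : Stack N) : (gram Yh H).PosSemidef :=
  posSemidef_of_inner (gram_isHermitian Yh H) fun v => by rw [inner_gram]; positivity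

theorem inner_normGram_nonneg {κ : ℝ} (hκ : 0 < κ) (Yh : ℝ → Mat n p) (H : Stack N) (v : Vec p) :
    0 ≤ inner ℝ v (app (normGram κ Yh H) v) := by
  rw [inner_normGram]
  exact Finset.sum_nonneg fun i _ => mul_nonneg (normalizer_nonneg hκ _) (sq_nonneg _)

theorem inner_normGram_le_gram {κ : ℝ} (hκ : 0 < κ) (Yh : ℝ → Mat n p) (H : Stack N)
    (v : Vec p) : inner ℝ v (app (normGram κ Yh H) v) ≤ inner ℝ v (app (gram Yh H) v) := by
  rw [inner_normGram, inner_gram]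
  exact Finset.sum_le_sum fun i _ =>
    mul_le_of_le_one_left (sq_nonneg _) (normalizer_le_one hκ _)

/-- Each normalizer is at least `1 / (1 + κ B²)`. This transfers excitation from the plain Gram
matrix, which the algorithm monitors, to `Ψ`, which drives the update. -/
theorem inner_gram_le_normGram {κ B : ℝ} (hκ : 0 < κ) (Yh : ℝ → Mat n p) (H : Stack N)
    (hB : ∀ i, ‖slotValue Yh (H i)‖ ≤ B) (v : Vec p) :
    inner ℝ v (app (gram Yh H) v) / (1 + κ * B ^ 2) ≤ inner ℝ v (app (normGram κ Yh H) v) := by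
  rw [inner_normGram, inner_gram, Finset.sum_div]
  refine Finset.sum_le_sum fun i _ => ?_
  rw [div_eq_inv_mul, normalizer, ← one_div]
  have := hB i
  gcongr

/-- Since `y² / (1 + κ y²) ≤ 1/κ`, a slot contributes at most `1/κ` whatever it holds. -/
theorem inner_normGram_le {κ : ℝ} (hκ : 0 < κ) (Yh : ℝ → Mat n p) (H : Stack N) (v : Vec p) :
    inner ℝ v (app (normGram κ Yh H) v) ≤ N / κ * ‖v‖ ^ 2 := by
  rw [inner_normGram]
  calc ∑ i, normalizer κ (slotValue Yh (H i)) * ‖app (slotValue Yh (H i)) v‖ ^ 2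
      ≤ ∑ _i : Fin N, 1 / κ * ‖v‖ ^ 2 := Finset.sum_le_sum fun i _ => by
        set Y := slotValue Yh (H i)
        have h1 : ‖app Y v‖ ^ 2 ≤ ‖Y‖ ^ 2 * ‖v‖ ^ 2 := by
          rw [← mul_pow]
          exact pow_le_pow_left₀ (norm_nonneg _) (norm_app_le Y v) 2
        have h2 : normalizer κ Y * ‖Y‖ ^ 2 ≤ 1 / κ := by
          rw [normalizer, one_div_mul_eq_div, div_le_div_iff₀ (by positivity) hκ]
          linarith
        calc normalizer κ Y * ‖app Y v‖ ^ 2 ≤ normalizer κ Y * (‖Y‖ ^ 2 * ‖v‖ ^ 2) := by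
              gcongr
              exact normalizer_nonneg hκ _
          _ = (normalizer κ Y * ‖Y‖ ^ 2) * ‖v‖ ^ 2 := by ring
          _ ≤ _ := by gcongr
    _ = N / κ * ‖v‖ ^ 2 := by simp; ring

theorem minEig_normGram_le_gram {κ : ℝ} (hκ : 0 < κ) (Yh : ℝ → Mat n p) (H : Stack N) :
    minEig (normGram κ Yh H) ≤ minEig (gram Yh H) := by
  rcases Nat.eq_zero_or_pos p with rfl | hp
  · simp [minEig_of_zero]
  · exact le_minEig hp (gram_isHermitian Yh H) fun v =>
      (minEig_mul_le (normGram_isHermitian κ Yh H) v).trans (inner_normGram_le_gram hκ Yh H v)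

theorem minEig_gram_div_le {κ B : ℝ} (hκ : 0 < κ) (Yh : ℝ → Mat n p) (H : Stack N)
    (hB : ∀ i, ‖slotValue Yh (H i)‖ ≤ B) :
    minEig (gram Yh H) / (1 + κ * B ^ 2) ≤ minEig (normGram κ Yh H) := by
  rcases Nat.eq_zero_or_pos p with rfl | hp
  · simp [minEig_of_zero]
  · refine le_minEig hp (normGram_isHermitian κ Yh H) fun v => ?_
    refine le_trans ?_ (inner_gram_le_normGram hκ Yh H hB v)
    rw [div_mul_eq_mul_div]
    have := minEig_mul_le (gram_isHermitian Yh H) v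
    gcongr

theorem minEig_gram_empty (Yh : ℝ → Mat n p) : minEig (gram Yh (fun _ : Fin N => none)) = 0 := by
  have : gram Yh (fun _ : Fin N => none) = 0 := by simp [gram, slotValue]
  rw [this]
  rcases Nat.eq_zero_or_pos p with rfl | hp
  · exact minEig_of_zero _
  · have : Nonempty (Fin p) := ⟨⟨0, hp⟩⟩
    simp [minEig]

end GramMatrices

/-! ### Invariants of the recording algorithm. -/

section RecordingAlgorithm

variable {n p N : ℕ}

theorem Stack.put_eq_some {H : Stack N} {j i : Fin N} {t τ : ℝ} (h : H.put j t i = some τ) :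
    τ = t ∨ H i = some τ := by
  unfold Stack.put at h
  by_cases hij : i = j
  · subst hij
    simp only [Function.update_self, Option.some.injEq] at h
    exact Or.inl h.symm
  · rw [Function.update_of_ne hij] at h
    exact Or.inr h

theorem TransInsert.eq_some {κ δ t : ℝ} {Yh : ℝ → Mat n p} {G G' : Stack N}
    (h : TransInsert κ δ Yh t G G') {i : Fin N} {τ : ℝ} (hi : G' i = some τ) :
    τ = t ∨ G i = some τ := by
  rcases h with ⟨-, j, -, rfl⟩ | ⟨-, ⟨j, -, rfl⟩ | ⟨-, rfl⟩⟩
  · exact Stack.put_eq_some hi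
  · exact Stack.put_eq_some hi
  · exact Or.inr hi

/-- The invariant of the recording algorithm after the sampling time `k * tstar`. -/
structure AlgInvariant (D : Tuning p) (Yh : ℝ → Mat n p) (k : ℕ) (s : AlgState D.N) : Prop where
  main_time : ∀ i τ, s.main i = some τ → D.T ≤ τ
  trans_time : ∀ i τ, s.trans i = some τ → D.T ≤ τ
  mul_lam_le : D.ξ * s.lam ≤ minEig (gram Yh s.main)
  le_lam : minEig (gram Yh s.main) ≤ s.lam
  sampled : 1 ≤ s.purges → D.T ≤ k * D.tstar
  trans_purged : 1 ≤ s.purges → ∀ i τ, s.trans i = some τ → D.T + D.tstar ≤ τ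
  main_purged : 2 ≤ s.purges → ∀ i τ, s.main i = some τ → D.T + D.tstar ≤ τ

theorem AlgInvariant.init (D : Tuning p) (Yh : ℝ → Mat n p) :
    AlgInvariant D Yh 0 (AlgState.init D.N Yh) := by
  constructor <;> simp [AlgState.init, minEig_gram_empty]

/-- A plain replacement makes `λ` equal to the least eigenvalue of the main stack. A purge may lower
that eigenvalue, but the purging test keeps it above `ξ` times the old `λ`, and `ξ ≤ 1` covers the
case where `λ` is raised. As for times: the first purge happens at some `k t* ≥ T` and empties the
transient stack, so whatever enters that stack later is recorded at `T + t*` or after; the second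
purge moves exactly such data into the main stack. -/
theorem AlgInvariant.step {D : Tuning p} (hD : D.Valid) {Yh : ℝ → Mat n p} {k : ℕ}
    {s s' : AlgState D.N} (hs : AlgInvariant D Yh k s)
    (h : AlgStep D Yh (((k + 1 : ℕ) : ℝ) * D.tstar) s s') : AlgInvariant D Yh (k + 1) s' := by
  obtain ⟨-, -, -, -, -, hts, -, hξ, hξ1, -⟩ := hD
  have hk : (k : ℝ) * D.tstar ≤ ((k + 1 : ℕ) : ℝ) * D.tstar := by
    push_cast; nlinarith
  have same : AlgInvariant D Yh (k + 1) s :=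
    ⟨hs.main_time, hs.trans_time, hs.mul_lam_le, hs.le_lam,
      fun h1 => (hs.sampled h1).trans hk, hs.trans_purged, hs.main_purged⟩
  rcases h with ⟨-, rfl⟩ | ⟨hT, ⟨-, rfl⟩ | ⟨j, lam1, G1, hlam, -, -, hG, ⟨hp, rfl⟩ | ⟨-, rfl⟩⟩⟩
  · exact same
  · exact same
  · have hG0 := minEig_nonneg (gram_posSemidef Yh G1)
    have htr : ∀ i τ, G1 i = some τ → D.T ≤ τ := fun i τ hi => by
      rcases hG.eq_some hi with rfl | h1
      · exact hT
      · exact hs.trans_time i τ h1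
    refine ⟨htr, by simp, ?_, le_max_right _ _, fun _ => hT, by simp, ?_⟩
    · simp only
      rcases le_total lam1 (minEig (gram Yh G1)) with h1 | h1
      · rw [max_eq_right h1]
        nlinarith
      · rw [max_eq_left h1]
        exact hp.1
    · intro h2 i τ hi
      simp only at h2 hi
      have h1 : 1 ≤ s.purges := by omega
      rcases hG.eq_some hi with rfl | h3
      · have := hs.sampled h1
        push_cast
        linarith
      · exact hs.trans_purged h1 i τ h3
  · have hH0 := minEig_nonneg (gram_posSemidef Yh (s.main.put j (((k + 1 : ℕ) : ℝ) * D.tstar)))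
    refine ⟨fun i τ hi => ?_, fun i τ hi => ?_, ?_, hlam.ge, fun _ => hT, fun h1 i τ hi => ?_,
      fun h2 i τ hi => ?_⟩
    · rcases Stack.put_eq_some hi with rfl | h1
      · exact hT
      · exact hs.main_time i τ h1
    · rcases hG.eq_some hi with rfl | h1
      · exact hT
      · exact hs.trans_time i τ h1
    · simp only
      rw [hlam]
      nlinarith
    · rcases hG.eq_some hi with rfl | h3
      · have := hs.sampled h1
        push_cast
        linarith
      · exact hs.trans_purged h1 i τ h3
    · rcases Stack.put_eq_some hi with rfl | h3
      · have := hs.sampled (one_le_two.trans h2)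
        push_cast
        linarith
      · exact hs.main_purged h2 i τ h3

theorem AlgStep.lam_le {D : Tuning p} (hD : D.Valid) {Yh : ℝ → Mat n p} {t : ℝ}
    {s s' : AlgState D.N} (h : AlgStep D Yh t s s') : s.lam ≤ s'.lam := by
  obtain ⟨-, -, -, -, -, -, hl, -⟩ := hD
  rcases h with ⟨-, rfl⟩ | ⟨-, ⟨-, rfl⟩ | ⟨j, lam1, G1, -, -, hl1, -, ⟨-, rfl⟩ | ⟨-, rfl⟩⟩⟩
  · exact le_rfl
  · exact le_rfl
  · exact le_max_of_le_left (by linarith)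
  · simp only; linarith

theorem AlgStep.purges_le {D : Tuning p} {Yh : ℝ → Mat n p} {t : ℝ}
    {s s' : AlgState D.N} (h : AlgStep D Yh t s s') : s.purges ≤ s'.purges := by
  rcases h with ⟨-, rfl⟩ | ⟨-, ⟨-, rfl⟩ | ⟨j, lam1, G1, -, -, -, -, ⟨-, rfl⟩ | ⟨-, rfl⟩⟩⟩
  all_goals simp

end RecordingAlgorithm

/-! ### Consequences for the active stack: late data and persistent excitation. -/

section ClosedLoopStacks

variable {n m p q : ℕ} {S : Plant n m p q} {K : JacBounds n} {D : Tuning p}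
  {R : Loop n m p q D.N} {𝒞 : Set (Vec n)} {𝒰 : Set (Vec m)}

theorem IsClosedLoop.algInvariant (h : IsClosedLoop S K D R 𝒞 𝒰) (hD : D.Valid) (k : ℕ) :
    AlgInvariant D (Yhat S D R) k (R.alg k) := by
  induction k with
  | zero => rw [h.alg_zero]; exact AlgInvariant.init D _
  | succ k ih => exact ih.step hD (h.alg_step k)

theorem IsClosedLoop.lam_mono (h : IsClosedLoop S K D R 𝒞 𝒰) (hD : D.Valid) :
    Monotone fun k => (R.alg k).lam :=
  monotone_nat_of_le_succ fun k => (h.alg_step k).lam_le hD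

theorem IsClosedLoop.purges_mono (h : IsClosedLoop S K D R 𝒞 𝒰) :
    Monotone fun k => (R.alg k).purges :=
  monotone_nat_of_le_succ fun k => (h.alg_step k).purges_le

theorem IsClosedLoop.activeStack_time (h : IsClosedLoop S K D R 𝒞 𝒰) (hD : D.Valid) {t τ : ℝ}
    {i : Fin D.N} (hi : activeStack D R t i = some τ) : D.T ≤ τ :=
  (h.algInvariant hD _).main_time i τ hi

theorem le_floor_of_mul_le {D : Tuning p} (hD : D.Valid) {t : ℝ} {k : ℕ}
    (hkt : (k : ℝ) * D.tstar ≤ t) : k ≤ ⌊t / D.tstar⌋₊ :=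
  Nat.le_floor ((le_div_iff₀ hD.2.2.2.2.2.1).2 hkt)

/-- After two purges, only data recorded a full delay after the first sampling time is in use. -/
theorem IsClosedLoop.activeStack_time_of_purged (h : IsClosedLoop S K D R 𝒞 𝒰) (hD : D.Valid)
    {c₀ τ₀ : ℝ} (he : ExcitedThroughTwoPurges S D R c₀ τ₀) {t τ : ℝ} (ht : τ₀ ≤ t)
    {i : Fin D.N} (hi : activeStack D R t i = some τ) : D.T + D.tstar ≤ τ := by
  obtain ⟨k, hk, hkτ, -⟩ := he
  refine (h.algInvariant hD _).main_purged ?_ i τ hi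
  rw [← hk]
  exact h.purges_mono (le_floor_of_mul_le hD (hkτ.trans ht))

/-- Once the excitation condition holds, replacements and purges keep the active stack exciting. -/
theorem IsClosedLoop.le_minEig_PsiMat (h : IsClosedLoop S K D R 𝒞 𝒰) (hD : D.Valid)
    {B c₀ τ₀ : ℝ} (hB : ∀ t, D.T ≤ t → ‖Yhat S D R t‖ ≤ B) (hB0 : 0 ≤ B)
    (he : ExcitedThroughTwoPurges S D R c₀ τ₀) {t : ℝ} (ht : τ₀ ≤ t) :
    D.ξ * c₀ / (1 + D.κ * B ^ 2) ≤ minEig (PsiMat S D R t) := by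
  have hinv := h.algInvariant hD ⌊t / D.tstar⌋₊
  obtain ⟨k, -, hkτ, hk⟩ := he
  have hmono := h.lam_mono hD (le_floor_of_mul_le hD (hkτ.trans ht))
  have hκ : 0 < D.κ := hD.1
  have hξ : 0 < D.ξ := hD.2.2.2.2.2.2.2.1
  have h1 : c₀ ≤ (R.alg k).lam :=
    (hk.trans (minEig_normGram_le_gram hκ _ _)).trans (h.algInvariant hD k).le_lam
  have h2 : D.ξ * c₀ ≤ minEig (gram (Yhat S D R) (activeStack D R t)) :=
    (mul_le_mul_of_nonneg_left (h1.trans hmono) hξ.le).trans hinv.mul_lam_le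
  refine le_trans ?_ (minEig_gram_div_le (B := B) hκ (Yhat S D R) (activeStack D R t) fun i => ?_)
  · gcongr
  · cases hi : activeStack D R t i with
    | none => simpa [slotValue] using hB0
    | some τ => exact hB τ (h.activeStack_time hD hi)

end ClosedLoopStacks

/-! ### Scalar comparison lemmas and the linear equation of the inverse gain. -/

section GainDynamics

theorem Matrix.continuous_entry {k l : ℕ} (i : Fin k) (j : Fin l) :
    Continuous fun M : Mat k l => M i j :=
  (LinearMap.toContinuousLinearMap (Matrix.entryLinearMap ℝ ℝ i j : Mat k l →ₗ[ℝ] ℝ)).continuous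

theorem SolvesODE.entry {k l : ℕ} {f r : ℝ → Mat k l} (h : SolvesODE f r) (i : Fin k)
    (j : Fin l) : SolvesODE (fun t => f t i j) (fun t => r t i j) := by
  have : CompleteSpace (Mat k l) := FiniteDimensional.complete ℝ _
  exact h.clm_comp (LinearMap.toContinuousLinearMap
    (Matrix.entryLinearMap ℝ ℝ i j : Mat k l →ₗ[ℝ] ℝ))

theorem SolvesODE.coord {k : ℕ} {f r : ℝ → Vec k} (h : SolvesODE f r) (i : Fin k) :
    SolvesODE (fun t => f t i) (fun t => r t i) :=
  h.clm_comp (EuclideanSpace.proj i : Vec k →L[ℝ] ℝ)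

theorem intervalIntegrable_of_measurable_of_abs_le {f : ℝ → ℝ} (hf : Measurable f) {s t b : ℝ}
    (hb : ∀ τ ∈ uIcc s t, |f τ| ≤ b) : IntervalIntegrable f volume s t := by
  rw [intervalIntegrable_iff]
  refine Measure.integrableOn_of_bounded (M := b) (by simp) hf.aestronglyMeasurable ?_
  exact (ae_restrict_iff' measurableSet_uIoc).2
    (Eventually.of_forall fun τ hτ => hb τ (uIoc_subset_uIcc hτ))

theorem solvesODE_integral_of_measurable {χ : ℝ → ℝ} (hm : Measurable χ) (h0 : ∀ t, 0 ≤ χ t)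
    (h1 : ∀ t, χ t ≤ 1) : SolvesODE (fun t => ∫ s in (0 : ℝ)..t, χ s) χ := by
  intro t ht
  exact ⟨intervalIntegrable_of_measurable_of_abs_le hm fun τ _ =>
    abs_le.2 ⟨by linarith [h0 τ], h1 τ⟩, by simp⟩

section Comparison

variable {χ q h : ℝ → ℝ} {β₁ : ℝ}

/-- `χ` acts as a clock of speed at most one, so `exp (β₁ ∫ χ)` is the integrating factor of `q' = χ
(-β₁ q + h)`. -/
theorem SolvesODE.mul_exp_integral (hm : Measurable χ) (h0 : ∀ t, 0 ≤ χ t) (h1 : ∀ t, χ t ≤ 1)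
    (hq : SolvesODE q (fun t => χ t * (-β₁ * q t + h t))) (C : ℝ) :
    SolvesODE (fun t => Real.exp (β₁ * ∫ s in (0 : ℝ)..t, χ s) * (q t - C))
      (fun t => Real.exp (β₁ * ∫ s in (0 : ℝ)..t, χ s) * χ t * (h t - β₁ * C)) := by
  refine (((solvesODE_integral_of_measurable hm h0 h1).exp_mul β₁).mul
    (hq.sub (solvesODE_const C))).congr_rhs fun t _ => ?_
  ring

theorem integral_mono_right_of_nonneg (hm : Measurable χ) (h0 : ∀ t, 0 ≤ χ t)
    (h1 : ∀ t, χ t ≤ 1) {s t : ℝ} (hs : 0 ≤ s) (hst : s ≤ t) :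
    ∫ τ in (0 : ℝ)..s, χ τ ≤ ∫ τ in (0 : ℝ)..t, χ τ := by
  have := (solvesODE_integral_of_measurable hm h0 h1).neg.le_of_nonpos hs hst fun τ _ => by
    linarith [h0 τ]
  linarith

/-- The product of the integrating factor with `q - C` does not increase, while the factor itself
does not decrease: a nonpositive `q - C` stays nonpositive and a positive one cannot grow. -/
theorem SolvesODE.le_max (hm : Measurable χ) (h0 : ∀ t, 0 ≤ χ t) (h1 : ∀ t, χ t ≤ 1)
    (hβ : 0 < β₁) (hq : SolvesODE q (fun t => χ t * (-β₁ * q t + h t))) {s t C : ℝ}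
    (hs : 0 ≤ s) (hst : s ≤ t) (hC : ∀ τ ∈ Icc s t, h τ ≤ β₁ * C) : q t ≤ max (q s) C := by
  have h2 := (hq.mul_exp_integral hm h0 h1 C).le_of_nonpos hs hst fun τ hτ =>
    mul_nonpos_of_nonneg_of_nonpos (mul_nonneg (Real.exp_pos _).le (h0 τ))
      (by linarith [hC τ hτ])
  have h3 : Real.exp (β₁ * ∫ τ in (0 : ℝ)..s, χ τ) ≤ Real.exp (β₁ * ∫ τ in (0 : ℝ)..t, χ τ) :=
    Real.exp_le_exp.2
      (mul_le_mul_of_nonneg_left (integral_mono_right_of_nonneg hm h0 h1 hs hst) hβ.le)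
  have h4 := Real.exp_pos (β₁ * ∫ τ in (0 : ℝ)..s, χ τ)
  set a := Real.exp (β₁ * ∫ τ in (0 : ℝ)..s, χ τ)
  set b := Real.exp (β₁ * ∫ τ in (0 : ℝ)..t, χ τ)
  rcases le_total (q s) C with h5 | h5
  · refine le_max_of_le_right ?_
    by_contra! h6
    nlinarith [mul_pos (h4.trans_le h3) (sub_pos.2 h6)]
  · refine le_max_of_le_left ?_
    by_contra! h6
    nlinarith [mul_pos (h4.trans_le h3) (sub_pos.2 h6)]

theorem SolvesODE.min_le (hm : Measurable χ) (h0 : ∀ t, 0 ≤ χ t) (h1 : ∀ t, χ t ≤ 1)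
    (hβ : 0 < β₁) (hq : SolvesODE q (fun t => χ t * (-β₁ * q t + h t))) {s t C : ℝ}
    (hs : 0 ≤ s) (hst : s ≤ t) (hC : ∀ τ ∈ Icc s t, β₁ * C ≤ h τ) : min (q s) C ≤ q t := by
  have hq' : SolvesODE (fun t => -q t) (fun t => χ t * (-β₁ * (-q t) + -h t)) :=
    hq.neg.congr_rhs fun t _ => by ring
  have := SolvesODE.le_max hm h0 h1 hβ hq' (C := -C) hs hst fun τ hτ => by linarith [hC τ hτ]
  rw [max_neg_neg] at this
  linarith

/-- At time `t` the clock shows at most `t`, so for `h ≥ 0` the decay is no faster than with `χ =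
1`. -/
theorem SolvesODE.exp_mul_le (hm : Measurable χ) (h0 : ∀ t, 0 ≤ χ t) (h1 : ∀ t, χ t ≤ 1)
    (hβ : 0 < β₁) (hq : SolvesODE q (fun t => χ t * (-β₁ * q t + h t))) {t : ℝ}
    (ht : 0 ≤ t) (hh : ∀ τ ∈ Icc 0 t, 0 ≤ h τ) (hq0 : 0 ≤ q 0) :
    Real.exp (-β₁ * t) * q 0 ≤ q t := by
  have h2 := (hq.mul_exp_integral hm h0 h1 0).neg.le_of_nonpos le_rfl ht fun τ hτ =>
    neg_nonpos.2 (mul_nonneg (mul_nonneg (Real.exp_pos _).le (h0 τ)) (by simpa using hh τ hτ))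
  have h3 : Real.exp (β₁ * ∫ τ in (0 : ℝ)..t, χ τ) ≤ Real.exp (β₁ * t) := by
    have := (solvesODE_integral_of_measurable hm h0 h1).le_add_mul le_rfl ht fun τ _ => h1 τ
    refine Real.exp_le_exp.2 (mul_le_mul_of_nonneg_left ?_ hβ.le)
    simpa using this
  simp only [intervalIntegral.integral_same, mul_zero, Real.exp_zero, one_mul, sub_zero,
    neg_le_neg_iff] at h2
  have h4 : Real.exp (-β₁ * t) * Real.exp (β₁ * t) = 1 := by rw [← Real.exp_add]; simp
  have h5 : 0 ≤ q t := by
    by_contra! h6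
    nlinarith [mul_pos (Real.exp_pos (β₁ * ∫ τ in (0 : ℝ)..t, χ τ)) (neg_pos.2 h6)]
  calc Real.exp (-β₁ * t) * q 0 ≤ Real.exp (-β₁ * t) * (Real.exp (β₁ * t) * q t) := by
        gcongr
        exact h2.trans (mul_le_mul_of_nonneg_right h3 h5)
    _ = q t := by rw [← mul_assoc, h4, one_mul]

end Comparison

variable {p : ℕ}

/-- A linear homogeneous matrix equation with locally bounded coefficients has only the zero
solution from zero initial data. -/
theorem eq_zero_of_solvesODE_mul {Z G : ℝ → Mat p p}
    (hZ : ∀ i j, SolvesODE (fun t => Z t i j) (fun t => (G t * Z t) i j)) (hZ0 : Z 0 = 0)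
    {t B : ℝ} (ht : 0 ≤ t) (hG : ∀ τ ∈ Icc 0 t, ∀ i j, |G τ i j| ≤ B) : Z t = 0 := by
  have hz : SolvesODE (fun t => ∑ i, ∑ j, Z t i j * Z t i j)
      (fun t => ∑ i, ∑ j, ((G t * Z t) i j * Z t i j + Z t i j * (G t * Z t) i j)) :=
    SolvesODE.sum _ fun i _ => SolvesODE.sum _ fun j _ => (hZ i j).mul (hZ i j)
  have hle : ∀ τ i j, Z τ i j ^ 2 ≤ ∑ i, ∑ j, Z τ i j * Z τ i j := fun τ i j => by
    calc Z τ i j ^ 2 = Z τ i j * Z τ i j := sq _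
      _ ≤ ∑ j, Z τ i j * Z τ i j :=
        Finset.single_le_sum (f := fun j => Z τ i j * Z τ i j)
          (fun j _ => mul_self_nonneg _) (Finset.mem_univ j)
      _ ≤ _ := Finset.single_le_sum (f := fun i => ∑ j, Z τ i j * Z τ i j)
          (fun i _ => Finset.sum_nonneg fun j _ => mul_self_nonneg _) (Finset.mem_univ i)
  -- Growth rate of the sum of squares `z`: `p²` entries, each contributing at most `2 p |B| z`. The
  -- added `1` keeps the rate nonzero for Grönwall.
  have hη : -(2 * (p : ℝ) ^ 3 * |B| + 1) ≠ 0 := by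
    have : 0 ≤ 2 * (p : ℝ) ^ 3 * |B| := by positivity
    linarith
  have key := hz.gronwall (b := 0) hη le_rfl ht fun τ hτ => by
    set z := ∑ i, ∑ j, Z τ i j * Z τ i j
    have hz0 : 0 ≤ z := Finset.sum_nonneg fun i _ => Finset.sum_nonneg fun j _ => mul_self_nonneg _
    have h1 : ∀ i j, (G τ * Z τ) i j * Z τ i j + Z τ i j * (G τ * Z τ) i j ≤
        2 * (p * |B| * z) := fun i j => by
      have h2 : (G τ * Z τ) i j * Z τ i j ≤ p * |B| * z := by
        rw [Matrix.mul_apply, Finset.sum_mul]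
        calc ∑ k, G τ i k * Z τ k j * Z τ i j ≤ ∑ _k : Fin p, |B| * z :=
              Finset.sum_le_sum fun k _ => by
                have h3 : |Z τ k j * Z τ i j| ≤ z := by
                  rw [abs_le]
                  constructor <;>
                  nlinarith [hle τ k j, hle τ i j, sq_nonneg (Z τ k j + Z τ i j),
                    sq_nonneg (Z τ k j - Z τ i j)]
                calc G τ i k * Z τ k j * Z τ i j ≤ |G τ i k * (Z τ k j * Z τ i j)| := by
                      rw [mul_assoc]; exact le_abs_self _
                  _ = |G τ i k| * |Z τ k j * Z τ i j| := abs_mul _ _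
                  _ ≤ |B| * z :=
                      mul_le_mul ((hG τ hτ i k).trans (le_abs_self B)) h3 (abs_nonneg _)
                        (abs_nonneg _)
          _ = p * |B| * z := by simp; ring
      linarith [mul_comm (Z τ i j) ((G τ * Z τ) i j)]
    calc ∑ i, ∑ j, ((G τ * Z τ) i j * Z τ i j + Z τ i j * (G τ * Z τ) i j)
        ≤ ∑ _i : Fin p, ∑ _j : Fin p, 2 * (p * |B| * z) :=
          Finset.sum_le_sum fun i _ => Finset.sum_le_sum fun j _ => h1 i j
      _ = 2 * (p : ℝ) ^ 3 * |B| * z := by simp; ring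
      _ ≤ _ := by linarith
  simp only [hZ0, Matrix.zero_apply, mul_zero, Finset.sum_const_zero, zero_div, sub_zero,
    add_zero] at key
  ext i j
  have := (hle t i j).trans key
  simpa using pow_eq_zero_iff (two_ne_zero) |>.1 (le_antisymm this (sq_nonneg _))

/-- The inverse of the least-squares gain solves a linear equation. -/
theorem exists_inverse_gain {Γ Ψ : ℝ → Mat p p} {χ : ℝ → ℝ} {β₁ k b : ℝ} (hΓ0 : (Γ 0).PosDef)
    (hm : Measurable χ) (h0 : ∀ t, 0 ≤ χ t) (h1 : ∀ t, χ t ≤ 1)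
    (hΨm : ∀ i j, Measurable fun t => Ψ t i j) (hΨ : ∀ t, (Ψ t).IsHermitian)
    (hΨb : ∀ t i j, |Ψ t i j| ≤ b)
    (hΓ : SolvesODE Γ (fun t => χ t • (β₁ • Γ t - k • (Γ t * Ψ t * Γ t)))) :
    ∃ W : ℝ → Mat p p, W 0 = (Γ 0)⁻¹ ∧ (∀ t, (W t).IsHermitian) ∧
      (∀ i j, SolvesODE (fun t => W t i j)
        (fun t => χ t * (-β₁ * W t i j + k * Ψ t i j))) ∧
      ∀ t, 0 ≤ t → Γ t * W t = 1 := by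
  have hmu := solvesODE_integral_of_measurable hm h0 h1
  set μ : ℝ → ℝ := fun t => ∫ s in (0 : ℝ)..t, χ s with hμdef
  have hχi : ∀ s t, IntervalIntegrable χ volume s t := fun s t =>
    intervalIntegrable_of_measurable_of_abs_le (b := 1) hm fun τ _ =>
      abs_le.2 ⟨by linarith [h0 τ], h1 τ⟩
  have hμc : Continuous μ := intervalIntegral.continuous_primitive hχi 0
  have hJ : ∀ i j, SolvesODE (fun t => ∫ s in (0 : ℝ)..t, χ s * (Real.exp (β₁ * μ s) * Ψ s i j))
      (fun t => χ t * (Real.exp (β₁ * μ t) * Ψ t i j)) := fun i j t ht => by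
    refine ⟨?_, by simp⟩
    have he : Continuous fun s => Real.exp (β₁ * μ s) :=
      Real.continuous_exp.comp (continuous_const.mul hμc)
    have hi := intervalIntegrable_of_measurable_of_abs_le (s := 0) (t := t) (b := b)
      (hm.mul (hΨm i j)) fun τ _ => by
        simp only [Pi.mul_apply]
        rw [abs_mul, abs_of_nonneg (h0 τ)]
        nlinarith [hΨb τ i j, abs_nonneg (Ψ τ i j), h0 τ, h1 τ]
    refine (hi.continuousOn_mul he.continuousOn).congr ?_
    intro s _
    simp only [Pi.mul_apply]
    ring
  -- Variation of constants for the expected equation of the inverse; invertibility of `Γ t` at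
  -- positive times is not presupposed.
  let W : ℝ → Mat p p := fun t => Matrix.of fun i j => Real.exp (-β₁ * μ t) *
    ((Γ 0)⁻¹ i j + k * ∫ s in (0 : ℝ)..t, χ s * (Real.exp (β₁ * μ s) * Ψ s i j))
  have hW : ∀ i j, SolvesODE (fun t => W t i j)
      (fun t => χ t * (-β₁ * W t i j + k * Ψ t i j)) := fun i j => by
    have h2 := (hmu.exp_mul (-β₁)).mul
      ((solvesODE_const ((Γ 0)⁻¹ i j)).add ((hJ i j).const_mul k))
    refine h2.congr_rhs fun t _ => ?_
    have h3 : Real.exp (-β₁ * μ t) * Real.exp (β₁ * μ t) = 1 := by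
      rw [← Real.exp_add]; simp
    simp only [W, Matrix.of_apply]
    linear_combination k * χ t * Ψ t i j * h3
  have hW0 : W 0 = (Γ 0)⁻¹ := by
    ext i j
    simp [W, hμdef]
  refine ⟨W, hW0, fun t => ?_, hW, fun t ht => ?_⟩
  · ext i j
    have h2 : ∀ s, Ψ s j i = Ψ s i j := fun s => by
      have := (hΨ s).apply i j
      simpa using this
    have h3 : (Γ 0)⁻¹ j i = (Γ 0)⁻¹ i j := by
      have := hΓ0.inv.1.apply i j
      simpa using this
    simp [W, h2, h3]
  · have hdet : IsUnit (Γ 0).det := (Matrix.isUnit_iff_isUnit_det _).1 hΓ0.isUnit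
    -- The terms with `β₁` cancel in the derivative of `1 - Γ W`, leaving a linear homogeneous
    -- equation with zero initial value; uniqueness gives `Γ W = 1`.
    have hZ : ∀ i j, SolvesODE (fun t => (1 - Γ t * W t) i j)
        (fun t => ((-(χ t * k) • (Γ t * Ψ t)) * (1 - Γ t * W t)) i j) := fun i j => by
      have h2 : SolvesODE (fun t => ∑ l, Γ t i l * W t l j) _ :=
        SolvesODE.sum Finset.univ fun l _ => (hΓ.entry i l).mul (hW l j)
      refine ((solvesODE_const ((1 : Mat p p) i j)).sub h2).congr (fun t _ => ?_) fun t _ => ?_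
      · simp [Matrix.mul_apply]
      · have h3 : ∑ l, ((χ t • (β₁ • Γ t - k • (Γ t * Ψ t * Γ t))) i l * W t l j +
            Γ t i l * (χ t * (-β₁ * W t l j + k * Ψ t l j))) =
            ((χ t • (β₁ • Γ t - k • (Γ t * Ψ t * Γ t))) * W t +
              Γ t * (χ t • (-β₁ • W t + k • Ψ t))) i j := by
          rw [Matrix.add_apply, Matrix.mul_apply, Matrix.mul_apply, ← Finset.sum_add_distrib]
          simp
        have h4 : -((χ t • (β₁ • Γ t - k • (Γ t * Ψ t * Γ t))) * W t +
            Γ t * (χ t • (-β₁ • W t + k • Ψ t))) =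
            (-(χ t * k) • (Γ t * Ψ t)) * (1 - Γ t * W t) := by
          simp only [smul_sub, smul_add, sub_mul, mul_add, mul_sub, Matrix.smul_mul,
            Matrix.mul_smul, Matrix.mul_assoc, mul_one]
          module
        rw [h3, zero_sub, ← h4]
        rfl
    have hentry : ∃ B', ∀ τ ∈ Icc 0 t, ∀ i j, |Γ τ i j| ≤ B' := by
      have : ∀ i j, ∃ B', ∀ τ ∈ Icc 0 t, ‖Γ τ i j‖ ≤ B' := fun i j =>
        isCompact_Icc.exists_bound_of_continuousOn
          ((hΓ.entry i j).continuousOn.mono fun x hx => hx.1)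
      choose B' hB' using this
      refine ⟨∑ i, ∑ j, |B' i j|, fun τ hτ i j => ((hB' i j τ hτ).trans (le_abs_self _)).trans ?_⟩
      exact (Finset.single_le_sum (f := fun j => |B' i j|) (fun _ _ => abs_nonneg _)
        (Finset.mem_univ j)).trans (Finset.single_le_sum (f := fun i => ∑ j, |B' i j|)
          (fun i _ => Finset.sum_nonneg fun _ _ => abs_nonneg _) (Finset.mem_univ i))
    obtain ⟨B', hB'⟩ := hentry
    have hzero := eq_zero_of_solvesODE_mul (Z := fun t => 1 - Γ t * W t)
      (G := fun t => -(χ t * k) • (Γ t * Ψ t)) (B := |k| * (p * (|B'| * |b|))) hZ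
      (by simp [hW0, Matrix.mul_nonsing_inv _ hdet]) ht fun τ hτ i j => by
        rw [Matrix.smul_apply, smul_eq_mul, abs_mul, abs_neg, abs_mul, abs_of_nonneg (h0 τ),
          Matrix.mul_apply]
        have h4 : |∑ l, Γ τ i l * Ψ τ l j| ≤ p * (|B'| * |b|) := by
          calc |∑ l, Γ τ i l * Ψ τ l j| ≤ ∑ l, |Γ τ i l * Ψ τ l j| :=
                Finset.abs_sum_le_sum_abs _ _
            _ ≤ ∑ _l : Fin p, |B'| * |b| := Finset.sum_le_sum fun l _ => by
                rw [abs_mul]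
                exact mul_le_mul ((hB' τ hτ i l).trans (le_abs_self _))
                  ((hΨb τ l j).trans (le_abs_self _)) (abs_nonneg _) (abs_nonneg _)
            _ = p * (|B'| * |b|) := by simp
        have h5 : χ τ * |k| ≤ |k| := mul_le_of_le_one_left (abs_nonneg k) (h1 τ)
        gcongr
    exact (sub_eq_zero.1 hzero).symm

theorem solvesODE_inner_app {W U : ℝ → Mat p p}
    (hW : ∀ i j, SolvesODE (fun t => W t i j) (fun t => U t i j)) (v : Vec p) :
    SolvesODE (fun t => inner ℝ v (app (W t) v)) (fun t => inner ℝ v (app (U t) v)) := by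
  simp only [inner_app_eq_sum]
  refine SolvesODE.sum _ fun i _ => SolvesODE.sum _ fun j _ =>
    (((hW i j).const_mul (v i * v j)).congr (fun t _ => by ring) fun t _ => by ring)

end GainDynamics

/-! ### Quadratic form bounds pass to the inverse matrix. -/

section InverseBounds

variable {p : ℕ} {W G : Mat p p}

theorem Matrix.IsHermitian.of_mul_eq_one (hW : W.IsHermitian) (h : G * W = 1) :
    G.IsHermitian := by
  have : G = W⁻¹ := (Matrix.inv_eq_left_inv h).symm
  rw [this]
  exact hW.inv

theorem app_mul_app_of_mul_eq_one (h : G * W = 1) (v : Vec p) : app W (app G v) = v := by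
  rw [← mul_app, mul_eq_one_comm.1 h, one_app]

theorem inner_app_of_mul_eq_one (h : G * W = 1) (v : Vec p) :
    inner ℝ (app G v) (app W (app G v)) = inner ℝ v (app G v) := by
  rw [app_mul_app_of_mul_eq_one h, real_inner_comm]

/-- Expand the form of `W` at `G v - v / w`, which is nonnegative; the cross terms are `‖v‖²`
because `W G = 1`. -/
theorem div_le_inner_app_of_mul_eq_one (hW : W.IsHermitian) (h : G * W = 1) {w : ℝ}
    (hw : 0 < w) (hle : ∀ v : Vec p, inner ℝ v (app W v) ≤ w * ‖v‖ ^ 2)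
    (h0 : ∀ v : Vec p, 0 ≤ inner ℝ v (app W v)) (v : Vec p) :
    1 / w * ‖v‖ ^ 2 ≤ inner ℝ v (app G v) := by
  have h1 := h0 (app G v - (1 / w) • v)
  have h2 : inner ℝ v (app W (app G v)) = ‖v‖ ^ 2 := by
    rw [app_mul_app_of_mul_eq_one h, real_inner_self_eq_norm_sq]
  have h3 : inner ℝ (app G v) (app W v) = ‖v‖ ^ 2 := by
    rw [← inner_app_symm hW, app_mul_app_of_mul_eq_one h, real_inner_self_eq_norm_sq]
  simp only [app_sub, app_smul, inner_sub_left, inner_sub_right, inner_smul_left,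
    inner_smul_right, inner_app_of_mul_eq_one h, h2, h3] at h1
  have h4 : 1 / w * (1 / w * inner ℝ v (app W v)) ≤ 1 / w * (1 / w * (w * ‖v‖ ^ 2)) := by
    have := hle v
    gcongr
  have h5 : 1 / w * (1 / w * (w * ‖v‖ ^ 2)) = 1 / w * ‖v‖ ^ 2 := by field_simp
  simp only [conj_trivial] at h1
  linarith

/-- At the vector `G v` the hypothesis reads `w ‖G v‖² ≤ ⟨v, G v⟩ ≤ ‖v‖ ‖G v‖`, so `‖G v‖ ≤ ‖v‖ /
w`. -/
theorem inner_app_le_of_mul_eq_one (h : G * W = 1) {w : ℝ}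
    (hw : 0 < w) (hle : ∀ v : Vec p, w * ‖v‖ ^ 2 ≤ inner ℝ v (app W v)) (v : Vec p) :
    inner ℝ v (app G v) ≤ 1 / w * ‖v‖ ^ 2 := by
  have h1 := hle (app G v)
  rw [inner_app_of_mul_eq_one h] at h1
  have h2 := real_inner_le_norm v (app G v)
  have h3 : (w * ‖app G v‖) * ‖app G v‖ ≤ ‖v‖ * ‖app G v‖ := by nlinarith
  have h4 : w * ‖app G v‖ ≤ ‖v‖ := by
    rcases (norm_nonneg (app G v)).eq_or_lt with h5 | h5
    · rw [← h5]; simp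
    · exact le_of_mul_le_mul_right h3 h5
  have h5 : ‖app G v‖ ≤ 1 / w * ‖v‖ := by
    rw [one_div_mul_eq_div, le_div_iff₀ hw]; linarith
  nlinarith [norm_nonneg v]

theorem sub_smul_one_posSemidef {c : ℝ} (hG : G.IsHermitian)
    (h : ∀ v : Vec p, c * ‖v‖ ^ 2 ≤ inner ℝ v (app G v)) : (G - c • (1 : Mat p p)).PosSemidef := by
  refine posSemidef_of_inner (hG.sub (by simp [Matrix.IsHermitian])) fun v => ?_
  have := h v
  simp only [sub_app, smul_app, one_app, inner_sub_right, inner_smul_right,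
    real_inner_self_eq_norm_sq]
  linarith

theorem smul_one_sub_posSemidef {c : ℝ} (hG : G.IsHermitian)
    (h : ∀ v : Vec p, inner ℝ v (app G v) ≤ c * ‖v‖ ^ 2) : (c • (1 : Mat p p) - G).PosSemidef := by
  refine posSemidef_of_inner (Matrix.IsHermitian.sub (by simp [Matrix.IsHermitian]) hG)
    fun v => ?_
  have := h v
  simp only [sub_app, smul_app, one_app, inner_sub_right, inner_smul_right,
    real_inner_self_eq_norm_sq]
  linarith

end InverseBounds

/-! ### The inverse gain along a trajectory and its uniform bounds. -/

section LoopGain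

variable {n m p q : ℕ} (S : Plant n m p q) (K : JacBounds n) (D : Tuning p)
  (R : Loop n m p q D.N)

theorem abs_entry_le_norm {k l : ℕ} (M : Mat k l) (i : Fin k) (j : Fin l) : |M i j| ≤ ‖M‖ := by
  have h1 : app M (EuclideanSpace.single j 1) i = M i j := by
    simp [app_apply]
  have h2 := norm_app_le M (EuclideanSpace.single j 1)
  rw [← h1]
  refine (PiLp.norm_apply_le (app M (EuclideanSpace.single j 1)) i).trans (h2.trans ?_)
  simp

theorem norm_normGram_le {N : ℕ} {κ : ℝ} (hκ : 0 < κ) (Yh : ℝ → Mat n p) (H : Stack N) :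
    ‖normGram κ Yh H‖ ≤ N / κ := by
  rw [normGram]
  calc _ ≤ ∑ _i : Fin N, 1 / κ := norm_sum_le_of_le _ fun i _ => by
        set Y := slotValue Yh (H i)
        rw [norm_smul, Real.norm_of_nonneg (normalizer_nonneg hκ _)]
        have h1 : ‖Yᵀ * Y‖ ≤ ‖Y‖ ^ 2 := by
          refine (Matrix.l2_opNorm_mul _ _).trans ?_
          rw [norm_transpose, sq]
        calc normalizer κ Y * ‖Yᵀ * Y‖ ≤ normalizer κ Y * ‖Y‖ ^ 2 := by
              gcongr
              exact normalizer_nonneg hκ _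
          _ ≤ 1 / κ := by
              rw [normalizer, one_div_mul_eq_div, div_le_div_iff₀ (by positivity) hκ]
              linarith
    _ = N / κ := by simp [div_eq_mul_inv]

/-- The defining identity of the residual, slot by slot; an empty slot makes both sides zero. -/
theorem slotValue_phi_term (a : Option ℝ) (θh : Vec p) :
    slotValue (Xhat D R) a - slotValue (Ghat S D R) a - app (slotValue (Yhat S D R) a) θh =
      app (slotValue (Yhat S D R) a) (R.θ - θh) + slotValue (residualErr S D R) a := by
  cases a with
  | none => simp [slotValue]
  | some τ =>
    simp only [slotValue, Option.elim, residualErr, app_sub]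
    abel

/-- The update direction in terms of the parameter error and the residual. -/
theorem phi_eq (t : ℝ) :
    phi S D R t = app (PsiMat S D R t) (thetaErr D R t) + Qvec S D R t := by
  simp only [phi, PsiMat, normGram, Qvec, sum_app, thetaErr, ← Finset.sum_add_distrib]
  refine Finset.sum_congr rfl fun i _ => ?_
  rw [slotValue_phi_term, app_add, smul_add, smul_app, mul_app]

open Classical in
/-- The indicator of the times at which the projection is inactive. -/
noncomputable def unprojectedIndicator (t : ℝ) : ℝ :=
  if Unprojected S D R (max t 0) then 1 else 0

variable {S K D R}

theorem measurable_of_activeStack {f : Stack D.N → ℝ} :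
    Measurable fun t => f (activeStack D R t) :=
  (measurable_from_nat (f := fun k => f (R.alg k).main)).comp
    (Nat.measurable_floor.comp (measurable_id.div_const _))

theorem continuous_comp_max {E : Type*} [TopologicalSpace E] {f : ℝ → E}
    (hf : ContinuousOn f (Ici 0)) : Continuous fun t => f (max t 0) :=
  hf.comp_continuous (by fun_prop) fun t => mem_Ici.2 (le_max_right t 0)

variable {𝒞 : Set (Vec n)} {𝒰 : Set (Vec m)}

/-- Stack quantities are functions of `⌊t / t*⌋`, while `θ̂` and `Γ` are continuous on `[0, ∞)`.
Clamping time at `0` extends this to measurability on the whole line. -/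
theorem IsClosedLoop.measurable_unprojectedIndicator (h : IsClosedLoop S K D R 𝒞 𝒰) :
    Measurable (unprojectedIndicator S D R) := by
  classical
  have hθ : Continuous fun t => R.θh (max t 0) := continuous_comp_max h.update.continuousOn
  have hθi : ∀ i, Measurable fun t => R.θh (max t 0) i := fun i =>
    (continuous_comp_max (h.update.coord i).continuousOn).measurable
  have hΓ : ∀ i j, Measurable fun t => R.Γ (max t 0) i j := fun i j =>
    (continuous_comp_max (h.gain.entry i j).continuousOn).measurable
  have hmax : Measurable fun t : ℝ => max t 0 := measurable_id.max measurable_const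
  have hΨ : ∀ i j, Measurable fun t => PsiMat S D R (max t 0) i j := fun i j =>
    (measurable_of_activeStack (f := fun H => normGram D.κ (Yhat S D R) H i j)).comp hmax
  have hQ : ∀ i, Measurable fun t => Qvec S D R (max t 0) i := fun i =>
    (measurable_of_activeStack (f := fun H => (∑ i, normalizer D.κ (slotValue (Yhat S D R) (H i)) •
      app (slotValue (Yhat S D R) (H i))ᵀ (slotValue (residualErr S D R) (H i)) : Vec p) i)).comp
      hmax
  have hφ : ∀ i, Measurable fun t => phi S D R (max t 0) i := fun i => by
    simp only [phi_eq, PiLp.add_apply, app_apply, thetaErr, PiLp.sub_apply]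
    exact (Finset.measurable_sum _ fun j _ => (hΨ i j).mul ((hθi j).const_sub _)).add (hQ i)
  have hin : Measurable fun t =>
      inner ℝ (rawUpdate S D R (max t 0)) (R.θh (max t 0)) := by
    simp only [rawUpdate, inner_eq_sum, PiLp.smul_apply, app_apply, smul_eq_mul]
    exact Finset.measurable_sum _ fun i _ => ((Finset.measurable_sum _ fun j _ =>
      (hΓ i j).mul (hφ j)).const_mul _).mul (hθi i)
  have hn : Measurable fun t => ‖R.θh (max t 0)‖ ^ 2 := (hθ.norm.pow 2).measurable
  refine Measurable.ite ?_ measurable_const measurable_const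
  exact (measurableSet_lt hn measurable_const).union
    ((measurableSet_eq_fun hn measurable_const).inter (measurableSet_le hin measurable_const))

theorem unprojectedIndicator_nonneg (t : ℝ) : 0 ≤ unprojectedIndicator S D R t := by
  unfold unprojectedIndicator; split_ifs <;> simp

theorem unprojectedIndicator_le_one (t : ℝ) : unprojectedIndicator S D R t ≤ 1 := by
  unfold unprojectedIndicator; split_ifs <;> simp

theorem unprojectedIndicator_of {t : ℝ} (ht : 0 ≤ t) (h : Unprojected S D R t) :
    unprojectedIndicator S D R t = 1 := by
  simp [unprojectedIndicator, max_eq_left ht, h]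

theorem unprojectedIndicator_of_not {t : ℝ} (ht : 0 ≤ t) (h : ¬ Unprojected S D R t) :
    unprojectedIndicator S D R t = 0 := by
  simp [unprojectedIndicator, max_eq_left ht, h]

/-- `W` is the inverse of the least-squares gain. -/
structure IsInverseGain (S : Plant n m p q) (D : Tuning p) (R : Loop n m p q D.N)
    (W : ℝ → Mat p p) : Prop where
  zero : W 0 = D.Γ0⁻¹
  isHermitian : ∀ t, (W t).IsHermitian
  ode : ∀ i j, SolvesODE (fun t => W t i j) (fun t => (unprojectedIndicator S D R t •
    (-D.β1 • W t + D.kθ • PsiMat S D R t)) i j)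
  mul_eq_one : ∀ t, 0 ≤ t → R.Γ t * W t = 1

theorem IsClosedLoop.exists_isInverseGain (h : IsClosedLoop S K D R 𝒞 𝒰) (hD : D.Valid) :
    ∃ W, IsInverseGain S D R W := by
  obtain ⟨W, h1, h2, h3, h4⟩ := exists_inverse_gain (Γ := R.Γ) (Ψ := PsiMat S D R)
    (χ := unprojectedIndicator S D R) (β₁ := D.β1) (k := D.kθ) (b := D.N / D.κ)
    (h.gain_zero ▸ hD.2.2.2.1) h.measurable_unprojectedIndicator unprojectedIndicator_nonneg
    unprojectedIndicator_le_one
    (fun i j => measurable_of_activeStack (f := fun H => normGram D.κ (Yhat S D R) H i j))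
    (fun t => normGram_isHermitian _ _ _)
    (fun t i j => (abs_entry_le_norm _ i j).trans (norm_normGram_le hD.1 _ _))
    (h.gain.congr_rhs fun t ht => by
      unfold gammaRHS
      split_ifs with hu
      · rw [unprojectedIndicator_of ht hu, one_smul]
      · rw [unprojectedIndicator_of_not ht hu, zero_smul])
  exact ⟨W, by rw [h1, h.gain_zero], h2, fun i j => (h3 i j).congr_rhs fun t _ => by simp, h4⟩

namespace IsInverseGain

variable {W : ℝ → Mat p p}

theorem quadratic (hW : IsInverseGain S D R W) (v : Vec p) :
    SolvesODE (fun t => inner ℝ v (app (W t) v)) (fun t => unprojectedIndicator S D R t *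
      (-D.β1 * inner ℝ v (app (W t) v) + D.kθ * inner ℝ v (app (PsiMat S D R t) v))) :=
  (solvesODE_inner_app hW.ode v).congr_rhs fun t _ => by
    simp only [smul_app, add_app, inner_smul_right, inner_add_right]

/-- The middle term of the constant is the equilibrium of the comparison equation with `Ψ` replaced
by its bound `N/κ`; the final `1` ensures positivity. -/
theorem inner_le (hW : IsInverseGain S D R W) (h : IsClosedLoop S K D R 𝒞 𝒰) (hD : D.Valid)
    {t : ℝ} (ht : 0 ≤ t) (v : Vec p) :
    inner ℝ v (app (W t) v) ≤ (‖D.Γ0⁻¹‖ + D.kθ * (D.N / D.κ) / D.β1 + 1) * ‖v‖ ^ 2 := by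
  obtain ⟨hκ, hk, hβ, -⟩ := hD
  have h1 := (hW.quadratic v).le_max h.measurable_unprojectedIndicator unprojectedIndicator_nonneg
    unprojectedIndicator_le_one hβ (C := D.kθ * (D.N / D.κ) / D.β1 * ‖v‖ ^ 2) le_rfl ht
    fun τ _ => by
      have := inner_normGram_le hκ (Yhat S D R) (activeStack D R τ) v
      calc D.kθ * inner ℝ v (app (PsiMat S D R τ) v) ≤ D.kθ * (D.N / D.κ * ‖v‖ ^ 2) := by
            gcongr; exact this
        _ = _ := by field_simp
  have h2 : inner ℝ v (app (W 0) v) ≤ ‖D.Γ0⁻¹‖ * ‖v‖ ^ 2 := by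
    rw [hW.zero]
    exact (le_abs_self _).trans (abs_inner_app_le _ v)
  have h3 : 0 ≤ D.kθ * (D.N / D.κ) / D.β1 * ‖v‖ ^ 2 := by positivity
  have h4 : 0 ≤ ‖D.Γ0⁻¹‖ * ‖v‖ ^ 2 := by positivity
  refine h1.trans (max_le ?_ ?_) <;> nlinarith [sq_nonneg ‖v‖]

/-- Needs no excitation. It makes `Γ` positive definite at all times, so the projection never
divides by zero at a nonzero estimate. -/
theorem exp_mul_le_inner (hW : IsInverseGain S D R W) (h : IsClosedLoop S K D R 𝒞 𝒰)
    (hD : D.Valid) {g : ℝ} (hg : 0 < g) (hg0 : ∀ v : Vec p, g * ‖v‖ ^ 2 ≤ inner ℝ v (app D.Γ0⁻¹ v))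
    {t : ℝ} (ht : 0 ≤ t) (v : Vec p) :
    Real.exp (-D.β1 * t) * g * ‖v‖ ^ 2 ≤ inner ℝ v (app (W t) v) := by
  obtain ⟨hκ, hk, hβ, -⟩ := hD
  have h0 := hg0 v
  have h1 := (hW.quadratic v).exp_mul_le h.measurable_unprojectedIndicator
    unprojectedIndicator_nonneg unprojectedIndicator_le_one hβ ht
    (fun τ _ => mul_nonneg hk.le (inner_normGram_nonneg hκ _ _ v))
    (by rw [hW.zero]; exact le_trans (by positivity) h0)
  refine le_trans ?_ h1
  rw [hW.zero, mul_assoc]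
  gcongr

/-- Up to `max τ₀ 0` the form can at worst decay freely. Afterwards it cannot fall below the smaller
of its value at that time and the equilibrium `k_θ c / β₁`. -/
theorem min_mul_le_inner (hW : IsInverseGain S D R W) (h : IsClosedLoop S K D R 𝒞 𝒰)
    (hD : D.Valid) {g : ℝ} (hg : 0 < g) (hg0 : ∀ v : Vec p, g * ‖v‖ ^ 2 ≤ inner ℝ v (app D.Γ0⁻¹ v))
    {τ₀ c : ℝ} (hc : ∀ t, 0 ≤ t → τ₀ ≤ t → c ≤ minEig (PsiMat S D R t))
    {t : ℝ} (ht : 0 ≤ t) (v : Vec p) :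
    min (Real.exp (-D.β1 * max τ₀ 0) * g) (D.kθ * c / D.β1) * ‖v‖ ^ 2 ≤
      inner ℝ v (app (W t) v) := by
  have hβ : 0 < D.β1 := hD.2.2.1
  have hk : 0 < D.kθ := hD.2.1
  have early : ∀ s, 0 ≤ s → s ≤ max τ₀ 0 →
      Real.exp (-D.β1 * max τ₀ 0) * g * ‖v‖ ^ 2 ≤ inner ℝ v (app (W s) v) := fun s hs hs' => by
    refine le_trans ?_ (hW.exp_mul_le_inner h hD hg hg0 hs v)
    have : Real.exp (-D.β1 * max τ₀ 0) ≤ Real.exp (-D.β1 * s) :=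
      Real.exp_le_exp.2 (by nlinarith)
    gcongr
  rcases le_total t (max τ₀ 0) with h1 | h1
  · refine le_trans ?_ (early t ht h1)
    gcongr
    exact min_le_left _ _
  · have h2 := (hW.quadratic v).min_le h.measurable_unprojectedIndicator
      unprojectedIndicator_nonneg unprojectedIndicator_le_one hβ
      (C := D.kθ * c / D.β1 * ‖v‖ ^ 2) (le_max_right τ₀ 0) h1 fun τ hτ => by
        have h3 := minEig_mul_le (normGram_isHermitian D.κ (Yhat S D R) (activeStack D R τ)) v
        have h4 := hc τ ((le_max_right _ _).trans hτ.1) ((le_max_left _ _).trans hτ.1)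
        calc D.β1 * (D.kθ * c / D.β1 * ‖v‖ ^ 2) = D.kθ * (c * ‖v‖ ^ 2) := by field_simp
          _ ≤ D.kθ * (minEig (PsiMat S D R τ) * ‖v‖ ^ 2) := by gcongr
          _ ≤ _ := by gcongr; exact h3
    refine le_trans (le_min ?_ ?_) h2
    · refine le_trans ?_ (early _ (le_max_right _ _) le_rfl)
      gcongr
      exact min_le_left _ _
    · gcongr
      exact min_le_right _ _

theorem inner_gain_pos (hW : IsInverseGain S D R W) (h : IsClosedLoop S K D R 𝒞 𝒰)
    (hD : D.Valid) {t : ℝ} (ht : 0 ≤ t) {v : Vec p} (hv : v ≠ 0) :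
    0 < inner ℝ v (app (R.Γ t) v) := by
  obtain ⟨g, hg, hg0⟩ := (hD.2.2.2.1.inv : D.Γ0⁻¹.PosDef).exists_pos_mul_le
  have hβ := hD.2.2.1
  have hκ := hD.1
  have hk := hD.2.1
  have hw : 0 < ‖D.Γ0⁻¹‖ + D.kθ * (D.N / D.κ) / D.β1 + 1 := by positivity
  have h1 := div_le_inner_app_of_mul_eq_one (hW.isHermitian t) (hW.mul_eq_one t ht) hw
    (hW.inner_le h hD ht) (fun v => le_trans (by positivity)
      (hW.exp_mul_le_inner h hD hg hg0 ht v)) v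
  have h2 : 0 < ‖v‖ := norm_pos_iff.2 hv
  exact lt_of_lt_of_le (by positivity) h1

end IsInverseGain

end LoopGain

/-! ### Derivatives of squared norms and quadratic forms. -/

section VectorODE

variable {k : ℕ}

theorem SolvesODE.norm_sq {f r : ℝ → Vec k} (h : SolvesODE f r) :
    SolvesODE (fun t => ‖f t‖ ^ 2) (fun t => 2 * inner ℝ (f t) (r t)) := by
  have := SolvesODE.sum Finset.univ fun i (_ : i ∈ Finset.univ) => (h.coord i).mul (h.coord i)
  refine this.congr (fun t _ => ?_) fun t _ => ?_
  · rw [← real_inner_self_eq_norm_sq, inner_eq_sum]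
  · rw [inner_eq_sum, Finset.mul_sum]
    exact Finset.sum_congr rfl fun i _ => by ring

theorem SolvesODE.inner_app {f r : ℝ → Vec k} (h : SolvesODE f r) {W U : ℝ → Mat k k}
    (hW : ∀ i j, SolvesODE (fun t => W t i j) (fun t => U t i j))
    (hsymm : ∀ t, (W t).IsHermitian) :
    SolvesODE (fun t => inner ℝ (f t) (app (W t) (f t)))
      (fun t => 2 * inner ℝ (r t) (app (W t) (f t)) + inner ℝ (f t) (app (U t) (f t))) := by
  have h1 := SolvesODE.sum Finset.univ fun i (_ : i ∈ Finset.univ) =>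
    SolvesODE.sum Finset.univ fun j (_ : j ∈ Finset.univ) =>
      ((h.coord i).mul (hW i j)).mul (h.coord j)
  refine h1.congr (fun t _ => ?_) fun t _ => ?_
  · rw [inner_app_eq_sum]
  · have h2 : inner ℝ (r t) (app (W t) (f t)) = inner ℝ (f t) (app (W t) (r t)) := by
      rw [← inner_app_symm (hsymm t), real_inner_comm]
    rw [two_mul]
    nth_rewrite 2 [h2]
    simp only [inner_eq_sum, app_apply, Finset.mul_sum, ← Finset.sum_add_distrib]
    exact Finset.sum_congr rfl fun i _ => Finset.sum_congr rfl fun j _ => by ring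

end VectorODE

/-! ### The projection and the Lyapunov function of the parameter error. -/

section ParameterError

variable {n m p q : ℕ} {S : Plant n m p q} {K : JacBounds n} {D : Tuning p}
  {R : Loop n m p q D.N} {𝒞 : Set (Vec n)} {𝒰 : Set (Vec m)}

theorem IsClosedLoop.thetaBar_nonneg (h : IsClosedLoop S K D R 𝒞 𝒰) : 0 ≤ D.thetaBar :=
  (norm_nonneg _).trans h.theta_le

/-- The projection keeps the parameter estimate in the ball. -/
theorem IsClosedLoop.norm_thetaHat_le (h : IsClosedLoop S K D R 𝒞 𝒰) (hD : D.Valid) {t : ℝ}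
    (ht : 0 ≤ t) : ‖R.θh t‖ ≤ D.thetaBar := by
  obtain ⟨W, hW⟩ := h.exists_isInverseGain hD
  by_contra! hlt
  have hθ0 := h.thetaBar_nonneg
  have hcont : ContinuousOn (fun τ => ‖R.θh τ‖) (Icc 0 t) :=
    (h.update.continuousOn.mono fun x hx => hx.1).norm
  set A := Icc 0 t ∩ (fun τ => ‖R.θh τ‖) ⁻¹' Iic D.thetaBar
  have hA : IsCompact A :=
    isCompact_Icc.of_isClosed_subset (hcont.preimage_isClosed_of_isClosed isClosed_Icc isClosed_Iic)
      inter_subset_left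
  -- `s` is the last time up to `t` with the estimate in the ball. After `s` the projected law is in
  -- force, its direction is orthogonal to `θ̂`, and the norm cannot increase.
  obtain ⟨s, hs, hmax⟩ := hA.exists_isGreatest ⟨0, ⟨le_rfl, ht⟩, h.thetaHat_zero_le⟩
  have h1 := h.update.norm_sq.le_of_nonpos_Ioo hs.1.1 hs.1.2 fun τ hτ => by
    have hτ0 : 0 ≤ τ := hs.1.1.trans hτ.1.le
    have h2 : D.thetaBar < ‖R.θh τ‖ := by
      by_contra! h3
      exact absurd (hmax ⟨⟨hτ0, hτ.2.le⟩, h3⟩) (not_le.2 hτ.1)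
    have h3 : D.thetaBar ^ 2 < ‖R.θh τ‖ ^ 2 := pow_lt_pow_left₀ h2 hθ0 two_ne_zero
    have h4 : ¬ Unprojected S D R τ := by
      rintro (h5 | h5)
      · exact absurd h5 h3.le.not_gt
      · exact h3.ne' h5.1
    have h5 : R.θh τ ≠ 0 := fun h6 => by
      rw [h6, norm_zero] at h2
      linarith
    have h6 := hW.inner_gain_pos h hD hτ0 h5
    rw [thetaRHS, if_neg h4, inner_sub_right, inner_smul_right, div_mul_cancel₀ _ h6.ne']
    simp
  have h2 : ‖R.θh s‖ ≤ D.thetaBar := hs.2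
  exact absurd (abs_le_of_sq_le_sq' h1 (norm_nonneg _)).2 (not_le.2 (h2.trans_lt hlt))

theorem IsClosedLoop.norm_thetaErr_le (h : IsClosedLoop S K D R 𝒞 𝒰) (hD : D.Valid) {t : ℝ}
    (ht : 0 ≤ t) : ‖thetaErr D R t‖ ≤ 2 * D.thetaBar := by
  have h1 := norm_sub_le R.θ (R.θh t)
  have h2 := h.norm_thetaHat_le hD ht
  have h3 := h.theta_le
  unfold thetaErr
  linarith

theorem IsClosedLoop.solvesODE_thetaErr (h : IsClosedLoop S K D R 𝒞 𝒰) :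
    SolvesODE (thetaErr D R) (fun t => -thetaRHS S D R t) :=
  ((solvesODE_const R.θ).sub h.update).congr_rhs fun t _ => by simp

namespace IsInverseGain

variable {W : ℝ → Mat p p}

/-- The Lyapunov function of the parameter error satisfies a differential inequality. -/
theorem exists_lyapunov_deriv (hW : IsInverseGain S D R W) (h : IsClosedLoop S K D R 𝒞 𝒰)
    (hD : D.Valid) : ∃ r : ℝ → ℝ,
      SolvesODE (fun t => inner ℝ (thetaErr D R t) (app (W t) (thetaErr D R t))) r ∧
      ∀ t, 0 ≤ t → r t ≤
        -D.kθ * inner ℝ (thetaErr D R t) (app (PsiMat S D R t) (thetaErr D R t))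
          - 2 * D.kθ * inner ℝ (Qvec S D R t) (thetaErr D R t)
          - min (D.β1 * inner ℝ (thetaErr D R t) (app (W t) (thetaErr D R t)))
            (D.kθ * inner ℝ (thetaErr D R t) (app (PsiMat S D R t) (thetaErr D R t))) := by
  refine ⟨_, h.solvesODE_thetaErr.inner_app hW.ode hW.isHermitian, fun t ht => ?_⟩
  have hΓ : (R.Γ t).IsHermitian := (hW.isHermitian t).of_mul_eq_one (hW.mul_eq_one t ht)
  have hcancel : ∀ v : Vec p, inner ℝ (app (R.Γ t) v) (app (W t) (thetaErr D R t)) =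
      inner ℝ v (thetaErr D R t) := fun v => by
    rw [inner_app_symm hΓ, ← mul_app, hW.mul_eq_one t ht, one_app]
  have hraw : inner ℝ (rawUpdate S D R t) (app (W t) (thetaErr D R t)) =
      D.kθ * (inner ℝ (thetaErr D R t) (app (PsiMat S D R t) (thetaErr D R t)) +
        inner ℝ (Qvec S D R t) (thetaErr D R t)) := by
    rw [rawUpdate, inner_smul_left, hcancel, phi_eq, inner_add_left,
      real_inner_comm (thetaErr D R t) (app _ _)]
    simp
  set θt := thetaErr D R t with hθt
  set V := inner ℝ θt (app (W t) θt)
  set P := inner ℝ θt (app (PsiMat S D R t) θt)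
  by_cases hu : Unprojected S D R t
  -- The update contributes `-2 k_θ P` and the change of `W` contributes `k_θ P - β₁ V`; the term
  -- `β₁ V` is the first entry of the minimum.
  · rw [unprojectedIndicator_of ht hu, thetaRHS, if_pos hu, inner_neg_left, hraw]
    simp only [one_smul, add_app, smul_app, inner_add_right, inner_smul_right]
    have := min_le_left (D.β1 * V) (D.kθ * P)
    linarith
  -- `W` is frozen here, so the full `-2 k_θ P` remains and supplies the second entry of the
  -- minimum. The projection term is nonpositive: `‖θ̂‖ = θ̄ ≥ ‖θ‖` forces `⟨θ̂, θ̃⟩ ≤ 0`, and its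
  -- coefficient is nonnegative.
  · rw [unprojectedIndicator_of_not ht hu, thetaRHS, if_neg hu, inner_neg_left, inner_sub_left,
      hraw, inner_smul_left, hcancel]
    simp only [zero_smul, zero_app, inner_zero_right, conj_trivial]
    have h1 : ‖R.θh t‖ ^ 2 ≤ D.thetaBar ^ 2 :=
      pow_le_pow_left₀ (norm_nonneg _) (h.norm_thetaHat_le hD ht) 2
    have h2 : ‖R.θh t‖ ^ 2 = D.thetaBar ^ 2 := by
      by_contra h3
      exact hu (Or.inl (lt_of_le_of_ne h1 h3))
    have h3 : 0 ≤ inner ℝ (R.θh t) (rawUpdate S D R t) := by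
      by_contra! h4
      exact hu (Or.inr ⟨h2, by rw [real_inner_comm]; exact h4.le⟩)
    have h4 : 0 ≤ inner ℝ (R.θh t) (app (R.Γ t) (R.θh t)) := by
      by_cases h5 : R.θh t = 0
      · simp [h5]
      · exact (hW.inner_gain_pos h hD ht h5).le
    have h5 : inner ℝ (R.θh t) θt ≤ 0 := by
      rw [hθt, thetaErr, inner_sub_right, real_inner_self_eq_norm_sq, h2]
      have h6 := real_inner_le_norm (R.θh t) R.θ
      have h7 := h.norm_thetaHat_le hD ht
      have h8 := h.theta_le
      nlinarith [norm_nonneg (R.θh t), norm_nonneg R.θ]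
    have h6 := mul_nonpos_of_nonneg_of_nonpos (div_nonneg h3 h4) h5
    have := min_le_right (D.β1 * V) (D.kθ * P)
    linarith

end IsInverseGain

end ParameterError

/-! ### Lipschitz estimates from bounds on partial derivatives. -/

section Lipschitz

theorem norm_le_sum_abs {k : ℕ} (v : Vec k) : ‖v‖ ≤ ∑ i, |v i| := by
  have h1 : v = ∑ i, v i • EuclideanSpace.single i (1 : ℝ) := by
    ext j
    simp [Finset.sum_apply, Pi.single_apply]
  nth_rewrite 1 [h1]
  refine norm_sum_le_of_le _ fun i _ => ?_
  rw [norm_smul]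
  simp

theorem norm_dual_le_sum {k : ℕ} (L : Vec k →L[ℝ] ℝ) :
    ‖L‖ ≤ ∑ i, |L (EuclideanSpace.single i 1)| := by
  refine L.opNorm_le_bound (Finset.sum_nonneg fun _ _ => abs_nonneg _) fun v => ?_
  have h1 : v = ∑ i, v i • EuclideanSpace.single i (1 : ℝ) := by
    ext j
    simp [Finset.sum_apply, Pi.single_apply]
  nth_rewrite 1 [h1]
  rw [map_sum, Finset.sum_mul]
  refine norm_sum_le_of_le _ fun i _ => ?_
  rw [map_smul, norm_smul, mul_comm]
  exact mul_le_mul_of_nonneg_left (PiLp.norm_apply_le v i) (norm_nonneg _)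

/-- The Jacobian bounds concern products such as `∂_k Y_{ji} θ_i`, so the mean value inequality is
applied to `h c` and not to `h`. -/
theorem abs_sub_mul_le_of_partialD {n : ℕ} {𝒞 : Set (Vec n)} (h𝒞 : Convex ℝ 𝒞) {h : Vec n → ℝ}
    {c : ℝ} {a b : Fin n → ℝ} (hd : ∀ x ∈ 𝒞, DifferentiableAt ℝ h x)
    (hab : ∀ x ∈ 𝒞, ∀ k, a k ≤ partialD h x k * c ∧ partialD h x k * c ≤ b k)
    {x y : Vec n} (hx : x ∈ 𝒞) (hy : y ∈ 𝒞) :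
    |h x * c - h y * c| ≤ (∑ k, (|a k| + |b k|)) * ‖x - y‖ := by
  have h1 : ∀ z ∈ 𝒞, DifferentiableAt ℝ (fun z => h z * c) z := fun z hz =>
    (hd z hz).mul_const c
  refine h𝒞.norm_image_sub_le_of_norm_fderiv_le (𝕜 := ℝ) h1 (fun z hz => ?_) hy hx
  refine (norm_dual_le_sum _).trans (Finset.sum_le_sum fun k _ => ?_)
  have h2 := hab z hz k
  rw [fderiv_mul_const (hd z hz), smul_apply, smul_eq_mul, mul_comm]
  change |partialD h z k * c| ≤ _
  rw [abs_le]
  constructor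
  · linarith [neg_abs_le (a k), abs_nonneg (b k)]
  · linarith [le_abs_self (b k), abs_nonneg (a k)]

end Lipschitz

/-! ### Uniform bounds and a Lipschitz constant for the plant on `𝒞`. -/

section PlantBounds

variable {n m p q : ℕ} {S : Plant n m p q} {K : JacBounds n} {𝒞 : Set (Vec n)}
  {𝒰 : Set (Vec m)} {Θ : Set (Vec p)}

theorem JacobianBounded.continuousOn_Y (hJ : JacobianBounded S K 𝒞 𝒰 Θ) :
    ContinuousOn S.Y 𝒞 := by
  refine continuousOn_pi.2 fun j => continuousOn_pi.2 fun i => fun x hx => ?_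
  exact ((hJ x hx j).1.1 i).continuousAt.continuousWithinAt

theorem JacobianBounded.continuousOn_g (hJ : JacobianBounded S K 𝒞 𝒰 Θ) :
    ContinuousOn S.g 𝒞 := by
  refine continuousOn_pi.2 fun j => continuousOn_pi.2 fun i => fun x hx => ?_
  exact ((hJ x hx j).1.2.2 i).continuousAt.continuousWithinAt

theorem JacobianBounded.continuousOn_f0 (hJ : JacobianBounded S K 𝒞 𝒰 Θ) :
    ContinuousOn S.f0 𝒞 := by
  have h : ContinuousOn (fun x => (S.f0 x).ofLp) 𝒞 := continuousOn_pi.2 fun j => fun x hx =>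
    (hJ x hx j).1.2.1.continuousAt.continuousWithinAt
  exact (PiLp.continuous_toLp 2 _).comp_continuousOn h

/-- A common bound for the plant data on the operating region. -/
structure PlantBound (S : Plant n m p q) (𝒞 : Set (Vec n)) (𝒰 : Set (Vec m)) (B : ℝ) : Prop where
  nonneg : 0 ≤ B
  state : ∀ x ∈ 𝒞, ‖x‖ ≤ B
  Y : ∀ x ∈ 𝒞, ‖S.Y x‖ ≤ B
  f0 : ∀ x ∈ 𝒞, ‖S.f0 x‖ ≤ B
  g : ∀ x ∈ 𝒞, ‖S.g x‖ ≤ B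
  input : ∀ u ∈ 𝒰, ‖u‖ ≤ B

theorem JacobianBounded.exists_plantBound (hJ : JacobianBounded S K 𝒞 𝒰 Θ) (h𝒞 : IsCompact 𝒞)
    (h𝒰 : Bornology.IsBounded 𝒰) : ∃ B, PlantBound S 𝒞 𝒰 B := by
  obtain ⟨B1, h1⟩ := h𝒞.exists_bound_of_continuousOn continuousOn_id
  obtain ⟨B2, h2⟩ := h𝒞.exists_bound_of_continuousOn hJ.continuousOn_Y
  obtain ⟨B3, h3⟩ := h𝒞.exists_bound_of_continuousOn hJ.continuousOn_f0
  obtain ⟨B4, h4⟩ := h𝒞.exists_bound_of_continuousOn hJ.continuousOn_g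
  obtain ⟨B5, h5⟩ := h𝒰.exists_norm_le
  have := abs_nonneg B1
  have := abs_nonneg B2
  have := abs_nonneg B3
  have := abs_nonneg B4
  have := abs_nonneg B5
  refine ⟨|B1| + |B2| + |B3| + |B4| + |B5|, by positivity, fun x hx => ?_, fun x hx => ?_,
    fun x hx => ?_, fun x hx => ?_, fun u hu => ?_⟩
  · linarith [h1 x hx, le_abs_self B1, show ‖id x‖ = ‖x‖ from rfl]
  · linarith [h2 x hx, le_abs_self B2]
  · linarith [h3 x hx, le_abs_self B3]
  · linarith [h4 x hx, le_abs_self B4]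
  · linarith [h5 u hu, le_abs_self B5]

/-- A Lipschitz constant of the plant dynamics on the operating region. -/
noncomputable def plantLipschitz {n : ℕ} (m p : ℕ) (K : JacBounds n) : ℝ :=
  ∑ j, (p * ∑ k, (|K.Ky1 j k| + |K.Ky2 j k|) + ∑ k, (|K.Kf1 j k| + |K.Kf2 j k|)
    + m * ∑ k, (|K.Kg1 j k| + |K.Kg2 j k|))

theorem plantLipschitz_nonneg (m p : ℕ) (K : JacBounds n) : 0 ≤ plantLipschitz m p K := by
  unfold plantLipschitz; positivity

theorem JacobianBounded.norm_sub_le (hJ : JacobianBounded S K 𝒞 𝒰 Θ) (h𝒞 : Convex ℝ 𝒞)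
    {x y : Vec n} (hx : x ∈ 𝒞) (hy : y ∈ 𝒞) {θ : Vec p} (hθ : θ ∈ Θ) {u : Vec m} (hu : u ∈ 𝒰) :
    ‖(app (S.Y x) θ + S.f0 x + app (S.g x) u) - (app (S.Y y) θ + S.f0 y + app (S.g y) u)‖ ≤
      plantLipschitz m p K * ‖x - y‖ := by
  refine (norm_le_sum_abs _).trans ?_
  rw [plantLipschitz, Finset.sum_mul]
  refine Finset.sum_le_sum fun j _ => ?_
  have h1 : ∀ i, |S.Y x j i * θ i - S.Y y j i * θ i| ≤
      (∑ k, (|K.Ky1 j k| + |K.Ky2 j k|)) * ‖x - y‖ := fun i =>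
    abs_sub_mul_le_of_partialD (h := fun z => S.Y z j i) h𝒞 (fun z hz => (hJ z hz j).1.1 i)
      (fun z hz k => ((hJ z hz j).2 k).1 θ hθ i) hx hy
  have h2 : |S.f0 x j - S.f0 y j| ≤ (∑ k, (|K.Kf1 j k| + |K.Kf2 j k|)) * ‖x - y‖ := by
    simpa using abs_sub_mul_le_of_partialD (h := fun z => S.f0 z j) (c := 1) h𝒞
      (fun z hz => (hJ z hz j).1.2.1) (fun z hz k => by simpa using ((hJ z hz j).2 k).2.1) hx hy
  have h3 : ∀ i, |S.g x j i * u i - S.g y j i * u i| ≤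
      (∑ k, (|K.Kg1 j k| + |K.Kg2 j k|)) * ‖x - y‖ := fun i =>
    abs_sub_mul_le_of_partialD (h := fun z => S.g z j i) h𝒞 (fun z hz => (hJ z hz j).1.2.2 i)
      (fun z hz k => ((hJ z hz j).2 k).2.2 u hu i) hx hy
  have h4 : ((app (S.Y x) θ + S.f0 x + app (S.g x) u) -
      (app (S.Y y) θ + S.f0 y + app (S.g y) u) : Vec n) j =
      ∑ i, (S.Y x j i * θ i - S.Y y j i * θ i) + (S.f0 x j - S.f0 y j) +
        ∑ i, (S.g x j i * u i - S.g y j i * u i) := by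
    simp only [PiLp.sub_apply, PiLp.add_apply, app_apply, Finset.sum_sub_distrib]
    ring
  have h5 := (Finset.abs_sum_le_sum_abs (fun i => S.Y x j i * θ i - S.Y y j i * θ i)
    Finset.univ).trans (Finset.sum_le_sum fun i _ => h1 i)
  have h6 := (Finset.abs_sum_le_sum_abs (fun i => S.g x j i * u i - S.g y j i * u i)
    Finset.univ).trans (Finset.sum_le_sum fun i _ => h3 i)
  rw [h4]
  refine (abs_add_three _ _ _).trans ?_
  simp only [Finset.sum_const, Finset.card_univ, Fintype.card_fin, nsmul_eq_mul] at h5 h6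
  linarith

end PlantBounds

/-! ### Recorded regressors, residuals and the disturbance `Q`. -/

section RecordedData

variable {n m p q : ℕ} {S : Plant n m p q} {K : JacBounds n} {D : Tuning p}
  {R : Loop n m p q D.N} {𝒞 : Set (Vec n)} {𝒰 : Set (Vec m)} {Θ : Set (Vec p)}

theorem IsClosedLoop.continuousOn_comp_xh (h : IsClosedLoop S K D R 𝒞 𝒰) {E : Type*}
    [TopologicalSpace E] {f : Vec n → E} (hf : ContinuousOn f 𝒞) {s t : ℝ} (hs : 0 ≤ s)
    (ht : 0 ≤ t) : ContinuousOn (fun τ => f (R.xh τ)) (uIcc s t) := by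
  have hsub : ∀ τ ∈ uIcc s t, 0 ≤ τ := fun τ hτ => (le_min hs ht).trans hτ.1
  exact hf.comp (h.observer.continuousOn.mono hsub) fun τ hτ => h.xh_mem τ (hsub τ hτ)

theorem Yhat_eq_integral (h : IsClosedLoop S K D R 𝒞 𝒰) (hJ : JacobianBounded S K 𝒞 𝒰 Θ)
    (hT : 0 ≤ D.T) {t : ℝ} (ht : D.T ≤ t) :
    Yhat S D R t = ∫ s in (t - D.T)..t, S.Y (R.xh s) := by
  have : CompleteSpace (Mat n p) := FiniteDimensional.complete ℝ _
  have hi : IntervalIntegrable (fun s => S.Y (R.xh s)) volume (t - D.T) t :=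
    (h.continuousOn_comp_xh hJ.continuousOn_Y (by linarith) (by linarith)).intervalIntegrable
  ext j i
  exact (LinearMap.toContinuousLinearMap
    (Matrix.entryLinearMap ℝ ℝ j i : Mat n p →ₗ[ℝ] ℝ)).intervalIntegral_comp_comm hi

theorem norm_Yhat_le (h : IsClosedLoop S K D R 𝒞 𝒰) (hJ : JacobianBounded S K 𝒞 𝒰 Θ)
    (hT : 0 ≤ D.T) {B : ℝ} (hB : PlantBound S 𝒞 𝒰 B) {t : ℝ} (ht : D.T ≤ t) :
    ‖Yhat S D R t‖ ≤ B * D.T := by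
  rw [Yhat_eq_integral h hJ hT ht]
  have := intervalIntegral.norm_integral_le_of_norm_le_const (a := t - D.T) (b := t) (C := B)
    (f := fun s => S.Y (R.xh s)) fun s hs => by
      rw [uIoc_of_le (by linarith)] at hs
      exact hB.Y _ (h.xh_mem s (by linarith [hs.1]))
  rwa [sub_sub_cancel, abs_of_nonneg hT] at this

theorem intervalIntegrable_of_coord {k : ℕ} {f : ℝ → Vec k} {s t : ℝ}
    (hf : ∀ i, IntervalIntegrable (fun τ => f τ i) volume s t) :
    IntervalIntegrable f volume s t := by
  have h1 : f = fun τ => ∑ i, f τ i • EuclideanSpace.single i (1 : ℝ) := by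
    ext τ j
    simp [Finset.sum_apply, Pi.single_apply]
  rw [h1]
  have : ∀ i : Fin k, IntervalIntegrable (fun τ => f τ i • EuclideanSpace.single i (1 : ℝ))
      volume s t := fun i => ⟨(hf i).1.smul_const _, (hf i).2.smul_const _⟩
  simpa only [Finset.sum_fn] using IntervalIntegrable.sum Finset.univ fun i _ => this i

theorem intervalIntegrable_Ghat (h : IsClosedLoop S K D R 𝒞 𝒰) (hJ : JacobianBounded S K 𝒞 𝒰 Θ)
    {B : ℝ} (hB : PlantBound S 𝒞 𝒰 B) {s t : ℝ} (hs : 0 ≤ s) (ht : 0 ≤ t) :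
    IntervalIntegrable (fun s => S.f0 (R.xh s) + app (S.g (R.xh s)) (R.u s)) volume s t := by
  refine (h.continuousOn_comp_xh hJ.continuousOn_f0 hs ht).intervalIntegrable.add ?_
  refine intervalIntegrable_of_coord fun j => ?_
  simp only [app_apply]
  have : ∀ i : Fin m, IntervalIntegrable (fun τ => S.g (R.xh τ) j i * R.u τ i) volume s t :=
    fun i => by
      have hu : Measurable fun τ => R.u τ i :=
        (EuclideanSpace.proj i : Vec m →L[ℝ] ℝ).continuous.measurable.comp h.u_meas
      refine (intervalIntegrable_of_measurable_of_abs_le (b := B) hu fun τ hτ => ?_).continuousOn_mul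
        ((Matrix.continuous_entry j i).comp_continuousOn
          (h.continuousOn_comp_xh hJ.continuousOn_g hs ht))
      exact (PiLp.norm_apply_le (R.u τ) i).trans
        (hB.input _ (h.u_mem τ ((le_min hs ht).trans hτ.1)))
  simpa only [Finset.sum_fn] using IntervalIntegrable.sum Finset.univ fun i _ => this i

/-- The residual is bounded by the state estimation error on the recording window. -/
theorem norm_residualErr_le (h : IsClosedLoop S K D R 𝒞 𝒰)
    (hJ : JacobianBounded S K 𝒞 𝒰 (Metric.closedBall 0 D.thetaBar)) (h𝒞 : Convex ℝ 𝒞)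
    (hT : 0 ≤ D.T) {B : ℝ} (hB : PlantBound S 𝒞 𝒰 B) {t e : ℝ} (ht : D.T ≤ t)
    (he : ∀ s ∈ Icc (t - D.T) t, ‖xErr D R s‖ ≤ e) :
    ‖residualErr S D R t‖ ≤ (plantLipschitz m p K * D.T + 2) * e := by
  have h0 : 0 ≤ t - D.T := by linarith
  have ht0 : 0 ≤ t := by linarith
  have hYi : IntervalIntegrable (fun s => S.Y (R.xh s)) volume (t - D.T) t :=
    (h.continuousOn_comp_xh hJ.continuousOn_Y h0 ht0).intervalIntegrable
  have : CompleteSpace (Mat n p) := FiniteDimensional.complete ℝ _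
  let L : Mat n p →L[ℝ] Vec n := LinearMap.toContinuousLinearMap
    { toFun := fun M => app M R.θ, map_add' := fun _ _ => add_app _ _ _,
      map_smul' := fun _ _ => smul_app _ _ _ }
  have hYθ : app (Yhat S D R t) R.θ = ∫ s in (t - D.T)..t, app (S.Y (R.xh s)) R.θ := by
    rw [Yhat_eq_integral h hJ hT ht]
    exact (L.intervalIntegral_comp_comm hYi).symm
  have hYθi : IntervalIntegrable (fun s => app (S.Y (R.xh s)) R.θ) volume (t - D.T) t :=
    ⟨L.integrable_comp hYi.1, L.integrable_comp hYi.2⟩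
  have hGi := intervalIntegrable_Ghat h hJ hB h0 ht0
  have hx := h.plant.sub_eq h0 ht0
  have hxi := h.plant.intervalIntegrable h0 ht0
  -- Writing `x̂ = x - x̃` and integrating the plant leaves a Lipschitz difference over a window of
  -- length `T` and `x̃` at its two ends; hence the constant `Lipschitz * T + 2`.
  have hres : residualErr S D R t = (∫ s in (t - D.T)..t, (plantRHS S D R s -
      app (S.Y (R.xh s)) R.θ - (S.f0 (R.xh s) + app (S.g (R.xh s)) (R.u s)))) -
      xErr D R t + xErr D R (t - D.T) := by
    rw [intervalIntegral.integral_sub (hxi.sub hYθi) hGi, intervalIntegral.integral_sub hxi hYθi,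
      ← hYθ, ← hx]
    simp only [residualErr, Xhat, Ghat, xErr]
    abel
  have hint : ‖∫ s in (t - D.T)..t, (plantRHS S D R s -
      app (S.Y (R.xh s)) R.θ - (S.f0 (R.xh s) + app (S.g (R.xh s)) (R.u s)))‖ ≤
      (plantLipschitz m p K * e) * D.T := by
    have := intervalIntegral.norm_integral_le_of_norm_le_const (a := t - D.T) (b := t)
      (C := plantLipschitz m p K * e) (f := fun s => plantRHS S D R s -
      app (S.Y (R.xh s)) R.θ - (S.f0 (R.xh s) + app (S.g (R.xh s)) (R.u s))) fun s hs => by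
        rw [uIoc_of_le (by linarith)] at hs
        have hs0 : 0 ≤ s := by linarith [hs.1]
        have h1 := hJ.norm_sub_le h𝒞 (h.x_mem s hs0) (h.xh_mem s hs0)
          (θ := R.θ) (by simpa using h.theta_le) (h.u_mem s hs0)
        have h2 := he s ⟨hs.1.le, hs.2⟩
        rw [show plantRHS S D R s - app (S.Y (R.xh s)) R.θ -
          (S.f0 (R.xh s) + app (S.g (R.xh s)) (R.u s)) =
          (app (S.Y (R.x s)) R.θ + S.f0 (R.x s) + app (S.g (R.x s)) (R.u s)) -
          (app (S.Y (R.xh s)) R.θ + S.f0 (R.xh s) + app (S.g (R.xh s)) (R.u s)) by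
            simp only [plantRHS]; abel]
        exact h1.trans (mul_le_mul_of_nonneg_left h2 (plantLipschitz_nonneg m p K))
    rwa [sub_sub_cancel, abs_of_nonneg hT] at this
  rw [hres]
  have h1 := he t ⟨by linarith, le_rfl⟩
  have h2 := he (t - D.T) ⟨le_rfl, by linarith⟩
  refine (norm_add_le _ _).trans ((add_le_add (norm_sub_le _ _) le_rfl).trans ?_)
  linarith

/-- Normalized data bound the disturbance of the parameter error by the residuals. -/
theorem norm_Qvec_le (h : IsClosedLoop S K D R 𝒞 𝒰) (hD : D.Valid) {Le e t : ℝ}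
    (hLe : 0 ≤ Le) (he : 0 ≤ e) (hres : ∀ t e : ℝ, D.T ≤ t →
      (∀ s ∈ Icc (t - D.T) t, ‖xErr D R s‖ ≤ e) → ‖residualErr S D R t‖ ≤ Le * e)
    (hrec : RecordedWithin D R e t) :
    ‖Qvec S D R t‖ ≤ D.N * (Le * e) / (2 * Real.sqrt D.κ) := by
  have hκ := hD.1
  have hs := Real.sqrt_pos.2 hκ
  have hss := Real.sq_sqrt hκ.le
  calc ‖Qvec S D R t‖ ≤ ∑ _i : Fin D.N, Le * e / (2 * Real.sqrt D.κ) :=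
        norm_sum_le_of_le _ fun i _ => by
          cases hi : activeStack D R t i with
          | none =>
            simp only [slotValue, Option.elim, app_zero, smul_zero, norm_zero]
            positivity
          | some τ =>
            simp only [slotValue, Option.elim]
            have h1 := hres τ e (h.activeStack_time hD hi) (hrec i τ hi)
            set Y := Yhat S D R τ
            have h2 := norm_app_le Yᵀ (residualErr S D R τ)
            rw [norm_transpose] at h2
            rw [norm_smul, Real.norm_of_nonneg (normalizer_nonneg hκ _)]
            -- `2 √κ y ≤ 1 + κ y²`.
            have h3 : normalizer D.κ Y * ‖Y‖ ≤ 1 / (2 * Real.sqrt D.κ) := by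
              rw [normalizer, one_div_mul_eq_div, div_le_div_iff₀ (by positivity) (by positivity)]
              nlinarith [sq_nonneg (Real.sqrt D.κ * ‖Y‖ - 1)]
            calc normalizer D.κ Y * ‖app Yᵀ (residualErr S D R τ)‖
                ≤ normalizer D.κ Y * (‖Y‖ * (Le * e)) := by
                  have := normalizer_nonneg hκ Y
                  gcongr
                  exact h2.trans (mul_le_mul_of_nonneg_left h1 (norm_nonneg _))
              _ = (normalizer D.κ Y * ‖Y‖) * (Le * e) := by ring
              _ ≤ 1 / (2 * Real.sqrt D.κ) * (Le * e) := by gcongr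
              _ = _ := by ring
    _ = _ := by simp; ring

end RecordedData

/-! ### Upper limits and comparison functions. -/

section LimsupLE

theorem LimsupLE.of_eventually_le {f g : ℝ → ℝ} {b : ℝ} (h : ∀ᶠ t in atTop, f t ≤ g t)
    (hg : Tendsto g atTop (𝓝 b)) : LimsupLE f b := fun δ hδ => by
  filter_upwards [h, hg.eventually_lt_const (show b < b + δ by linarith)] with t h1 h2
  linarith

theorem LimsupLE.mono {f : ℝ → ℝ} {b b' : ℝ} (h : LimsupLE f b) (hb : b ≤ b') :
    LimsupLE f b' := fun δ hδ => by
  filter_upwards [h δ hδ] with t ht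
  linarith

theorem tendsto_exp_neg_mul_sub {η : ℝ} (hη : 0 < η) (s : ℝ) :
    Tendsto (fun t => Real.exp (-η * (t - s))) atTop (𝓝 0) := by
  refine Real.tendsto_exp_atBot.comp ?_
  have : Tendsto (fun t : ℝ => t - s) atTop atTop := tendsto_atTop_add_const_right _ _ tendsto_id
  exact this.const_mul_atTop_of_neg (neg_lt_zero.2 hη)

theorem isClassK_mul {C : ℝ} (hC : 0 < C) : IsClassK fun r => C * r :=
  ⟨by fun_prop, fun _ _ _ _ hab => mul_lt_mul_of_pos_left hab hC, mul_zero C⟩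

theorem isClassKL_exp {C η : ℝ} (hC : 0 < C) (hη : 0 < η) :
    IsClassKL fun r s => C * Real.exp (-η * s) * r := by
  refine ⟨by fun_prop, fun s _ => isClassK_mul (mul_pos hC (Real.exp_pos _)), fun r hr => ⟨?_, ?_⟩⟩
  · intro s _ t _ hst
    have : Real.exp (-η * t) ≤ Real.exp (-η * s) := Real.exp_le_exp.2 (by nlinarith)
    simp only
    gcongr
  · have := ((tendsto_exp_neg_mul_sub hη 0).const_mul C).mul_const r
    simpa using this

end LimsupLE

/-! ### Ultimate boundedness and input-to-state stability of the parameter error. -/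

section Stability

variable {n m p q : ℕ} {S : Plant n m p q} {K : JacBounds n} {D : Tuning p}
  {R : Loop n m p q D.N} {𝒞 : Set (Vec n)} {𝒰 : Set (Vec m)}

/-- Uniform bounds on the inverse gain and on the excitation. -/
structure GainBounds (S : Plant n m p q) (D : Tuning p) (R : Loop n m p q D.N)
    (W : ℝ → Mat p p) (w₁ w₂ c T₀ : ℝ) : Prop where
  w₁_pos : 0 < w₁
  w₂_pos : 0 < w₂
  c_pos : 0 < c
  T₀_nonneg : 0 ≤ T₀
  mul_le : D.β1 * w₁ ≤ D.kθ * c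
  lower : ∀ t, 0 ≤ t → ∀ v : Vec p, w₁ * ‖v‖ ^ 2 ≤ inner ℝ v (app (W t) v)
  upper : ∀ t, 0 ≤ t → ∀ v : Vec p, inner ℝ v (app (W t) v) ≤ w₂ * ‖v‖ ^ 2
  excited : ∀ t, T₀ ≤ t → c ≤ minEig (PsiMat S D R t)

namespace GainBounds

variable {W : ℝ → Mat p p} {w₁ w₂ c T₀ : ℝ}

/-- The condition `β₁ w₁ ≤ k_θ c` lets both entries of the minimum dominate `β₁ w₁ ‖θ̃‖²`, so the
same decay holds with the projection on or off. The bound without decay serves the times before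
`T₀`. -/
theorem exists_lyapunov (hb : GainBounds S D R W w₁ w₂ c T₀) (hW : IsInverseGain S D R W)
    (h : IsClosedLoop S K D R 𝒞 𝒰) (hD : D.Valid) : ∃ V r : ℝ → ℝ, SolvesODE V r ∧
      (∀ t, 0 ≤ t → w₁ * ‖thetaErr D R t‖ ^ 2 ≤ V t ∧ V t ≤ w₂ * ‖thetaErr D R t‖ ^ 2) ∧
      (∀ t, 0 ≤ t → r t ≤ 2 * D.kθ * ‖Qvec S D R t‖ * ‖thetaErr D R t‖) ∧
      (∀ t, T₀ ≤ t → r t ≤ -(D.kθ * c + D.β1 * w₁) * ‖thetaErr D R t‖ ^ 2 +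
        2 * D.kθ * ‖Qvec S D R t‖ * ‖thetaErr D R t‖) := by
  obtain ⟨r, hr, hle⟩ := hW.exists_lyapunov_deriv h hD
  obtain ⟨hκ, hk, hβ, -⟩ := hD
  refine ⟨_, r, hr, fun t ht => ⟨hb.lower t ht _, hb.upper t ht _⟩, fun t ht => ?_, fun t ht => ?_⟩
  · have h1 := hle t ht
    have h2 : 0 ≤ inner ℝ (thetaErr D R t) (app (PsiMat S D R t) (thetaErr D R t)) :=
      inner_normGram_nonneg hκ _ _ _
    have h3 : 0 ≤ inner ℝ (thetaErr D R t) (app (W t) (thetaErr D R t)) :=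
      le_trans (mul_nonneg hb.w₁_pos.le (sq_nonneg _)) (hb.lower t ht _)
    have h4 := (abs_le.1 (abs_real_inner_le_norm (Qvec S D R t) (thetaErr D R t))).1
    have h5 := le_min (mul_nonneg hβ.le h3) (mul_nonneg hk.le h2)
    nlinarith
  · have ht0 := hb.T₀_nonneg.trans ht
    have h1 := hle t ht0
    have h2 : c * ‖thetaErr D R t‖ ^ 2 ≤
        inner ℝ (thetaErr D R t) (app (PsiMat S D R t) (thetaErr D R t)) :=
      (mul_le_mul_of_nonneg_right (hb.excited t ht) (sq_nonneg _)).trans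
        (minEig_mul_le (normGram_isHermitian _ _ _) _)
    have h3 := hb.lower t ht0 (thetaErr D R t)
    have h4 := (abs_le.1 (abs_real_inner_le_norm (Qvec S D R t) (thetaErr D R t))).1
    have h6 := mul_le_mul_of_nonneg_left h2 hk.le
    have h7 := mul_le_mul_of_nonneg_left h3 hβ.le
    have h8 := mul_le_mul_of_nonneg_right hb.mul_le (sq_nonneg ‖thetaErr D R t‖)
    have h5 : D.β1 * w₁ * ‖thetaErr D R t‖ ^ 2 ≤
        min (D.β1 * inner ℝ (thetaErr D R t) (app (W t) (thetaErr D R t)))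
        (D.kθ * inner ℝ (thetaErr D R t) (app (PsiMat S D R t) (thetaErr D R t))) :=
      le_min (by linarith) (by linarith)
    nlinarith

/-- Ultimate boundedness of the parameter error. -/
theorem limsupLE (hb : GainBounds S D R W w₁ w₂ c T₀) (hW : IsInverseGain S D R W)
    (h : IsClosedLoop S K D R 𝒞 𝒰) (hD : D.Valid) {w : ℝ}
    (hw : ∀ᶠ t in atTop, ‖Qvec S D R t‖ ≤ w) :
    LimsupLE (fun t => ‖thetaErr D R t‖)
      (Real.sqrt (w₂ / w₁) * (2 * D.kθ * w / (D.kθ * c + D.β1 * w₁))) := by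
  obtain ⟨V, r, hV, hVb, -, hr⟩ := hb.exists_lyapunov hW h hD
  obtain ⟨hκ, hk, hβ, -⟩ := hD
  obtain ⟨t₁, ht₁⟩ := eventually_atTop.1 hw
  have hw₁ := hb.w₁_pos
  have hw₂ := hb.w₂_pos
  have hc := hb.c_pos
  have hw0 : 0 ≤ w := (norm_nonneg _).trans (ht₁ t₁ le_rfl)
  set a := D.kθ * c + D.β1 * w₁ with ha_def
  have ha : 0 < a := by positivity
  set s := max t₁ T₀
  have hs : 0 ≤ s := hb.T₀_nonneg.trans (le_max_right _ _)
  have hη : 0 < a / (2 * w₂) := by positivity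
  set η := a / (2 * w₂) with hη_def
  have hV1 : ∀ t, s ≤ t → V t ≤ Real.exp (-η * (t - s)) * (V s - 2 * D.kθ ^ 2 * w ^ 2 / a / η) +
      2 * D.kθ ^ 2 * w ^ 2 / a / η := fun t ht => by
    refine hV.gronwall hη.ne' hs ht fun τ hτ => ?_
    have h1 := hr τ ((le_max_right _ _).trans hτ.1)
    have h2 := (hVb τ (hs.trans hτ.1)).2
    have h3 := ht₁ τ ((le_max_left _ _).trans hτ.1)
    set e := ‖thetaErr D R τ‖
    have he : 0 ≤ e := norm_nonneg _
    have h4 : η * V τ ≤ a / 2 * e ^ 2 := by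
      calc η * V τ ≤ η * (w₂ * e ^ 2) := by gcongr
        _ = a / 2 * e ^ 2 := by rw [hη_def]; field_simp
    have h5 : 2 * D.kθ * ‖Qvec S D R τ‖ * e ≤ 2 * D.kθ * w * e := by gcongr
    -- Young's inequality spends half of the decay on the disturbance; the other half gives the rate
    -- `η = a / (2 w₂)`.
    have h6 : 2 * D.kθ * w * e ≤ a / 2 * e ^ 2 + 2 * D.kθ ^ 2 * w ^ 2 / a := by
      have h7 : 0 ≤ (a * e - 2 * D.kθ * w) ^ 2 / (2 * a) := by positivity
      have h8 : (a * e - 2 * D.kθ * w) ^ 2 / (2 * a) =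
          a / 2 * e ^ 2 + 2 * D.kθ ^ 2 * w ^ 2 / a - 2 * D.kθ * w * e := by
        field_simp; ring
      linarith
    linarith
  refine LimsupLE.of_eventually_le
    (g := fun t => Real.sqrt ((Real.exp (-η * (t - s)) * (V s - 2 * D.kθ ^ 2 * w ^ 2 / a / η) +
      2 * D.kθ ^ 2 * w ^ 2 / a / η) / w₁)) ?_ ?_
  · filter_upwards [eventually_ge_atTop s] with t ht
    refine Real.le_sqrt_of_sq_le ?_
    rw [le_div_iff₀ hw₁, mul_comm]
    exact (hVb t (hs.trans ht)).1.trans (hV1 t ht)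
  · have h1 := ((((tendsto_exp_neg_mul_sub hη s).mul_const
      (V s - 2 * D.kθ ^ 2 * w ^ 2 / a / η)).add_const
      (2 * D.kθ ^ 2 * w ^ 2 / a / η)).div_const w₁).sqrt
    have h2 : Real.sqrt ((0 * (V s - 2 * D.kθ ^ 2 * w ^ 2 / a / η) +
        2 * D.kθ ^ 2 * w ^ 2 / a / η) / w₁) = Real.sqrt (w₂ / w₁) * (2 * D.kθ * w / a) := by
      rw [← Real.sqrt_sq (show 0 ≤ 2 * D.kθ * w / a by positivity), ← Real.sqrt_mul (by positivity)]
      congr 1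
      rw [hη_def]
      field_simp
      ring
    rwa [h2] at h1

/-- Input-to-state stability of the parameter error, in terms of the squared norm. -/
theorem iss (hb : GainBounds S D R W w₁ w₂ c T₀) (hW : IsInverseGain S D R W)
    (h : IsClosedLoop S K D R 𝒞 𝒰) (hD : D.Valid) {η M : ℝ}
    (hη : η = (D.kθ * c + D.β1 * w₁) / (2 * w₂))
    (hM : M = (4 * D.kθ * |D.thetaBar| + 1) * (T₀ + 1 / η)) {t₀ t w : ℝ} (ht₀ : 0 ≤ t₀)
    (ht : t₀ ≤ t) (hw : ∀ s ∈ Icc t₀ t, ‖Qvec S D R s‖ ≤ w) :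
    ‖thetaErr D R t‖ ≤ Real.sqrt (w₂ * Real.exp (η * T₀) / w₁) * Real.exp (-(η / 2) * (t - t₀)) *
      ‖thetaErr D R t₀‖ + Real.sqrt (M / w₁) * Real.sqrt w := by
  obtain ⟨V, r, hV, hVb, hr0, hr⟩ := hb.exists_lyapunov hW h hD
  have hθ : ∀ s, 0 ≤ s → ‖thetaErr D R s‖ ≤ 2 * |D.thetaBar| := fun s hs =>
    (h.norm_thetaErr_le hD hs).trans (by linarith [le_abs_self D.thetaBar])
  obtain ⟨hκ, hk, hβ, -⟩ := hD
  have hw₁ := hb.w₁_pos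
  have hw₂ := hb.w₂_pos
  have hc := hb.c_pos
  have hT₀ := hb.T₀_nonneg
  have hw0 : 0 ≤ w := (norm_nonneg _).trans (hw t₀ ⟨le_rfl, ht⟩)
  -- Bounding `‖θ̃‖` by `2 θ̄` makes the disturbance term linear in `w`. The added `1` keeps `M`
  -- positive even when `θ̄ = 0`, so that the resulting gain function is strictly increasing.
  set B := 4 * D.kθ * |D.thetaBar| + 1
  have hB : 0 ≤ B := by positivity
  have hηpos : 0 < η := by rw [hη]; positivity
  have hV0 : ∀ s, 0 ≤ s → 0 ≤ V s := fun s hs => le_trans (by positivity) (hVb s hs).1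
  have hQ : ∀ s ∈ Icc t₀ t, 2 * D.kθ * ‖Qvec S D R s‖ * ‖thetaErr D R s‖ ≤ B * w :=
    fun s hs => by
      have h1 := hw s hs
      have h2 := hθ s (ht₀.trans hs.1)
      calc 2 * D.kθ * ‖Qvec S D R s‖ * ‖thetaErr D R s‖ ≤ 2 * D.kθ * w * (2 * |D.thetaBar|) := by
            gcongr
        _ ≤ B * w := by simp only [B]; linarith
  have early : ∀ s, t₀ ≤ s → s ≤ t → V s ≤ V t₀ + B * w * (s - t₀) := fun s h1 h2 =>
    hV.le_add_mul ht₀ h1 fun τ hτ =>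
      (hr0 τ (ht₀.trans hτ.1)).trans (hQ τ ⟨hτ.1, hτ.2.trans h2⟩)
  have late : ∀ s, t₀ ≤ s → T₀ ≤ s → s ≤ t →
      V t ≤ Real.exp (-η * (t - s)) * V s + B * w * (1 / η) := fun s h1 h2 h3 => by
    have h4 := hV.gronwall (η := η) (b := B * w) hηpos.ne' (ht₀.trans h1) h3 fun τ hτ => by
      have h5 := hr τ (h2.trans hτ.1)
      have h6 := hQ τ ⟨h1.trans hτ.1, hτ.2⟩
      have h7 := (hVb τ (hT₀.trans (h2.trans hτ.1))).2
      have h8 : η * V τ ≤ (D.kθ * c + D.β1 * w₁) * ‖thetaErr D R τ‖ ^ 2 := by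
        calc η * V τ ≤ η * (w₂ * ‖thetaErr D R τ‖ ^ 2) := by gcongr
          _ = (D.kθ * c + D.β1 * w₁) / 2 * ‖thetaErr D R τ‖ ^ 2 := by rw [hη]; field_simp
          _ ≤ _ := by gcongr; exact half_le_self (by positivity)
      linarith
    have h5 : 0 ≤ Real.exp (-η * (t - s)) * (B * w / η) := by positivity
    rw [mul_sub] at h4
    have h6 : B * w * (1 / η) = B * w / η := by ring
    linarith
  -- Before `T₀`, `V` may fail to decay, which the factor `exp (η T₀)` absorbs, and it grows by at
  -- most `B w T₀`; afterwards the disturbance adds at most `B w / η`.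
  have key : V t ≤ Real.exp (η * T₀) * Real.exp (-η * (t - t₀)) * V t₀ + M * w := by
    have hMw : M * w = B * w * T₀ + B * w * (1 / η) := by rw [hM]; ring
    have hBw : 0 ≤ B * w := by positivity
    have hBη : 0 ≤ B * w * (1 / η) := by positivity
    have hBT : 0 ≤ B * w * T₀ := by positivity
    have hVt := hV0 t₀ ht₀
    rw [← Real.exp_add]
    rcases le_total t T₀ with h1 | h1
    · have h2 := early t ht le_rfl
      have h3 : 1 ≤ Real.exp (η * T₀ + -η * (t - t₀)) := Real.one_le_exp (by nlinarith)
      nlinarith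
    · rcases le_total t₀ T₀ with h2 | h2
      · have h3 := late T₀ h2 le_rfl h1
        have h4 := early T₀ h2 h1
        have h5 : Real.exp (-η * (t - T₀)) ≤ Real.exp (η * T₀ + -η * (t - t₀)) :=
          Real.exp_le_exp.2 (by nlinarith)
        have h6 : Real.exp (-η * (t - T₀)) ≤ 1 := Real.exp_le_one_iff.2 (by nlinarith)
        have h7 : Real.exp (-η * (t - T₀)) * V T₀ ≤
            Real.exp (-η * (t - T₀)) * (V t₀ + B * w * (T₀ - t₀)) := by gcongr
        have h8 : Real.exp (-η * (t - T₀)) * V t₀ ≤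
            Real.exp (η * T₀ + -η * (t - t₀)) * V t₀ := by gcongr
        have h9 : Real.exp (-η * (t - T₀)) * (B * w * (T₀ - t₀)) ≤ B * w * (T₀ - t₀) :=
          mul_le_of_le_one_left (mul_nonneg hBw (by linarith)) h6
        nlinarith
      · have h3 := late t₀ le_rfl h2 ht
        have h5 : Real.exp (-η * (t - t₀)) ≤ Real.exp (η * T₀ + -η * (t - t₀)) :=
          Real.exp_le_exp.2 (by nlinarith)
        nlinarith
  have hMpos : 0 ≤ M := by rw [hM]; positivity
  have h1 := (hVb t (ht₀.trans ht)).1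
  have h2 := (hVb t₀ ht₀).2
  have hsq : ‖thetaErr D R t‖ ^ 2 ≤ (Real.sqrt (w₂ * Real.exp (η * T₀) / w₁) *
      Real.exp (-(η / 2) * (t - t₀)) * ‖thetaErr D R t₀‖) ^ 2 +
      (Real.sqrt (M / w₁) * Real.sqrt w) ^ 2 := by
    rw [mul_pow, mul_pow, mul_pow, Real.sq_sqrt (by positivity), Real.sq_sqrt (by positivity),
      Real.sq_sqrt hw0, ← Real.exp_nat_mul]
    have h3 : ((2 : ℕ) : ℝ) * (-(η / 2) * (t - t₀)) = -η * (t - t₀) := by push_cast; ring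
    rw [h3]
    have h4 : w₂ * Real.exp (η * T₀) / w₁ * Real.exp (-η * (t - t₀)) * ‖thetaErr D R t₀‖ ^ 2 +
        M / w₁ * w = (Real.exp (η * T₀) * Real.exp (-η * (t - t₀)) *
          (w₂ * ‖thetaErr D R t₀‖ ^ 2) + M * w) / w₁ := by
      field_simp
    rw [h4, le_div_iff₀ hw₁, mul_comm]
    refine h1.trans (key.trans ?_)
    gcongr
  refine abs_le_of_sq_le_sq' (hsq.trans ?_) (by positivity) |>.2
  have h3 : 0 ≤ Real.sqrt (w₂ * Real.exp (η * T₀) / w₁) * Real.exp (-(η / 2) * (t - t₀)) *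
    ‖thetaErr D R t₀‖ := by positivity
  have h4 : 0 ≤ Real.sqrt (M / w₁) * Real.sqrt w := by positivity
  nlinarith [mul_nonneg h3 h4]

end GainBounds

end Stability

/-! ### Convergence of the high-gain observer. -/

section StateEstimator

variable {n m p q : ℕ} {S : Plant n m p q} {K : JacBounds n} {D : Tuning p}
  {R : Loop n m p q D.N} {𝒞 : Set (Vec n)} {𝒰 : Set (Vec m)}

/-- This is the upper left block of the matrix inequality, read as a quadratic form. -/
theorem SatisfiesLMI.inner_le {C : Mat q n} {O : Gains n q} (h : SatisfiesLMI K C O) (v : Vec n) :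
    2 * inner ℝ (app (K.A - O.L * C) v) (app O.P v) ≤ -(2 * O.α) * inner ℝ v (app O.P v) := by
  have h1 := (h.2.2.submatrix (e := (Sum.inl : Fin n → Fin n ⊕ Fin n)) Sum.inl_injective).posSemidef
  have h2 : (-(Matrix.fromBlocks
      ((K.A - O.L * C)ᵀ * O.P + O.P * (K.A - O.L * C) + (2 * O.α) • O.P)
      (O.P - (J21 K C O)ᵀ) (O.P - J21 K C O) (-J22 K))).submatrix Sum.inl Sum.inl =
      0 - ((K.A - O.L * C)ᵀ * O.P + O.P * (K.A - O.L * C) + (2 * O.α) • O.P) := by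
    ext i j
    simp
  rw [h2] at h1
  have h3 := h1.inner_nonneg v
  rw [sub_app, zero_app, add_app, add_app, smul_app, mul_app, mul_app, inner_sub_right,
    inner_zero_right, inner_add_right, inner_add_right, inner_smul_right, ← inner_app,
    ← inner_app_symm h.2.1.1 v, real_inner_comm (app (K.A - O.L * C) v) (app O.P v)] at h3
  linarith

/-- The perturbation of the linear part of the observer error dynamics. -/
noncomputable def observerPerturbation (S : Plant n m p q) (K : JacBounds n) (D : Tuning p)
    (R : Loop n m p q D.N) (t : ℝ) : Vec n :=
  (Ftheta S K (R.x t) R.θ - Ftheta S K (inj S D R R.gains.l1 t) (R.θh t)) +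
    (Fone S K (R.x t) - Fone S K (inj S D R R.gains.l2 t)) +
    (Gu S K (R.x t) (R.u t) - Gu S K (inj S D R R.gains.l3 t) (R.u t))

/-- The plant equals `A x + F_θ + F_1 + G_u`, as the shifts by `K_{•1} x` cancel against `A x`. -/
theorem plantRHS_sub_observerRHS (t : ℝ) : plantRHS S D R t - observerRHS S K D R t =
    app (K.A - R.gains.L * S.C) (xErr D R t) + observerPerturbation S K D R t := by
  simp only [plantRHS, observerRHS, observerPerturbation, Ftheta, Fone, Gu, xErr, yErr,
    JacBounds.A, add_app, sub_app, app_sub, mul_app]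
  abel

/-- A bound of the perturbation on the operating region. -/
noncomputable def perturbationBound (K : JacBounds n) (D : Tuning p) (B : ℝ) : ℝ :=
  2 * (‖K.Ky1‖ * B + B * |D.thetaBar| + (‖K.Kf1‖ * B + B) + (‖K.Kg1‖ * B + B * B))

theorem IsClosedLoop.norm_observerPerturbation_le (h : IsClosedLoop S K D R 𝒞 𝒰) (hD : D.Valid)
    {B : ℝ} (hB : PlantBound S 𝒞 𝒰 B) (hinj : InjectionsIn S D R 𝒞) {t : ℝ} (ht : 0 ≤ t) :
    ‖observerPerturbation S K D R t‖ ≤ perturbationBound K D B := by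
  have hB0 := hB.nonneg
  have happ : ∀ {k l : ℕ} (M : Mat k l) {v : Vec l} {a b : ℝ}, ‖M‖ ≤ a → ‖v‖ ≤ b → 0 ≤ a →
      ‖app M v‖ ≤ a * b := fun M v a b h1 h2 h3 =>
    (norm_app_le M v).trans (mul_le_mul h1 h2 (norm_nonneg _) h3)
  have hF : ∀ z ∈ 𝒞, ∀ ϑ : Vec p, ‖ϑ‖ ≤ D.thetaBar →
      ‖Ftheta S K z ϑ‖ ≤ ‖K.Ky1‖ * B + B * |D.thetaBar| := fun z hz ϑ hϑ => by
    refine (norm_add_le _ _).trans (add_le_add ?_ ?_)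
    · rw [norm_neg]
      exact happ _ le_rfl (hB.state z hz) (norm_nonneg _)
    · exact happ _ (hB.Y z hz) (hϑ.trans (le_abs_self _)) hB0
  have hF1 : ∀ z ∈ 𝒞, ‖Fone S K z‖ ≤ ‖K.Kf1‖ * B + B := fun z hz => by
    refine (norm_add_le _ _).trans (add_le_add ?_ (hB.f0 z hz))
    rw [norm_neg]
    exact happ _ le_rfl (hB.state z hz) (norm_nonneg _)
  have hG : ∀ z ∈ 𝒞, ∀ u ∈ 𝒰, ‖Gu S K z u‖ ≤ ‖K.Kg1‖ * B + B * B := fun z hz u hu => by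
    refine (norm_add_le _ _).trans (add_le_add ?_ (happ _ (hB.g z hz) (hB.input u hu) hB0))
    rw [norm_neg]
    exact happ _ le_rfl (hB.state z hz) (norm_nonneg _)
  obtain ⟨h1, h2, h3⟩ := hinj t ht
  have hx := h.x_mem t ht
  have hu := h.u_mem t ht
  unfold observerPerturbation perturbationBound
  refine (norm_add₃_le).trans ?_
  have e1 := norm_sub_le (Ftheta S K (R.x t) R.θ) (Ftheta S K (inj S D R R.gains.l1 t) (R.θh t))
  have e2 := norm_sub_le (Fone S K (R.x t)) (Fone S K (inj S D R R.gains.l2 t))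
  have e3 := norm_sub_le (Gu S K (R.x t) (R.u t)) (Gu S K (inj S D R R.gains.l3 t) (R.u t))
  linarith [hF _ hx _ h.theta_le, hF _ h1 _ (h.norm_thetaHat_le hD ht), hF1 _ hx, hF1 _ h2,
    hG _ hx _ hu, hG _ h3 _ hu]

/-- Exponential convergence of the observer error to a ball of radius inversely proportional to
the gain. -/
theorem IsClosedLoop.minEig_mul_norm_xErr_sq_le (h : IsClosedLoop S K D R 𝒞 𝒰) {Δ : ℝ}
    (hΔ : ∀ t, 0 ≤ t → ‖observerPerturbation S K D R t‖ ≤ Δ) {t : ℝ} (ht : 0 ≤ t) :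
    minEig R.gains.P * ‖xErr D R t‖ ^ 2 ≤ maxEig R.gains.P *
      (Real.exp (-R.gains.α * t) * ‖xErr D R 0‖ ^ 2 + Δ ^ 2 / R.gains.α ^ 2) := by
  obtain ⟨hα, hP, -⟩ := id h.lmi
  set α := R.gains.α
  set P := R.gains.P
  -- For `n = 0`, `maxEig` is `sSup ∅ = 0`; otherwise a unit vector shows that it is nonnegative.
  have hmax : 0 ≤ maxEig P * Δ ^ 2 := by
    rcases Nat.eq_zero_or_pos n with rfl | hn
    · simp [maxEig]
    · have h1 := le_maxEig_mul hP.1 (EuclideanSpace.single ⟨0, hn⟩ (1 : ℝ))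
      have h2 := hP.posSemidef.inner_nonneg (EuclideanSpace.single ⟨0, hn⟩ (1 : ℝ))
      have h3 := h2.trans h1
      rw [PiLp.norm_single] at h3
      exact mul_nonneg (by simpa using h3) (sq_nonneg _)
  have hV := (h.plant.sub h.observer).inner_app (W := fun _ => P) (U := fun _ => 0)
    (fun i j => solvesODE_const (P i j)) fun _ => hP.1
  have hG := hV.gronwall (η := α) (b := maxEig P * Δ ^ 2 / α) hα.ne' le_rfl ht fun τ hτ => by
    rw [plantRHS_sub_observerRHS]
    change 2 * inner ℝ (app (K.A - R.gains.L * S.C) (xErr D R τ) + observerPerturbation S K D R τ)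
      (app P (xErr D R τ)) + inner ℝ (xErr D R τ) (app 0 (xErr D R τ)) ≤
      -α * inner ℝ (xErr D R τ) (app P (xErr D R τ)) + maxEig P * Δ ^ 2 / α
    have h1 := h.lmi.inner_le (xErr D R τ)
    set e := xErr D R τ
    set d := observerPerturbation S K D R τ
    have h2 : inner ℝ d (app P d) ≤ maxEig P * Δ ^ 2 := by
      refine (le_maxEig_mul hP.1 d).trans ?_
      have h3 : ‖d‖ ^ 2 ≤ Δ ^ 2 := pow_le_pow_left₀ (norm_nonneg _) (hΔ τ hτ.1) 2
      rcases le_or_gt 0 (maxEig P) with h4 | h4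
      · gcongr
      · have : ‖d‖ ^ 2 * maxEig P ≤ 0 := mul_nonpos_of_nonneg_of_nonpos (sq_nonneg _) h4.le
        linarith
    -- Young's inequality in the metric of `P`: half of the contraction rate `2 α` is traded for
    -- `dᵀPd / α`.
    have h3 := hP.posSemidef.inner_nonneg (α • e - d)
    have h4 : inner ℝ e (app P d) = inner ℝ d (app P e) := by
      rw [← inner_app_symm hP.1, real_inner_comm]
    simp only [app_sub, app_smul, inner_sub_left, inner_sub_right, inner_smul_left,
      inner_smul_right, conj_trivial, h4] at h3
    have h5 : 2 * inner ℝ d (app P e) ≤ α * inner ℝ e (app P e) + maxEig P * Δ ^ 2 / α := by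
      rw [← sub_le_iff_le_add', le_div_iff₀ hα]
      linarith
    rw [inner_add_left, zero_app, inner_zero_right]
    change 2 * inner ℝ (app (K.A - R.gains.L * S.C) e) (app P e) ≤ -(2 * α) * inner ℝ e (app P e)
      at h1
    linarith
  change inner ℝ (xErr D R t) (app P (xErr D R t)) ≤ Real.exp (-α * (t - 0)) *
    (inner ℝ (xErr D R 0) (app P (xErr D R 0)) - maxEig P * Δ ^ 2 / α / α) +
      maxEig P * Δ ^ 2 / α / α at hG
  refine (minEig_mul_le hP.1 _).trans (hG.trans ?_)
  have h1 : Real.exp (-α * (t - 0)) * inner ℝ (xErr D R 0) (app P (xErr D R 0)) ≤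
      Real.exp (-α * (t - 0)) * (maxEig P * ‖xErr D R 0‖ ^ 2) := by
    gcongr
    exact le_maxEig_mul hP.1 _
  have h2 : 0 ≤ Real.exp (-α * (t - 0)) * (maxEig P * Δ ^ 2 / α / α) := by positivity
  rw [sub_zero] at *
  have h3 : maxEig P * (Real.exp (-α * t) * ‖xErr D R 0‖ ^ 2 + Δ ^ 2 / α ^ 2) =
      Real.exp (-α * t) * (maxEig P * ‖xErr D R 0‖ ^ 2) + maxEig P * Δ ^ 2 / α / α := by
    field_simp
  rw [h3, mul_sub]
  linarith

/-- A gain that is large compared to the condition number of `P` makes the observer error small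
from the first sampling time on. -/
theorem IsClosedLoop.norm_xErr_le (h : IsClosedLoop S K D R 𝒞 𝒰) (hD : D.Valid)
    {B : ℝ} (hB : PlantBound S 𝒞 𝒰 B) (hinj : InjectionsIn S D R 𝒞) {ε α₀ : ℝ} (hε : 0 < ε)
    (hα₀ : 0 < α₀) (hαε : 8 * B ^ 2 / D.tstar ^ 2 + perturbationBound K D B ^ 2 ≤ (α₀ * ε) ^ 2)
    (hα : α₀ * Real.sqrt (maxEig R.gains.P / minEig R.gains.P) ≤ R.gains.α) {t : ℝ}
    (ht : D.tstar ≤ t) : ‖xErr D R t‖ ≤ ε := by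
  rcases Nat.eq_zero_or_pos n with rfl | hn
  · rw [Subsingleton.elim (xErr D R t) 0, norm_zero]
    exact hε.le
  obtain ⟨hα1, hP, -⟩ := h.lmi
  have hts := hD.2.2.2.2.2.1
  have ht0 : 0 ≤ t := hts.le.trans ht
  have hmin := minEig_pos_of_posDef hn hP
  have h1 := h.minEig_mul_norm_xErr_sq_le (fun τ hτ => h.norm_observerPerturbation_le hD hB hinj hτ)
    ht0
  have hx0 : ‖xErr D R 0‖ ≤ 2 * B := by
    have h2 := norm_sub_le (R.x 0) (R.xh 0)
    have h3 := hB.state _ (h.x_mem 0 le_rfl)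
    have h4 := hB.state _ (h.xh_mem 0 le_rfl)
    unfold xErr
    linarith
  set α := R.gains.α
  set P := R.gains.P
  set Δ := perturbationBound K D B
  have hmax : 0 ≤ maxEig P := by
    have h1 := le_maxEig_mul hP.1 (EuclideanSpace.single ⟨0, hn⟩ (1 : ℝ))
    have h2 := hP.posSemidef.inner_nonneg (EuclideanSpace.single ⟨0, hn⟩ (1 : ℝ))
    simpa using h2.trans h1
  have hρ : 0 ≤ maxEig P / minEig P := div_nonneg hmax hmin.le
  have h2 : α₀ ^ 2 * (maxEig P / minEig P) ≤ α ^ 2 := by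
    have := pow_le_pow_left₀ (by positivity) hα 2
    rwa [mul_pow, Real.sq_sqrt hρ] at this
  -- From `y² / 2 ≤ exp y` at `y = α t*`. The transient thus scales like `1/α²`, as the perturbation
  -- term does, and with `‖x̃(0)‖ ≤ 2 B` it gives the summand `8 B² / t*²`.
  have h3 : Real.exp (-α * t) ≤ 2 / (α ^ 2 * D.tstar ^ 2) := by
    have h4 : Real.exp (-α * t) ≤ Real.exp (-(α * D.tstar)) := Real.exp_le_exp.2 (by nlinarith)
    refine h4.trans ?_
    have hy : 0 < α * D.tstar := by positivity
    have h5 := Real.quadratic_le_exp_of_nonneg hy.le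
    rw [Real.exp_neg, ← mul_pow, inv_le_comm₀ (Real.exp_pos _) (by positivity), inv_div]
    linarith
  have h4 : Real.exp (-α * t) * ‖xErr D R 0‖ ^ 2 + Δ ^ 2 / α ^ 2 ≤ (α₀ * ε) ^ 2 / α ^ 2 := by
    calc Real.exp (-α * t) * ‖xErr D R 0‖ ^ 2 + Δ ^ 2 / α ^ 2
        ≤ 2 / (α ^ 2 * D.tstar ^ 2) * (2 * B) ^ 2 + Δ ^ 2 / α ^ 2 := by gcongr
      _ = (8 * B ^ 2 / D.tstar ^ 2 + Δ ^ 2) / α ^ 2 := by field_simp; ring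
      _ ≤ _ := by gcongr
  have h5 : ‖xErr D R t‖ ^ 2 ≤ ε ^ 2 := by
    have h6 : ‖xErr D R t‖ ^ 2 ≤ maxEig P / minEig P * ((α₀ * ε) ^ 2 / α ^ 2) := by
      rw [div_mul_eq_mul_div, le_div_iff₀ hmin, mul_comm]
      exact h1.trans (mul_le_mul_of_nonneg_left h4 hmax)
    refine h6.trans ?_
    rw [← mul_div_assoc, div_le_iff₀ (by positivity)]
    calc maxEig P / minEig P * (α₀ * ε) ^ 2 = (α₀ ^ 2 * (maxEig P / minEig P)) * ε ^ 2 := by ring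
      _ ≤ α ^ 2 * ε ^ 2 := by gcongr
      _ = _ := by ring
  exact (abs_le_of_sq_le_sq' h5 hε.le).2

end StateEstimator

/-! ### The main theorem: choice of uniform constants and assembly. -/

theorem theorem2 {n m p q : ℕ} (S : Plant n m p q) (K : JacBounds n) (D : Tuning p)
    (𝒞 : Set (Vec n)) (𝒰 : Set (Vec m))
    (h𝒞 : IsCompact 𝒞) (h𝒞' : Convex ℝ 𝒞) (h𝒰 : Bornology.IsBounded 𝒰)
    (hJ : JacobianBounded S K 𝒞 𝒰 (Metric.closedBall 0 D.thetaBar))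
    (hD : D.Valid) (c₀ τ₀ : ℝ) (hc₀ : 0 < c₀) :
    ∃ (Le Γl Γu c a : ℝ) (β : ℝ → ℝ → ℝ) (γ : ℝ → ℝ),
      0 < Le ∧ 0 < Γl ∧ 0 < Γu ∧ 0 < c ∧ a = D.kθ * c + D.β1 / Γu ∧
      IsClassKL β ∧ IsClassK γ ∧
      (∀ R : Loop n m p q D.N, IsClosedLoop S K D R 𝒞 𝒰 → FinitelyInformative S D R →
        ExcitedThroughTwoPurges S D R c₀ τ₀ →
        (∀ t : ℝ, 0 ≤ t → ‖R.θh t‖ ≤ D.thetaBar) ∧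
        (∀ t : ℝ, 0 ≤ t →
          (R.Γ t - Γl • (1 : Mat p p)).PosSemidef ∧ (Γu • (1 : Mat p p) - R.Γ t).PosSemidef) ∧
        (∀ t : ℝ, 0 ≤ t → τ₀ ≤ t → c ≤ minEig (PsiMat S D R t)) ∧
        (∀ t e : ℝ, D.T ≤ t → (∀ s ∈ Icc (t - D.T) t, ‖xErr D R s‖ ≤ e) →
          ‖residualErr S D R t‖ ≤ Le * e) ∧
        (∀ t₀ t w : ℝ, 0 ≤ t₀ → t₀ ≤ t → (∀ s ∈ Icc t₀ t, ‖Qvec S D R s‖ ≤ w) →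
          ‖thetaErr D R t‖ ≤ β ‖thetaErr D R t₀‖ (t - t₀) + γ (Real.sqrt w)) ∧
        (∀ w : ℝ, (∀ᶠ t in atTop, ‖Qvec S D R t‖ ≤ w) →
          LimsupLE (fun t => ‖thetaErr D R t‖) (Real.sqrt (Γu / Γl) * (4 * D.kθ * w / a))) ∧
        (∀ e : ℝ, 0 ≤ e → (∀ᶠ t in atTop, RecordedWithin D R e t) →
          LimsupLE (fun t => ‖thetaErr D R t‖)
            (Real.sqrt (Γu / (D.κ * Γl)) * (2 * D.kθ * D.N * Le / a) * e))) ∧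
      (∀ ε : ℝ, 0 < ε → ∃ α₀ : ℝ, 0 < α₀ ∧
        ∀ R : Loop n m p q D.N, IsClosedLoop S K D R 𝒞 𝒰 → FinitelyInformative S D R →
          ExcitedThroughTwoPurges S D R c₀ τ₀ → InjectionsIn S D R 𝒞 →
          α₀ * Real.sqrt (maxEig R.gains.P / minEig R.gains.P) ≤ R.gains.α →
          (∀ t : ℝ, D.tstar ≤ t → ‖xErr D R t‖ ≤ ε) ∧
          LimsupLE (fun t => ‖thetaErr D R t‖)
            (Real.sqrt (Γu / (D.κ * Γl)) * (2 * D.kθ * D.N * Le / a) * ε)) := by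
  obtain ⟨B, hB⟩ := hJ.exists_plantBound h𝒞 h𝒰
  obtain ⟨g, hg, hg0⟩ := (hD.2.2.2.1.inv : D.Γ0⁻¹.PosDef).exists_pos_mul_le
  obtain ⟨hκ, hk, hβ, -, hT, hts, -, hξ, -⟩ := id hD
  -- `B T` bounds the recorded regressors; `ξ` is the loss that later purges may cause.
  have hc : 0 < D.ξ * c₀ / (1 + D.κ * (B * D.T) ^ 2) := by positivity
  set c := D.ξ * c₀ / (1 + D.κ * (B * D.T) ^ 2) with hc_def
  have hw₂ : 0 < ‖D.Γ0⁻¹‖ + D.kθ * (D.N / D.κ) / D.β1 + 1 := by positivity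
  set w₂ := ‖D.Γ0⁻¹‖ + D.kθ * (D.N / D.κ) / D.β1 + 1 with hw₂_def
  have hw₁ : 0 < min (Real.exp (-D.β1 * max τ₀ 0) * g) (D.kθ * c / D.β1) :=
    lt_min (mul_pos (Real.exp_pos _) hg) (by positivity)
  have hw₁β : D.β1 * min (Real.exp (-D.β1 * max τ₀ 0) * g) (D.kθ * c / D.β1) ≤ D.kθ * c := by
    calc _ ≤ D.β1 * (D.kθ * c / D.β1) := by gcongr; exact min_le_right _ _
      _ = D.kθ * c := by field_simp
  set w₁ := min (Real.exp (-D.β1 * max τ₀ 0) * g) (D.kθ * c / D.β1) with hw₁_def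
  have hLe : 0 < plantLipschitz m p K * D.T + 2 := by
    have := plantLipschitz_nonneg m p K
    positivity
  set Le := plantLipschitz m p K * D.T + 2 with hLe_def
  have ha : D.kθ * c + D.β1 / (1 / w₁) = D.kθ * c + D.β1 * w₁ := by rw [div_div_eq_mul_div, div_one]
  have ha0 : 0 < D.kθ * c + D.β1 * w₁ := by positivity
  have hratio : 1 / w₁ / (1 / w₂) = w₂ / w₁ := by field_simp
  have hη : 0 < (D.kθ * c + D.β1 * w₁) / (2 * w₂) := by positivity
  set η := (D.kθ * c + D.β1 * w₁) / (2 * w₂) with hη_def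
  have hT₀ : 0 ≤ max τ₀ 0 := le_max_right _ _
  have hM : 0 < (4 * D.kθ * |D.thetaBar| + 1) * (max τ₀ 0 + 1 / η) := by positivity
  set M := (4 * D.kθ * |D.thetaBar| + 1) * (max τ₀ 0 + 1 / η) with hM_def
  have hexc : ∀ R : Loop n m p q D.N, IsClosedLoop S K D R 𝒞 𝒰 →
      ExcitedThroughTwoPurges S D R c₀ τ₀ → ∀ t : ℝ, τ₀ ≤ t → c ≤ minEig (PsiMat S D R t) :=
    fun R h he t ht => h.le_minEig_PsiMat hD (fun t ht => norm_Yhat_le h hJ hT hB ht)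
      (mul_nonneg hB.nonneg hT) he ht
  have hgain : ∀ R : Loop n m p q D.N, IsClosedLoop S K D R 𝒞 𝒰 →
      ExcitedThroughTwoPurges S D R c₀ τ₀ →
      ∃ W, IsInverseGain S D R W ∧ GainBounds S D R W w₁ w₂ c (max τ₀ 0) := fun R h he => by
    obtain ⟨W, hW⟩ := h.exists_isInverseGain hD
    exact ⟨W, hW, hw₁, hw₂, hc, hT₀, hw₁β,
      fun t ht v => hW.min_mul_le_inner h hD hg hg0 (fun t _ => hexc R h he t) ht v,
      fun t ht v => hW.inner_le h hD ht v,
      fun t ht => hexc R h he t ((le_max_left _ _).trans ht)⟩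
  have hres : ∀ R : Loop n m p q D.N, IsClosedLoop S K D R 𝒞 𝒰 → ∀ t e : ℝ, D.T ≤ t →
      (∀ s ∈ Icc (t - D.T) t, ‖xErr D R s‖ ≤ e) → ‖residualErr S D R t‖ ≤ Le * e :=
    fun R h t e ht he => norm_residualErr_le h hJ h𝒞' hT hB ht he
  have hult : ∀ R : Loop n m p q D.N, IsClosedLoop S K D R 𝒞 𝒰 →
      ExcitedThroughTwoPurges S D R c₀ τ₀ → ∀ e : ℝ, 0 ≤ e →
      (∀ᶠ t in atTop, RecordedWithin D R e t) → LimsupLE (fun t => ‖thetaErr D R t‖)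
        (Real.sqrt (1 / w₁ / (D.κ * (1 / w₂))) *
          (2 * D.kθ * D.N * Le / (D.kθ * c + D.β1 * w₁)) * e) := fun R h he e he0 hrec => by
    obtain ⟨W, hW, hb⟩ := hgain R h he
    refine (hb.limsupLE hW h hD (w := D.N * (Le * e) / (2 * Real.sqrt D.κ))
      (hrec.mono fun t ht => norm_Qvec_le h hD hLe.le he0 (hres R h) ht)).mono ?_
    have hs : Real.sqrt (1 / w₁ / (D.κ * (1 / w₂))) = Real.sqrt (w₂ / w₁) / Real.sqrt D.κ := by
      rw [← Real.sqrt_div (by positivity)]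
      congr 1
      field_simp
    have hsκ := Real.sqrt_pos.2 hκ
    rw [hs]
    -- The claimed bound is twice what the Lyapunov estimate gives.
    have h1 : Real.sqrt (w₂ / w₁) / Real.sqrt D.κ *
        (2 * D.kθ * D.N * Le / (D.kθ * c + D.β1 * w₁)) * e =
        2 * (Real.sqrt (w₂ / w₁) * (2 * D.kθ * (D.N * (Le * e) / (2 * Real.sqrt D.κ)) /
          (D.kθ * c + D.β1 * w₁))) := by
      field_simp
    rw [h1]
    have h2 : 0 ≤ Real.sqrt (w₂ / w₁) * (2 * D.kθ * (D.N * (Le * e) / (2 * Real.sqrt D.κ)) /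
        (D.kθ * c + D.β1 * w₁)) := by positivity
    linarith
  -- The gain bounds are the reciprocals of those of `W`, so `Γu / Γl = w₂ / w₁` and `β₁ / Γu = β₁
  -- w₁`.
  refine ⟨Le, 1 / w₂, 1 / w₁, c, D.kθ * c + D.β1 / (1 / w₁),
    fun r s => Real.sqrt (w₂ * Real.exp (η * max τ₀ 0) / w₁) * Real.exp (-(η / 2) * s) * r,
    fun r => Real.sqrt (M / w₁) * r, hLe, by positivity, by positivity, hc, rfl,
    isClassKL_exp (Real.sqrt_pos.2 (by positivity)) (half_pos hη),
    isClassK_mul (Real.sqrt_pos.2 (by positivity)), fun R h _ he => ?_, fun ε hε => ?_⟩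
  · obtain ⟨W, hW, hb⟩ := hgain R h he
    refine ⟨fun t ht => h.norm_thetaHat_le hD ht, fun t ht => ?_,
      fun t _ ht => hexc R h he t ht, hres R h, fun t₀ t w ht₀ ht hw => ?_, fun w hw => ?_,
      fun e he0 hrec => ?_⟩
    · have hΓ := (hW.isHermitian t).of_mul_eq_one (hW.mul_eq_one t ht)
      refine ⟨sub_smul_one_posSemidef hΓ (div_le_inner_app_of_mul_eq_one (hW.isHermitian t)
        (hW.mul_eq_one t ht) hw₂ (hb.upper t ht) fun v => le_trans (by positivity)
          (hb.lower t ht v)), smul_one_sub_posSemidef hΓ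
        (inner_app_le_of_mul_eq_one (hW.mul_eq_one t ht) hw₁ (hb.lower t ht))⟩
    · exact hb.iss hW h hD hη_def hM_def ht₀ ht hw
    · refine (hb.limsupLE hW h hD hw).mono ?_
      obtain ⟨t, ht⟩ := hw.exists
      have hw0 : 0 ≤ w := (norm_nonneg _).trans ht
      rw [hratio, ha]
      gcongr
      norm_num
    · rw [ha]
      exact hult R h he e he0 hrec
  · set C := 8 * B ^ 2 / D.tstar ^ 2 + perturbationBound K D B ^ 2
    have hC : 0 ≤ C := by positivity
    -- Chosen so that `(α₀ ε)² = (√C + 1)² ≥ C`, with `α₀` positive even if `C = 0`.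
    refine ⟨(Real.sqrt C + 1) / ε, by positivity, fun R h _ he hinj hα => ?_⟩
    have hx : ∀ t : ℝ, D.tstar ≤ t → ‖xErr D R t‖ ≤ ε := fun t ht =>
      h.norm_xErr_le hD hB hinj hε (by positivity) (by
        rw [div_mul_cancel₀ _ hε.ne', ← Real.sq_sqrt hC]
        have := Real.sqrt_nonneg C
        rw [Real.sq_sqrt hC]
        nlinarith [Real.sq_sqrt hC]) hα ht
    refine ⟨hx, ?_⟩
    rw [ha]
    refine hult R h he ε hε.le ?_
    -- The data in use have `τ ≥ T + t*`, so their windows `[τ - T, τ]` lie after `t*`, where the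
    -- observer error is already at most `ε`.
    filter_upwards [eventually_ge_atTop τ₀] with t ht i τ hi s hs
    exact hx s (by linarith [hs.1, h.activeStack_time_of_purged hD he ht hi])
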